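/- Let $M_n=(m_{ij})$ be an $n\times n$ real symmetric random matrix with $m_{ij}=m_{ji}=\delta_{ij}\xi_{ij}$ for $i\le j$, where the $\delta_{ij}$ are Bernoulli random variables with $\mathbb P(\delta_{ij}=1)=p\in(0,1]$ and $\mathbb P(\delta_{ij}=0)=1-p$, the $\xi_{ij}$ are identically distributed with mean zero, variance one and subgaussian moment at most $B>0$ (that is, $\mathbb P(|\xi_{ij}|>t)\le 2\exp(-t^2/B^2)$ for all $t>0$), and all the $\delta_{ij}$, $\xi_{ij}$ ($i\le j$) are jointly independent. For $M\in\mathbb N$ and $r>0$ let $$\mathrm{Comp}(M,r)=\{x\in\mathbb R^n:\ \|x\|_2=1,\ \exists\, y\in\mathbb R^n \text{ with } |\mathrm{supp}(y)|\le M \text{ and } \|x-y\|_2\le r\}.$$ For all $B>0$ and $K>0$ there exist constants $C_0,C,c,c',c''>0$ and $\bar C>1$, depending only on $B$ and $K$, such that the following holds for all $n$, $p$ and $M\in\mathbb N$ with $$p\ge \frac{C_0\log n}{n},\qquad p^{-1}\le M\le cn .$$ Put $$\ell_0=\left\lceil\frac{\log (1/(8p))}{\log\sqrt{pn}}\right\rceil,\qquad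 \rho=\bar C^{-\ell_0-6}.$$ 1. For every fixed $\lambda\in[-K\sqrt{pn},K\sqrt{pn}]$, $$\mathbb P\bigl(\exists\, x\in\mathrm{Comp}(M,\rho):\ \|(M_n-\lambda)x\|_2\le C\rho\sqrt{pn}\bigr)\le \exp(-c'pn).$$ 2. $$\mathbb P\bigl(M_n \text{ has a unit eigenvector in } \mathrm{Comp}(M,\rho)\bigr)\le\exp(-c''pn).$$ -/

import Mathlib

open MeasureTheory ProbabilityTheory

namespace SparseRandomMatrix

/-- The subgaussian moment of the real random variable `X` is bounded by `B`:
`P(|X| > t) ≤ 2 exp(-t² / B²)` for all `t > 0` (used with `B > 0`). -/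
def SubgaussianMomentLE {Ω : Type*} [MeasurableSpace Ω] (P : Measure Ω) (X : Ω → ℝ) (B : ℝ) :
    Prop :=
  ∀ t : ℝ, 0 < t → P.real {ω | t < |X ω|} ≤ 2 * Real.exp (-(t ^ 2 / B ^ 2))

/-- The random variables that define an `n × n` sparse symmetric random matrix. They are indexed by
the unordered pairs `s(i, j)`, including `i = j`, that is, by the positions `i ≤ j`.
The `δ e` are Bernoulli with parameter `p`; the `ξ e` are identically distributed with mean zero,
variance one and subgaussian moment at most `B`; and all of these variables, the `δ`'s together with
the `ξ`'s, are independent. -/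
structure IsSparseModel {Ω : Type*} [MeasurableSpace Ω] (P : Measure Ω) (n : ℕ) (p B : ℝ)
    (δ ξ : Sym2 (Fin n) → Ω → ℝ) : Prop where
  measurable_delta : ∀ e, Measurable (δ e)
  measurable_xi : ∀ e, Measurable (ξ e)
  indep : iIndepFun (Sum.elim δ ξ) P
  delta_zero_or_one : ∀ e, ∀ᵐ ω ∂P, δ e ω = 0 ∨ δ e ω = 1
  delta_prob : ∀ e, P.real {ω | δ e ω = 1} = p
  xi_identDistrib : ∀ e e', IdentDistrib (ξ e) (ξ e') P P
  xi_mean : ∀ e, ∫ ω, ξ e ω ∂P = 0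
  xi_variance : ∀ e, variance (ξ e) P = 1
  xi_subgaussian : ∀ e, SubgaussianMomentLE P (ξ e) B

/-- The symmetric random matrix `M_n` with entries `m_{ij} = δ_{ij} ξ_{ij}`. -/
def sparseMatrix {Ω : Type*} {n : ℕ} (δ ξ : Sym2 (Fin n) → Ω → ℝ) (ω : Ω) :
    Matrix (Fin n) (Fin n) ℝ :=
  Matrix.of fun i j => δ s(i, j) ω * ξ s(i, j) ω

/-- `Sparse(M)`: the vectors with at most `M` nonzero coordinates. -/
def Sparse (n M : ℕ) : Set (EuclideanSpace ℝ (Fin n)) :=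
  {y | {i | y i ≠ 0}.ncard ≤ M}

/-- `Comp(M, r)`: the unit vectors at Euclidean distance at most `r` from `Sparse(M)`. -/
def Comp (n M : ℕ) (r : ℝ) : Set (EuclideanSpace ℝ (Fin n)) :=
  {x | ‖x‖ = 1 ∧ ∃ y ∈ Sparse n M, ‖x - y‖ ≤ r}

/-- `ℓ₀ = ⌈log(1 / (8p)) / log √(pn)⌉`. -/
noncomputable def ellZero (n : ℕ) (p : ℝ) : ℤ :=
  ⌈Real.log (1 / (8 * p)) / Real.log (Real.sqrt (p * n))⌉

/-- `ρ = D ^ (-ℓ₀ - 6)`. -/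
noncomputable def rho (D : ℝ) (n : ℕ) (p : ℝ) : ℝ :=
  D ^ (-ellZero n p - 6)

end SparseRandomMatrix

/-! Write d = pn and L = M_n - λ. Two properties of the matrix hold outside an event of probability
exp(-c d).

(a) ‖M_n‖ ≤ K₀√d (`IsSparseModel.norm_le`). This is the trace method with k of order d. Grouping
closed walks by their pattern of coincidences compares E tr M_n^(2k) with the same moment of a dense
matrix of size 2k (`sum_walkWeight_le`). Its entries follow a centered subgaussian law with
dominating moments (`exists_dominating_law`), and a net argument bounds its norm.

(b) `HasStructure`: for column sets J ⊆ T with |T| ≤ 2√d |J| and |T|p small, of order |J|d rows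
outside T have exactly one nonzero entry among the columns of T, and that entry is at least 1/2 and
lies in a column of J. This follows from Chernoff bounds and a union bound.

On these events let Lx be tiny for a unit vector x, and order the coordinates of x by modulus. On a
row from (b), Lx sees one coordinate of x plus the contribution of the coordinates outside T.
Summing over such rows bounds the mass beyond rank k by a constant times the mass beyond rank √d·k
(`HasStructure.tail_le`). About ℓ₀ such steps climb from rank 1 to rank 1/p, each costing a factor D
in norm. So, off its roughly 1/p largest coordinates, x has norm τ ≥ D^(-ℓ₀)
(`HasStructure.exists_core`). This is why ρ is a power of D with exponent of order -ℓ₀: relative to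
τ the compressibility error is still at most ε.

Rescaled by 1/τ, the vector is spread: either about 1/p coordinates are of order at least √p, or a
part of norm one has all its coordinates O(√p). In both cases a row misses a neighbourhood of 0 of
size √p with constant probability, so ‖Ly‖ is at least a constant times √d outside probability
exp(-c n) (`IsSparseModel.measureReal_norm_le_of_isSpread`). A lattice net finishes the fixed λ
statement. The large coordinates may have norm D^ℓ₀ but number at most about 1/p, which p ≥ C₀ log n
/ n makes affordable; the other M coordinates have norm at most 1 and M ≤ cn.

For eigenvectors, λ is rounded to a mesh of size ρ√d in [-K₀√d, K₀√d]; the exp(O(ℓ₀)) mesh points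
are absorbed by the probability bound (`measureReal_exists_eigenvector_le`). -/

namespace SparseRandomMatrix

open scoped NNReal ENNReal

/-! ### Subgaussian variables and the Paley–Zygmund inequality. -/

section Subgaussian

variable {Ω : Type*} [MeasurableSpace Ω] {P : Measure Ω}

/-- The linear term has expectation zero for a centered variable, which leaves a bound of the moment
generating function by square-exponential moments. -/
theorem exp_le_add_exp_sq (x : ℝ) : Real.exp x ≤ x + Real.exp (x ^ 2) := by
  have h1 := Real.add_one_le_exp (x ^ 2)
  rcases le_or_gt |x| 1 with h | h
  · have := (abs_le.1 (Real.abs_exp_sub_one_sub_id_le h)).2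
    linarith
  · rcases lt_or_ge x 0 with hx | hx
    · rw [abs_of_neg hx] at h
      have : Real.exp x ≤ 1 := Real.exp_le_one_iff.2 hx.le
      nlinarith
    · rw [abs_of_nonneg hx] at h
      have : Real.exp x ≤ Real.exp (x ^ 2) := Real.exp_le_exp.2 (by nlinarith)
      linarith

/-- A subgaussian tail bound gives square-exponential integrability. -/
theorem SubgaussianMomentLE.lintegral_exp_sq_le [IsProbabilityMeasure P] {X : Ω → ℝ} {B : ℝ}
    (hB : 0 < B) (hX : Measurable X) (h : SubgaussianMomentLE P X B) :
    ∫⁻ ω, ENNReal.ofReal (Real.exp (X ω ^ 2 / (2 * B ^ 2))) ∂P ≤ 3 := by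
  have hB2 : (0 : ℝ) < B ^ 2 := by positivity
  -- Layer cake with `g` the derivative of exp(t²/(2B²)). Multiplied by the tail bound, `g` becomes
  -- `f`, the derivative of -2 exp(-t²/(2B²)), of total mass 2; the value 1 at t = 0 gives 3.
  set g : ℝ → ℝ := fun t => (t / B ^ 2) * Real.exp (t ^ 2 / (2 * B ^ 2)) with hg
  have hgc : Continuous g := by fun_prop
  have hG : ∀ x : ℝ, ∫ t in (0 : ℝ)..x, g t = Real.exp (x ^ 2 / (2 * B ^ 2)) - 1 := by
    intro x
    have hd : ∀ t : ℝ, HasDerivAt (fun t => Real.exp (t ^ 2 / (2 * B ^ 2))) (g t) t := by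
      intro t
      have := ((hasDerivAt_pow 2 t).div_const (2 * B ^ 2)).exp
      convert this using 1
      change (t / B ^ 2) * Real.exp (t ^ 2 / (2 * B ^ 2)) = _
      push_cast
      field_simp
    rw [intervalIntegral.integral_eq_sub_of_hasDerivAt (fun t _ => hd t) (hgc.intervalIntegrable _ _)]
    simp
  have key := lintegral_comp_eq_lintegral_meas_lt_mul P (f := fun ω => |X ω|) (g := g)
    (Filter.Eventually.of_forall fun ω => abs_nonneg _) (by fun_prop)
    (fun t _ => hgc.intervalIntegrable _ _)
    (by
      filter_upwards [ae_restrict_mem measurableSet_Ioi] with t ht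
      have : 0 < t := ht
      positivity)
  have hint : ∫⁻ t in Set.Ioi (0 : ℝ), P {a | t < |X a|} * ENNReal.ofReal (g t) ≤ 2 := by
    set f : ℝ → ℝ := fun t => (2 * t / B ^ 2) * Real.exp (-(t ^ 2 / (2 * B ^ 2))) with hf
    have hle : ∫⁻ t in Set.Ioi (0 : ℝ), P {a | t < |X a|} * ENNReal.ofReal (g t) ≤
        ∫⁻ t in Set.Ioi (0 : ℝ), ENNReal.ofReal (f t) := by
      refine lintegral_mono_ae ?_
      filter_upwards [ae_restrict_mem measurableSet_Ioi] with t ht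
      have ht0 : 0 < t := ht
      have h1 := h t ht0
      have h2 : P {a | t < |X a|} = ENNReal.ofReal (P.real {a | t < |X a|}) := by simp
      rw [h2, ← ENNReal.ofReal_mul measureReal_nonneg]
      refine ENNReal.ofReal_le_ofReal ?_
      calc P.real {a | t < |X a|} * g t ≤ (2 * Real.exp (-(t ^ 2 / B ^ 2))) * g t := by
            gcongr
        _ = (2 * t / B ^ 2) * (Real.exp (-(t ^ 2 / B ^ 2)) * Real.exp (t ^ 2 / (2 * B ^ 2))) := by
            simp only [hg]; ring
        _ = f t := by
            rw [← Real.exp_add]; simp only [hf]; congr 2; field_simp; norm_num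
    refine hle.trans ?_
    have hd : ∀ t ∈ Set.Ici (0 : ℝ),
        HasDerivAt (fun t => -2 * Real.exp (-(t ^ 2 / (2 * B ^ 2)))) (f t) t := by
      intro t _
      have := (((hasDerivAt_pow 2 t).div_const (2 * B ^ 2)).fun_neg.exp).const_mul (-2)
      refine this.congr_deriv (Eq.symm ?_)
      change (2 * t / B ^ 2) * Real.exp (-(t ^ 2 / (2 * B ^ 2))) = _
      push_cast
      field_simp
    have hpos : ∀ t ∈ Set.Ioi (0 : ℝ), 0 ≤ f t := by
      intro t ht
      have : 0 < t := ht
      simp only [hf]; positivity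
    have hlim : Filter.Tendsto (fun t : ℝ => -2 * Real.exp (-(t ^ 2 / (2 * B ^ 2)))) Filter.atTop
        (nhds (-2 * 0)) := by
      refine Filter.Tendsto.const_mul _ ?_
      refine Real.tendsto_exp_neg_atTop_nhds_zero.comp ?_
      exact (Filter.tendsto_pow_atTop (by norm_num)).atTop_div_const (by positivity)
    rw [← ofReal_integral_eq_lintegral_ofReal (integrableOn_Ioi_deriv_of_nonneg' hd hpos hlim)
      ((ae_restrict_mem measurableSet_Ioi).mono hpos),
      integral_Ioi_of_hasDerivAt_of_nonneg' hd hpos hlim]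
    norm_num
  calc ∫⁻ ω, ENNReal.ofReal (Real.exp (X ω ^ 2 / (2 * B ^ 2))) ∂P
      = ∫⁻ ω, (ENNReal.ofReal (∫ t in (0 : ℝ)..|X ω|, g t) + 1) ∂P := by
        refine lintegral_congr fun ω => ?_
        rw [hG, sq_abs, ← ENNReal.ofReal_one, ← ENNReal.ofReal_add _ zero_le_one]
        · simp
        · have := Real.add_one_le_exp (X ω ^ 2 / (2 * B ^ 2))
          have : 0 ≤ X ω ^ 2 / (2 * B ^ 2) := by positivity
          linarith
    _ = ∫⁻ ω, ENNReal.ofReal (∫ t in (0 : ℝ)..|X ω|, g t) ∂P + 1 := by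
        rw [lintegral_add_right _ measurable_const]; simp
    _ ≤ 2 + 1 := by rw [key]; gcongr
    _ = 3 := by norm_num

theorem SubgaussianMomentLE.integrable_exp_sq [IsProbabilityMeasure P] {X : Ω → ℝ} {B : ℝ}
    (hB : 0 < B) (hX : Measurable X) (h : SubgaussianMomentLE P X B) :
    Integrable (fun ω => Real.exp (X ω ^ 2 / (2 * B ^ 2))) P := by
  refine ⟨by fun_prop, ?_⟩
  rw [hasFiniteIntegral_iff_ofReal (Filter.Eventually.of_forall fun ω => (Real.exp_pos _).le)]
  exact (h.lintegral_exp_sq_le hB hX).trans_lt (by simp)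

theorem SubgaussianMomentLE.integral_exp_sq_le [IsProbabilityMeasure P] {X : Ω → ℝ} {B : ℝ}
    (hB : 0 < B) (hX : Measurable X) (h : SubgaussianMomentLE P X B) :
    ∫ ω, Real.exp (X ω ^ 2 / (2 * B ^ 2)) ∂P ≤ 3 := by
  rw [integral_eq_lintegral_of_nonneg_ae (Filter.Eventually.of_forall fun ω => (Real.exp_pos _).le)
    (by fun_prop)]
  exact ENNReal.toReal_le_of_le_ofReal (by norm_num)
    ((h.lintegral_exp_sq_le hB hX).trans (by simp))

/-- A centered random variable with square-exponential moments is subgaussian. -/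
theorem hasSubgaussianMGF_of_exp_sq [IsProbabilityMeasure P] {X : Ω → ℝ} {a K : ℝ} (ha : 0 < a)
    (hX : AEMeasurable X P) (hint : Integrable (fun ω => Real.exp (a * X ω ^ 2)) P)
    (hK : ∫ ω, Real.exp (a * X ω ^ 2) ∂P ≤ K) (hmean : ∫ ω, X ω ∂P = 0) :
    HasSubgaussianMGF X (Real.toNNReal (2 * K / a)) P := by
  have hK1 : 1 ≤ K := by
    refine le_trans ?_ hK
    have : ∫ ω, (1 : ℝ) ∂P ≤ ∫ ω, Real.exp (a * X ω ^ 2) ∂P :=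
      integral_mono (integrable_const _) hint fun ω => Real.one_le_exp (by positivity)
    simpa using this
  have hyoung : ∀ t x : ℝ, t * x ≤ t ^ 2 / (4 * a) + a * x ^ 2 := by
    intro t x
    have : 0 ≤ (t - 2 * a * x) ^ 2 / (4 * a) := by positivity
    have e : (t - 2 * a * x) ^ 2 / (4 * a) = t ^ 2 / (4 * a) + a * x ^ 2 - t * x := by
      field_simp; ring
    linarith
  have hI : ∀ t : ℝ, Integrable (fun ω => Real.exp (t * X ω)) P := by
    intro t
    refine (hint.const_mul (Real.exp (t ^ 2 / (4 * a)))).mono' (by fun_prop) ?_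
    filter_upwards with ω
    rw [Real.norm_of_nonneg (Real.exp_pos _).le, ← Real.exp_add]
    exact Real.exp_le_exp.2 (hyoung t _)
  have hXi : Integrable X P := by
    refine ((hI 1).add (hI (-1))).mono' hX.aestronglyMeasurable ?_
    filter_upwards with ω
    have h1 := Real.add_one_le_exp (1 * X ω)
    have h2 := Real.add_one_le_exp (-1 * X ω)
    have h3 := Real.exp_pos (1 * X ω)
    have h4 := Real.exp_pos (-1 * X ω)
    simp only [Pi.add_apply, Real.norm_eq_abs]
    rw [abs_le]; constructor <;> linarith
  refine ⟨hI, fun t => ?_⟩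
  rw [Real.coe_toNNReal _ (by positivity)]
  -- For t² ≤ a, convexity of exp in the exponent θ·aX² gives 1 + θ(K - 1) up to the centered linear
  -- term. For t² > a, Young's inequality suffices, since the factor K ≤ exp(K - 1) is absorbed by
  -- t²/a > 1.
  rcases le_or_gt (t ^ 2) a with hta | hta
  · set θ := t ^ 2 / a with hθ
    have hθ0 : 0 ≤ θ := by positivity
    have hθ1 : θ ≤ 1 := by rw [hθ, div_le_one ha]; exact hta
    have hpt : ∀ ω, Real.exp (t * X ω) ≤ t * X ω + (1 - θ) + θ * Real.exp (a * X ω ^ 2) := by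
      intro ω
      have h1 := exp_le_add_exp_sq (t * X ω)
      have h2 := convexOn_exp.2 (Set.mem_univ (0 : ℝ)) (Set.mem_univ (a * X ω ^ 2))
        (sub_nonneg.2 hθ1) hθ0 (by ring)
      simp only [smul_eq_mul, mul_zero, zero_add, Real.exp_zero, mul_one] at h2
      have e : (t * X ω) ^ 2 = θ * (a * X ω ^ 2) := by rw [hθ]; field_simp
      rw [e] at h1
      linarith
    have hle : mgf X P t ≤ (1 - θ) + θ * K := by
      calc mgf X P t ≤ ∫ ω, (t * X ω + (1 - θ) + θ * Real.exp (a * X ω ^ 2)) ∂P :=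
            integral_mono (hI t) (((hXi.const_mul t).add (integrable_const _)).add
              (hint.const_mul θ)) hpt
        _ = (1 - θ) + θ * ∫ ω, Real.exp (a * X ω ^ 2) ∂P := by
            have h1 : Integrable (fun ω => t * X ω + (1 - θ)) P :=
              (hXi.const_mul t).add (integrable_const _)
            rw [integral_add h1 (hint.const_mul θ),
              integral_add (hXi.const_mul t) (integrable_const _), integral_const_mul,
              integral_const_mul, hmean]
            simp
        _ ≤ _ := by gcongr
    refine hle.trans ?_
    have := Real.add_one_le_exp (2 * K / a * t ^ 2 / 2)
    have e : 2 * K / a * t ^ 2 / 2 = θ * K := by rw [hθ]; field_simp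
    rw [e] at this ⊢
    linarith
  · calc mgf X P t ≤ ∫ ω, Real.exp (t ^ 2 / (4 * a)) * Real.exp (a * X ω ^ 2) ∂P := by
          refine integral_mono (hI t) (hint.const_mul _) fun ω => ?_
          simp only
          rw [← Real.exp_add]
          exact Real.exp_le_exp.2 (hyoung t _)
      _ ≤ Real.exp (t ^ 2 / (4 * a)) * K := by rw [integral_const_mul]; gcongr
      _ ≤ Real.exp (t ^ 2 / (4 * a)) * Real.exp (K - 1) := by
          gcongr; have := Real.add_one_le_exp (K - 1); linarith
      _ ≤ Real.exp (2 * K / a * t ^ 2 / 2) := by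
          rw [← Real.exp_add]
          refine Real.exp_le_exp.2 ?_
          have h1 : 1 ≤ t ^ 2 / a := by rw [le_div_iff₀ ha]; linarith
          have e1 : t ^ 2 / (4 * a) = (t ^ 2 / a) / 4 := by field_simp
          have e2 : 2 * K / a * t ^ 2 / 2 = K * (t ^ 2 / a) := by field_simp
          rw [e1, e2]
          nlinarith

/-- Paley–Zygmund. -/
theorem paleyZygmund [IsProbabilityMeasure P] {Z : Ω → ℝ} (hZ : Measurable Z)
    (hZ0 : ∀ ω, 0 ≤ Z ω) (hZ2 : Integrable (fun ω => Z ω ^ 2) P) {m q : ℝ} (hm : 0 ≤ m)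
    (hmean : m ≤ ∫ ω, Z ω ∂P) (hsq : ∫ ω, Z ω ^ 2 ∂P ≤ q) (hq : 0 < q) :
    m ^ 2 / (4 * q) ≤ P.real {ω | m / 2 < Z ω} := by
  set A := {ω | m / 2 < Z ω} with hA
  have hAm : MeasurableSet A := measurableSet_lt measurable_const hZ
  have hZi : Integrable Z P := by
    refine (hZ2.add (integrable_const 1)).mono' hZ.aestronglyMeasurable ?_
    filter_upwards with ω
    simp only [Pi.add_apply, Real.norm_eq_abs, abs_of_nonneg (hZ0 ω)]
    nlinarith [sq_nonneg (Z ω - 1)]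
  set x := P.real A with hx
  have hx0 : 0 ≤ x := measureReal_nonneg
  rcases hm.eq_or_lt with hm0 | hm0
  · rw [← hm0]; simpa using hx0
  -- Cauchy–Schwarz in linearized form: on the event, Z ≤ sZ²/2 + 1/(2s); the choice s = m/(2q) is
  -- made below.
  have hbound : ∀ s : ℝ, 0 < s → m / 2 ≤ s * q / 2 + x / (2 * s) := by
    intro s hs
    have hpt : ∀ ω, Z ω ≤ m / 2 + (s / 2 * Z ω ^ 2 + A.indicator (fun _ => 1 / (2 * s)) ω) := by
      intro ω
      by_cases hω : ω ∈ A
      · rw [Set.indicator_of_mem hω]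
        have : 0 ≤ (s * Z ω - 1) ^ 2 / (2 * s) := by positivity
        have e : (s * Z ω - 1) ^ 2 / (2 * s) = s / 2 * Z ω ^ 2 + 1 / (2 * s) - Z ω := by
          field_simp; ring
        linarith
      · rw [Set.indicator_of_notMem hω]
        have : Z ω ≤ m / 2 := not_lt.1 hω
        have : 0 ≤ s / 2 * Z ω ^ 2 := by positivity
        linarith
    have hI : Integrable (A.indicator (fun _ => 1 / (2 * s))) P :=
      (integrable_const _).indicator hAm
    have := integral_mono hZi ((integrable_const (m / 2)).add ((hZ2.const_mul (s / 2)).add hI)) hpt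
    rw [integral_add' (integrable_const (m / 2)) ((hZ2.const_mul (s / 2)).add hI),
      integral_add' (hZ2.const_mul (s / 2)) hI, integral_const_mul,
      integral_indicator_const _ hAm] at this
    simp only [integral_const, probReal_univ, smul_eq_mul, one_mul] at this
    have h2 : s / 2 * ∫ ω, Z ω ^ 2 ∂P ≤ s / 2 * q := by gcongr
    have e : x * (1 / (2 * s)) = x / (2 * s) := by ring
    rw [← hx, e] at this
    linarith
  have h := hbound (m / (2 * q)) (by positivity)
  have e1 : m / (2 * q) * q / 2 = m / 4 := by field_simp; ring
  have e2 : x / (2 * (m / (2 * q))) = x * q / m := by field_simp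
  rw [e1, e2] at h
  have h3 : m / 4 ≤ x * q / m := by linarith
  rw [le_div_iff₀ hm0] at h3
  rw [div_le_iff₀ (by positivity)]
  linarith

end Subgaussian
end SparseRandomMatrix

namespace SparseRandomMatrix

/-! ### Lattice nets of sparse vectors. -/

section Lattice

/-- The integer vectors with at most `k` nonzero coordinates and `ℓ¹` norm at most `R * k`. -/
noncomputable def latticeNet (n : ℕ) (R : ℝ) (k : ℕ) : Finset (Fin n → ℤ) :=
  (Fintype.piFinset fun _ => Finset.Icc (-⌊R * k⌋) ⌊R * k⌋).filter fun z =>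
    (Finset.univ.filter fun j => z j ≠ 0).card ≤ k ∧ ∑ j, |(z j : ℝ)| ≤ R * k

theorem mem_latticeNet {n : ℕ} {R : ℝ} {k : ℕ} {z : Fin n → ℤ} :
    z ∈ latticeNet n R k ↔
      (Finset.univ.filter fun j => z j ≠ 0).card ≤ k ∧ ∑ j, |(z j : ℝ)| ≤ R * k := by
  simp only [latticeNet, Finset.mem_filter, Fintype.mem_piFinset, Finset.mem_Icc,
    and_iff_right_iff_imp]
  rintro ⟨-, h⟩ j
  have h1 : |(z j : ℝ)| ≤ R * k :=
    (Finset.single_le_sum (f := fun j => |(z j : ℝ)|) (fun i _ => abs_nonneg _)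
      (Finset.mem_univ j)).trans h
  rw [← abs_le]
  exact Int.le_floor.2 (by push_cast; exact h1)

theorem sum_exp_neg_div_le {R : ℝ} (hR : 0 < R) (N : ℕ) :
    ∑ m ∈ Finset.range N, Real.exp (-((m + 1 : ℕ) : ℝ) / R) ≤ R := by
  set q := Real.exp (-1 / R) with hq
  have hq0 : 0 < q := Real.exp_pos _
  have hq1 : q < 1 := Real.exp_lt_one_iff.2 (div_neg_of_neg_of_pos (by norm_num) hR)
  have h1 : q * (1 + 1 / R) ≤ 1 := by
    have h := Real.add_one_le_exp (1 / R)
    have e : q * Real.exp (1 / R) = 1 := by rw [hq, ← Real.exp_add]; ring_nf; simp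
    nlinarith
  have h2 : q ≤ R * (1 - q) := by
    have e : q * (1 + 1 / R) = q + q / R := by ring
    rw [e] at h1
    have h3 : q / R ≤ 1 - q := by linarith
    rwa [div_le_iff₀' hR] at h3
  have h4 : ∀ m : ℕ, Real.exp (-((m + 1 : ℕ) : ℝ) / R) = q * q ^ m := by
    intro m
    rw [← pow_succ', hq, ← Real.exp_nat_mul]
    congr 1; push_cast; ring
  simp_rw [h4]
  rw [← Finset.mul_sum]
  have h5 : (∑ m ∈ Finset.range N, q ^ m) * (1 - q) ≤ 1 := by
    have := geom_sum_mul_neg q N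
    have : 0 ≤ q ^ N := by positivity
    linarith
  have h6 : 0 ≤ ∑ m ∈ Finset.range N, q ^ m := Finset.sum_nonneg fun _ _ => by positivity
  calc q * ∑ m ∈ Finset.range N, q ^ m ≤ R * (1 - q) * ∑ m ∈ Finset.range N, q ^ m := by gcongr
    _ = R * ((∑ m ∈ Finset.range N, q ^ m) * (1 - q)) := by ring
    _ ≤ R * 1 := by gcongr
    _ = R := mul_one R

theorem sum_Icc_weight_le {R δ : ℝ} (hR : 0 < R) (hδ : 0 ≤ δ) (N : ℤ) :
    ∑ z ∈ Finset.Icc (-N) N, (if z = 0 then (1 : ℝ) else δ * Real.exp (-|(z : ℝ)| / R)) ≤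
      1 + 2 * δ * R := by
  rcases lt_or_ge N 0 with hN | hN
  · rw [Finset.Icc_eq_empty (by omega)]; simp; positivity
  lift N to ℕ using hN
  have h : ∑ z ∈ Finset.Icc (-(N : ℤ)) N,
      (if z = 0 then (1 : ℝ) else δ * Real.exp (-|(z : ℝ)| / R)) =
      1 + 2 * δ * ∑ m ∈ Finset.range N, Real.exp (-((m + 1 : ℕ) : ℝ) / R) := by
    induction N with
    | zero => simp
    | succ N ih =>
      have e : Finset.Icc (-((N + 1 : ℕ) : ℤ)) ((N + 1 : ℕ) : ℤ) =
          insert (-((N + 1 : ℕ) : ℤ)) (insert ((N + 1 : ℕ) : ℤ) (Finset.Icc (-(N : ℤ)) N)) := by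
        ext z; simp only [Finset.mem_Icc, Finset.mem_insert]; push_cast; omega
      rw [e, Finset.sum_insert, Finset.sum_insert, ih, Finset.sum_range_succ]
      · rw [if_neg (by omega), if_neg (by omega)]
        push_cast
        rw [abs_neg, abs_of_nonneg (by positivity : (0 : ℝ) ≤ (N : ℝ) + 1)]
        ring
      · simp
      · simp only [Finset.mem_insert, Finset.mem_Icc]; push_cast; omega
  rw [h]
  have := sum_exp_neg_div_le hR N
  gcongr

/-- Exponential weights count supports and values together: the product weights sum to at most
exp(2δRn) over all integer vectors with entries in the box, while each net point has weight at least
(δ/e)^k. The price of R is only logarithmic once δ is taken proportional to 1/R. -/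
theorem card_latticeNet_le (n : ℕ) {R δ : ℝ} (hR : 0 < R) (hδ : 0 < δ) (hδ1 : δ ≤ 1) (k : ℕ) :
    ((latticeNet n R k).card : ℝ) ≤ Real.exp (2 * δ * R * n) * (Real.exp 1 / δ) ^ k := by
  set w : ℤ → ℝ := fun z => if z = 0 then (1 : ℝ) else δ * Real.exp (-|(z : ℝ)| / R) with hw
  have hw0 : ∀ z, 0 ≤ w z := by intro z; simp only [hw]; split_ifs <;> positivity
  have h1 : ∑ z ∈ latticeNet n R k, ∏ j, w (z j) ≤ Real.exp (2 * δ * R * n) := by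
    calc ∑ z ∈ latticeNet n R k, ∏ j, w (z j)
        ≤ ∑ z ∈ Fintype.piFinset fun _ : Fin n => Finset.Icc (-⌊R * k⌋) ⌊R * k⌋, ∏ j, w (z j) :=
          Finset.sum_le_sum_of_subset_of_nonneg (Finset.filter_subset _ _)
            fun _ _ _ => Finset.prod_nonneg fun _ _ => hw0 _
      _ = ∏ _j : Fin n, ∑ z ∈ Finset.Icc (-⌊R * k⌋) ⌊R * k⌋, w z :=
          (Finset.prod_univ_sum (fun _ : Fin n => Finset.Icc (-⌊R * k⌋) ⌊R * k⌋) fun _ z => w z).symm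
      _ ≤ ∏ _j : Fin n, Real.exp (2 * δ * R) := by
          refine Finset.prod_le_prod (fun _ _ => Finset.sum_nonneg fun _ _ => hw0 _) fun _ _ => ?_
          refine (sum_Icc_weight_le hR hδ.le _).trans ?_
          have := Real.add_one_le_exp (2 * δ * R)
          linarith
      _ = _ := by
          rw [Finset.prod_const, Finset.card_univ, Fintype.card_fin, ← Real.exp_nat_mul]
          ring_nf
  have h2 : ∀ z ∈ latticeNet n R k, (δ / Real.exp 1) ^ k ≤ ∏ j, w (z j) := by
    intro z hz
    obtain ⟨hz1, hz2⟩ := mem_latticeNet.1 hz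
    have e : ∏ j, w (z j) = δ ^ (Finset.univ.filter fun j => z j ≠ 0).card *
        Real.exp (-(∑ j, |(z j : ℝ)|) / R) := by
      have : ∀ j, w (z j) = (if z j ≠ 0 then δ else 1) * Real.exp (-|(z j : ℝ)| / R) := by
        intro j; by_cases h : z j = 0 <;> simp [hw, h]
      simp_rw [this]
      rw [Finset.prod_mul_distrib, ← Real.exp_sum, Finset.prod_ite]
      simp only [Finset.prod_const, one_pow, mul_one]
      rw [← Finset.sum_div, Finset.sum_neg_distrib]
    rw [e, div_pow, div_eq_mul_inv, ← Real.exp_nat_mul, ← Real.exp_neg]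
    refine mul_le_mul (pow_le_pow_of_le_one hδ.le hδ1 hz1) (Real.exp_le_exp.2 ?_)
      (Real.exp_pos _).le (by positivity)
    rw [neg_div, neg_le_neg_iff, div_le_iff₀ hR]
    linarith
  have h3 := (Finset.card_nsmul_le_sum _ _ _ h2).trans h1
  rw [nsmul_eq_mul] at h3
  have h4 : (δ / Real.exp 1) ^ k * (Real.exp 1 / δ) ^ k = 1 := by
    rw [← mul_pow]
    have : δ / Real.exp 1 * (Real.exp 1 / δ) = 1 := by field_simp
    rw [this, one_pow]
  calc ((latticeNet n R k).card : ℝ)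
      = ((latticeNet n R k).card * (δ / Real.exp 1) ^ k) * (Real.exp 1 / δ) ^ k := by
        rw [mul_assoc, h4, mul_one]
    _ ≤ _ := by gcongr

/-- The point of the lattice of mesh `ε / √k` with integer coordinates `z`. -/
noncomputable def latticePoint {n : ℕ} (ε : ℝ) (k : ℕ) (z : Fin n → ℤ) :
    EuclideanSpace ℝ (Fin n) :=
  WithLp.toLp 2 fun j => ε / Real.sqrt k * z j

/-- Rounding towards zero: moduli never grow, so zero coordinates and upper bounds on coordinates
survive the approximation. -/
theorem exists_int_trunc {h : ℝ} (hh : 0 < h) (x : ℝ) :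
    ∃ z : ℤ, |x - h * z| ≤ h ∧ |h * z| ≤ |x| := by
  rcases le_total 0 x with hx | hx
  · refine ⟨⌊x / h⌋, ?_, ?_⟩
    · have h1 := Int.floor_le (x / h)
      have h2 := Int.lt_floor_add_one (x / h)
      rw [le_div_iff₀ hh] at h1
      rw [div_lt_iff₀ hh] at h2
      rw [abs_le]; constructor <;> nlinarith
    · have h1 := Int.floor_le (x / h)
      rw [le_div_iff₀ hh] at h1
      have h0 : (0 : ℝ) ≤ ⌊x / h⌋ := by exact_mod_cast Int.floor_nonneg.2 (by positivity)
      rw [abs_of_nonneg hx, abs_of_nonneg (by positivity)]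
      linarith
  · refine ⟨⌈x / h⌉, ?_, ?_⟩
    · have h1 := Int.le_ceil (x / h)
      have h2 := Int.ceil_lt_add_one (x / h)
      rw [div_le_iff₀ hh] at h1
      have h2' : (⌈x / h⌉ - 1 : ℝ) < x / h := by linarith
      rw [lt_div_iff₀ hh] at h2'
      rw [abs_le]; constructor <;> nlinarith
    · have h1 := Int.le_ceil (x / h)
      rw [div_le_iff₀ hh] at h1
      have h0 : (⌈x / h⌉ : ℝ) ≤ 0 := by
        have : ⌈x / h⌉ ≤ 0 := Int.ceil_le.2 (by simpa using div_nonpos_of_nonpos_of_nonneg hx hh.le)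
        exact_mod_cast this
      rw [abs_of_nonpos hx, abs_of_nonpos (by nlinarith)]
      linarith

/-- With mesh ε/√k, the errors on k coordinates add up to ε in norm, and Cauchy–Schwarz turns ‖x‖ ≤
r into an ℓ¹ bound (r/ε)k for the integer vector. -/
theorem exists_latticePoint_near {n : ℕ} (x : EuclideanSpace ℝ (Fin n)) {k : ℕ} (hk : 0 < k)
    {ε r : ℝ} (hε : 0 < ε) (hx : ‖x‖ ≤ r) (hsupp : (Finset.univ.filter fun j => x j ≠ 0).card ≤ k) :
    ∃ z ∈ latticeNet n (r / ε) k, ‖x - latticePoint ε k z‖ ≤ ε ∧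
      ∀ j, |latticePoint ε k z j| ≤ |x j| ∧ |x j - latticePoint ε k z j| ≤ ε / Real.sqrt k := by
  have hk' : (0 : ℝ) < k := by exact_mod_cast hk
  set h := ε / Real.sqrt k with hh
  have hh0 : 0 < h := by positivity
  choose z hz1 hz2 using fun j => exists_int_trunc hh0 (x j)
  have hzero : ∀ j, x j = 0 → z j = 0 := by
    intro j hj
    have := hz2 j
    rw [hj, abs_zero] at this
    have := abs_nonpos_iff.1 this
    rcases mul_eq_zero.1 this with h' | h'
    · exact absurd h' hh0.ne'
    · exact_mod_cast h'
  have hS : ∀ f : Fin n → ℝ, (∀ j, x j = 0 → f j = 0) →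
      ∑ j, f j = ∑ j ∈ Finset.univ.filter (fun j => x j ≠ 0), f j := by
    intro f hf
    rw [Finset.sum_filter]
    refine Finset.sum_congr rfl fun j _ => ?_
    by_cases hj : x j = 0 <;> simp [hj, hf]
  have hkc : ((Finset.univ.filter fun j => x j ≠ 0).card : ℝ) ≤ k := by exact_mod_cast hsupp
  refine ⟨z, mem_latticeNet.2 ⟨?_, ?_⟩, ?_, fun j => ⟨hz2 j, hz1 j⟩⟩
  · refine (Finset.card_le_card fun j hj => ?_).trans hsupp
    simp only [Finset.mem_filter, Finset.mem_univ, true_and] at hj ⊢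
    exact fun h' => hj (hzero j h')
  · have h1 : ∀ j, |(z j : ℝ)| ≤ |x j| / h := by
      intro j
      have := hz2 j
      rw [abs_mul, abs_of_pos hh0] at this
      rw [le_div_iff₀ hh0]; linarith
    have h2 : ∑ j, |x j| ≤ Real.sqrt k * r := by
      have hc := Finset.sum_mul_sq_le_sq_mul_sq (Finset.univ.filter fun j => x j ≠ 0)
        (fun _ => (1 : ℝ)) (fun j => |x j|)
      simp only [one_mul, one_pow, Finset.sum_const, nsmul_eq_mul, mul_one, sq_abs] at hc
      rw [← hS (fun j => |x j|) (by simp +contextual), ← hS (fun j => x j ^ 2) (by simp +contextual)]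
        at hc
      have hn := EuclideanSpace.real_norm_sq_eq x
      rw [← hn] at hc
      have hr0 : 0 ≤ r := (norm_nonneg x).trans hx
      refine abs_le_of_sq_le_sq' ?_ (by positivity) |>.2
      rw [mul_pow, Real.sq_sqrt hk'.le]
      refine hc.trans ?_
      gcongr
    calc ∑ j, |(z j : ℝ)| ≤ ∑ j, |x j| / h := Finset.sum_le_sum fun j _ => h1 j
      _ = (∑ j, |x j|) / h := by rw [Finset.sum_div]
      _ ≤ Real.sqrt k * r / h := by gcongr
      _ = r / ε * k := by
          rw [hh]
          have : (k : ℝ) = Real.sqrt k * Real.sqrt k := (Real.mul_self_sqrt hk'.le).symm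
          field_simp
          rw [Real.sq_sqrt hk'.le]; ring
  · refine abs_le_of_sq_le_sq' ?_ hε.le |>.2
    rw [EuclideanSpace.real_norm_sq_eq, hS]
    · calc ∑ j ∈ Finset.univ.filter (fun j => x j ≠ 0), ((x - latticePoint ε k z) j) ^ 2
          ≤ ∑ j ∈ Finset.univ.filter (fun j => x j ≠ 0), h ^ 2 := by
            refine Finset.sum_le_sum fun j _ => ?_
            rw [← sq_abs]
            exact pow_le_pow_left₀ (abs_nonneg _) (hz1 j) 2
        _ = (Finset.univ.filter fun j => x j ≠ 0).card * h ^ 2 := by simp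
        _ ≤ k * h ^ 2 := by gcongr
        _ = ε ^ 2 := by rw [hh, div_pow, Real.sq_sqrt hk'.le]; field_simp
    · intro j hj
      simp [latticePoint, hj, hzero j hj]

end Lattice
end SparseRandomMatrix

namespace SparseRandomMatrix

/-! ### Closed walks, and the comparison of sparse and dense trace moments. -/

section Walks

open Finset

/-- The edge that the closed walk `w` traverses at time `t`. -/
def walkEdge {V : Type*} {K : ℕ} (w : Fin (K + 1) → V) (t : Fin (K + 1)) : Sym2 V :=
  s(w t, w (t + 1))

/-- The number of times that the closed walk `w` traverses `e`. -/
def walkMult {V : Type*} [DecidableEq V] {K : ℕ} (w : Fin (K + 1) → V) (e : Sym2 V) : ℕ :=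
  (univ.filter fun t => walkEdge w t = e).card

/-- The product over the edges `e` of the moment of order `walkMult w e`. -/
noncomputable def walkWeight {V : Type*} [DecidableEq V] {K : ℕ} (μ : ℕ → ℝ)
    (w : Fin (K + 1) → V) : ℝ :=
  ∏ e ∈ univ.image (walkEdge w), μ (walkMult w e)

theorem pow_apply_eq_sum_walks {V : Type*} [Fintype V] [DecidableEq V] (A : Matrix V V ℝ) (K : ℕ)
    (i j : V) : (A ^ K) i j = ∑ w : Fin (K + 1) → V,
      if w 0 = i ∧ w (Fin.last K) = j then ∏ t : Fin K, A (w t.castSucc) (w t.succ) else 0 := by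
  induction K generalizing j with
  | zero =>
    rw [pow_zero, Matrix.one_apply, ← (Equiv.funUnique (Fin 1) V).symm.sum_comp]
    simp only [Equiv.funUnique_symm_apply, univ_eq_empty, prod_empty, Fin.last_zero,
      uniqueElim_const]
    by_cases h : i = j
    · subst h; simp
    · rw [if_neg h]
      refine (Finset.sum_eq_zero fun x _ => if_neg ?_).symm
      rintro ⟨rfl, rfl⟩; exact h rfl
  | succ K ih =>
    rw [pow_succ, Matrix.mul_apply]
    rw [← (Fin.snocEquiv fun _ : Fin (K + 2) => V).sum_comp, Fintype.sum_prod_type, ]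
    simp_rw [ih, Finset.sum_mul]
    rw [Finset.sum_comm]
    have e1 : ∀ (x : V) (w : Fin (K + 1) → V),
        (Fin.snocEquiv fun _ : Fin (K + 2) => V) (x, w) = Fin.snoc (α := fun _ => V) w x :=
      fun _ _ => rfl
    simp_rw [e1]
    rw [Finset.sum_comm (γ := V)]
    refine Finset.sum_congr rfl fun w _ => ?_
    have h0 : ∀ x : V, Fin.snoc (α := fun _ => V) w x 0 = w 0 := fun x => by
      rw [← Fin.castSucc_zero, Fin.snoc_castSucc]
    simp_rw [Fin.snoc_last, h0, Fin.prod_univ_castSucc, Fin.snoc_castSucc,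
      ← Fin.castSucc_succ, Fin.snoc_castSucc, Fin.succ_last, Fin.snoc_last]
    by_cases hi : w 0 = i
    · simp [hi, ite_mul, Finset.sum_ite_eq, Finset.sum_ite_eq']
    · simp [hi]

/-- Addition on `Fin (K + 1)` is cyclic, so the factor at the last time is the closing edge. -/
theorem trace_pow_eq_sum_walks {V : Type*} [Fintype V] [DecidableEq V] (A : Matrix V V ℝ) (K : ℕ) :
    (A ^ (K + 1)).trace = ∑ w : Fin (K + 1) → V, ∏ t, A (w t) (w (t + 1)) := by
  rw [pow_succ, Matrix.trace]
  simp_rw [Matrix.diag_apply, Matrix.mul_apply, pow_apply_eq_sum_walks, Finset.sum_mul]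
  have : ∀ i j : V, ∑ w : Fin (K + 1) → V, (if w 0 = i ∧ w (Fin.last K) = j then
      ∏ t : Fin K, A (w t.castSucc) (w t.succ) else 0) * A j i =
      ∑ w : Fin (K + 1) → V, (if w 0 = i then if w (Fin.last K) = j then
      (∏ t : Fin K, A (w t.castSucc) (w t.succ)) * A (w (Fin.last K)) (w 0) else 0 else 0) := by
    intro i j
    refine Finset.sum_congr rfl fun w _ => ?_
    split_ifs with h1 h2 h3 <;> simp_all
  simp_rw [this]
  rw [Finset.sum_congr rfl fun i _ => Finset.sum_comm, Finset.sum_comm]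
  refine Finset.sum_congr rfl fun w _ => ?_
  rw [Fin.prod_univ_castSucc]
  simp [Fin.last_add_one]

variable {V W : Type*} [DecidableEq V] [DecidableEq W] {K : ℕ}

theorem walkEdge_eq_iff_of_ker {V W : Type*} {w : Fin (K + 1) → V} {w' : Fin (K + 1) → W}
    (h : ∀ s t, w s = w t ↔ w' s = w' t) (s t : Fin (K + 1)) :
    walkEdge w s = walkEdge w t ↔ walkEdge w' s = walkEdge w' t := by
  simp only [walkEdge, Sym2.eq_iff, h]

/-- The product sees only the partition of the index set into fibres, not the labels of the fibres.
-/
theorem prod_image_fiber_eq_of_ker {T E E' : Type*} [Fintype T] [DecidableEq E] [DecidableEq E']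
    {g : T → E} {g' : T → E'} (h : ∀ s t, g s = g t ↔ g' s = g' t) (F : ℕ → ℝ) :
    ∏ e ∈ univ.image g, F (univ.filter fun t => g t = e).card =
      ∏ e ∈ univ.image g', F (univ.filter fun t => g' t = e).card := by
  have hex : ∀ e ∈ univ.image g, ∃ t, g t = e := by
    intro e he; simpa using he
  refine Finset.prod_bij (fun e he => g' (hex e he).choose) ?_ ?_ ?_ ?_
  · intro e he; exact mem_image_of_mem _ (mem_univ _)
  · intro e he f hf hef
    rw [← (hex e he).choose_spec, ← (hex f hf).choose_spec]
    exact (h _ _).2 hef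
  · intro e' he'
    obtain ⟨t, -, rfl⟩ := mem_image.1 he'
    refine ⟨g t, mem_image_of_mem _ (mem_univ _), ?_⟩
    exact (h _ _).1 (hex (g t) (mem_image_of_mem _ (mem_univ _))).choose_spec
  · intro e he
    congr 2
    ext t
    simp only [mem_filter, mem_univ, true_and]
    rw [← h, (hex e he).choose_spec]

theorem walkWeight_eq_of_ker {w : Fin (K + 1) → V} {w' : Fin (K + 1) → W}
    (h : ∀ s t, w s = w t ↔ w' s = w' t) (μ : ℕ → ℝ) : walkWeight μ w = walkWeight μ w' :=
  prod_image_fiber_eq_of_ker (walkEdge_eq_iff_of_ker h) μ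

/-- Each vertex other than the starting one is first reached along an edge, and these first-entry
edges are distinct. -/
theorem card_image_le_card_walkEdge (w : Fin (K + 1) → V) :
    (univ.image w).card ≤ (univ.image (walkEdge w)).card + 1 := by
  have hfirst : ∀ v ∈ (univ.image w).erase (w 0), ∃ a : Fin (K + 1),
      walkEdge w a = s(w a, v) ∧ ∀ t, w t = v → a < t := by
    intro v hv
    obtain ⟨hv0, hv⟩ := mem_erase.1 hv
    have hne : (univ.filter fun t => w t = v).Nonempty := by
      obtain ⟨t, -, ht⟩ := mem_image.1 hv
      exact ⟨t, by simp [ht]⟩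
    set m := (univ.filter fun t => w t = v).min' hne with hm
    have hmem := (univ.filter fun t => w t = v).min'_mem hne
    rw [← hm, mem_filter] at hmem
    have hm0 : m ≠ 0 := by
      intro h0; rw [h0] at hmem; exact hv0 hmem.2.symm
    obtain ⟨s, hs⟩ := Fin.exists_succ_eq.2 hm0
    refine ⟨s.castSucc, ?_, fun t ht => ?_⟩
    · rw [walkEdge, Fin.coeSucc_eq_succ, hs, hmem.2]
    · refine lt_of_lt_of_le (b := s.succ) (Fin.castSucc_lt_succ) ?_
      rw [hs]
      exact Finset.min'_le _ _ (by simp [ht])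
  choose! f hf1 hf2 using hfirst
  have hcard : ((univ.image w).erase (w 0)).card ≤ (univ.image (walkEdge w)).card := by
    refine Finset.card_le_card_of_injOn (fun v => walkEdge w (f v))
      (fun v _ => mem_image_of_mem _ (mem_univ _)) ?_
    intro v hv v' hv' h
    simp only [hf1 v hv, hf1 v' hv', Sym2.eq_iff] at h
    rcases h with h | ⟨h1, h2⟩
    · exact h.2
    -- If the two edges agree with endpoints swapped, each vertex is visited strictly before the
    -- other one.
    · exact absurd (hf2 v' hv' _ h1) (lt_asymm (hf2 v hv _ h2.symm))
  have := Finset.card_erase_add_one (mem_image_of_mem w (mem_univ 0))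
  omega

/-- The canonical walk with the same coincidences as `w`. -/
def walkPattern (w : Fin (K + 1) → V) (t : Fin (K + 1)) : Fin (K + 1) :=
  (univ.filter fun s => w s = w t).min' ⟨t, by simp⟩

theorem apply_walkPattern (w : Fin (K + 1) → V) (t : Fin (K + 1)) : w (walkPattern w t) = w t := by
  have := (univ.filter fun s => w s = w t).min'_mem ⟨t, by simp⟩
  exact (mem_filter.1 this).2

theorem walkPattern_eq_iff (w : Fin (K + 1) → V) (s t : Fin (K + 1)) :
    walkPattern w s = walkPattern w t ↔ w s = w t := by
  constructor
  · intro h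
    rw [← apply_walkPattern w s, ← apply_walkPattern w t, h]
  · intro h; simp only [walkPattern, h]

theorem walkPattern_eq_of_ker {w : Fin (K + 1) → V} {w' : Fin (K + 1) → W}
    (h : ∀ s t, w s = w t ↔ w' s = w' t) : walkPattern w = walkPattern w' := by
  funext t
  simp only [walkPattern, h]

/-- A walk with pattern `c` is the same as an injective labelling of the values of `c`; a canonical
pattern is idempotent, so `c t` itself represents its class. -/
theorem card_walkPattern_eq [Fintype V] {c : Fin (K + 1) → Fin (K + 1)} (hc : walkPattern c = c) :
    (univ.filter fun w : Fin (K + 1) → V => walkPattern w = c).card =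
      (Fintype.card V).descFactorial (univ.image c).card := by
  rw [← Fintype.card_coe (univ.image c), ← Fintype.card_embedding_eq, ← Finset.card_univ]
  have hmem : ∀ t, c t ∈ univ.image c := fun t => mem_image_of_mem _ (mem_univ _)
  have hcc : ∀ t, c (c t) = c t := by
    intro t
    have := apply_walkPattern c t
    rwa [hc] at this
  refine Finset.card_bij'
    (fun w hw => (⟨fun x => w x, ?_⟩ : ↥(univ.image c) ↪ V))
    (fun f _ t => f ⟨c t, hmem t⟩) (fun _ _ => mem_univ _) ?_ ?_ ?_
  · rintro ⟨x, hx⟩ ⟨y, hy⟩ hxy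
    obtain ⟨s, -, rfl⟩ := mem_image.1 hx
    obtain ⟨t, -, rfl⟩ := mem_image.1 hy
    have hw' : walkPattern w = c := (mem_filter.1 hw).2
    have h1 := (walkPattern_eq_iff w (c s) (c t)).2 hxy
    rw [hw', hcc, hcc] at h1
    exact Subtype.ext h1
  · intro f _
    simp only [mem_filter, mem_univ, true_and]
    conv_rhs => rw [← hc]
    refine walkPattern_eq_of_ker fun s t => ?_
    rw [f.injective.eq_iff, Subtype.mk.injEq]
  · intro w hw
    have hw' : walkPattern w = c := (mem_filter.1 hw).2
    funext t
    change w (c t) = w t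
    rw [← hw']
    exact apply_walkPattern w t
  · intro f _
    ext ⟨x, hx⟩
    obtain ⟨s, -, rfl⟩ := mem_image.1 hx
    change f ⟨c (c s), _⟩ = f ⟨c s, _⟩
    simp only [hcc]

/-- The vertex set enters only through a falling factorial, so walks on sets of different sizes can
be compared pattern by pattern. -/
theorem sum_walkWeight_eq [Fintype V] (μ : ℕ → ℝ) :
    ∑ w : Fin (K + 1) → V, walkWeight μ w =
      ∑ c ∈ univ.filter (fun c : Fin (K + 1) → Fin (K + 1) => walkPattern c = c),
        ((Fintype.card V).descFactorial (univ.image c).card : ℝ) * walkWeight μ c := by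
  rw [← Finset.sum_fiberwise_of_maps_to
    (t := univ.filter (fun c : Fin (K + 1) → Fin (K + 1) => walkPattern c = c))
    (g := fun w => walkPattern w)]
  · refine Finset.sum_congr rfl fun c hc => ?_
    rw [Finset.sum_congr rfl (g := fun _ => walkWeight μ c), Finset.sum_const, nsmul_eq_mul,
      card_walkPattern_eq (mem_filter.1 hc).2]
    intro w hw
    have hw' : walkPattern w = c := (mem_filter.1 hw).2
    refine walkWeight_eq_of_ker (fun s t => ?_) μ
    rw [← hw', walkPattern_eq_iff]
  · intro w _
    simp only [mem_filter, mem_univ, true_and]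
    exact walkPattern_eq_of_ker fun s t => walkPattern_eq_iff w s t

theorem sum_walkMult (w : Fin (K + 1) → V) :
    ∑ e ∈ univ.image (walkEdge w), walkMult w e = K + 1 := by
  have := Finset.card_eq_sum_card_image (walkEdge w) (univ : Finset (Fin (K + 1)))
  simpa [walkMult] using this.symm

/-- Comparison of the closed-walk sums of a sparse and a dense random matrix. -/
theorem sum_walkWeight_le {n r k : ℕ} {p : ℝ} (hp0 : 0 < p) (hn : 0 < n)
    (hK : K + 1 = 2 * k) (hr : k + n * p ≤ r) (hp1 : p ≤ 1) {μ ν : ℕ → ℝ} (hμ1 : μ 1 = 0)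
    (hν : ∀ m, 0 ≤ ν m) (hμν : ∀ m, 2 ≤ m → |μ m| ≤ p * ν m) :
    ∑ w : Fin (K + 1) → Fin n, walkWeight μ w ≤
      1 / p * ∑ w : Fin (K + 1) → Fin r, walkWeight ν w := by
  rw [sum_walkWeight_eq, sum_walkWeight_eq, Finset.mul_sum]
  refine Finset.sum_le_sum fun c _ => ?_
  rw [Fintype.card_fin, Fintype.card_fin]
  set m := (univ.image c).card with hm
  have hν0 : 0 ≤ walkWeight ν c := Finset.prod_nonneg fun _ _ => hν _
  -- An edge traversed exactly once contributes the mean, which is zero. Otherwise every edge is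
  -- used at least twice, so there are at most k edges and k + 1 vertices.
  by_cases h1 : ∃ e ∈ univ.image (walkEdge c), walkMult c e = 1
  · obtain ⟨e, he, he1⟩ := h1
    have : walkWeight μ c = 0 := Finset.prod_eq_zero he (by rw [he1, hμ1])
    rw [this, mul_zero]
    positivity
  push Not at h1
  have h2 : ∀ e ∈ univ.image (walkEdge c), 2 ≤ walkMult c e := by
    intro e he
    have hpos : 0 < walkMult c e := by
      obtain ⟨t, -, ht⟩ := mem_image.1 he
      exact Finset.card_pos.2 ⟨t, by simp [ht]⟩
    have := h1 e he
    omega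
  set E := (univ.image (walkEdge c)).card with hE
  have hEk : E ≤ k := by
    have := Finset.card_nsmul_le_sum _ _ _ h2
    rw [sum_walkMult, smul_eq_mul] at this
    omega
  have hmE : m ≤ E + 1 := card_image_le_card_walkEdge c
  have hm0 : 1 ≤ m := Finset.card_pos.2 ⟨c 0, mem_image_of_mem _ (mem_univ _)⟩
  have hμw : walkWeight μ c ≤ p ^ E * walkWeight ν c := by
    refine (le_abs_self _).trans ?_
    rw [walkWeight, Finset.abs_prod]
    refine (Finset.prod_le_prod (fun _ _ => abs_nonneg _) fun e he => hμν _ (h2 e he)).trans ?_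
    rw [Finset.prod_mul_distrib, Finset.prod_const]; rfl
  have hpE : p ^ E ≤ p ^ (m - 1) := pow_le_pow_of_le_one hp0.le hp1 (by omega)
  have hdesc : (n.descFactorial m : ℝ) ≤ (n : ℝ) ^ m := by
    exact_mod_cast Nat.descFactorial_le_pow n m
  -- The smallest factor of the falling factorial is r + 1 - m ≥ r - k ≥ np: the vertex set of size
  -- r leaves room even for patterns with k + 1 vertices.
  have hrdesc : (n * p) ^ m ≤ (r.descFactorial m : ℝ) := by
    have h3 : ((r + 1 - m : ℕ) : ℝ) ^ m ≤ (r.descFactorial m : ℝ) := by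
      exact_mod_cast Nat.pow_sub_le_descFactorial r m
    refine le_trans ?_ h3
    have hkr : k ≤ r := by
      have h4 : (k : ℝ) ≤ r := by
        have : 0 ≤ (n : ℝ) * p := by positivity
        linarith
      exact_mod_cast h4
    have hmk : m ≤ k + 1 := by omega
    refine pow_le_pow_left₀ (by positivity) ?_ m
    rw [Nat.cast_sub (by omega)]
    have : (m : ℝ) ≤ k + 1 := by exact_mod_cast hmk
    push_cast
    linarith
  calc (n.descFactorial m : ℝ) * walkWeight μ c
      ≤ (n : ℝ) ^ m * (p ^ (m - 1) * walkWeight ν c) := by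
        refine mul_le_mul_of_nonneg hdesc (hμw.trans ?_) (by positivity) (by positivity)
        gcongr
    -- There may be one more vertex than edges, hence one power of p too few: this is the source of
    -- the factor 1/p.
    _ = 1 / p * ((n * p) ^ m * walkWeight ν c) := by
        obtain ⟨q, hq⟩ : ∃ q, m = q + 1 := ⟨m - 1, by omega⟩
        rw [hq, Nat.add_sub_cancel, mul_pow]
        field_simp
        ring
    _ ≤ _ := by gcongr

end Walks
end SparseRandomMatrix

namespace SparseRandomMatrix

open scoped NNReal ENNReal

/-! ### Independence of blocks, trace moments and a dominating law. -/

section Independence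

variable {Ω : Type*} [MeasurableSpace Ω] {P : Measure Ω}

/-- Functions of disjoint blocks of independent variables are independent. -/
theorem iIndepFun_blocks {ι κ β : Type*} [MeasurableSpace β] {X : ι → Ω → β}
    (h : iIndepFun X P) (hX : ∀ i, Measurable (X i)) {S : κ → Finset ι}
    (hS : Pairwise fun k l => Disjoint (S k) (S l)) :
    iIndepFun (fun k ω (i : S k) => X i ω) P := by
  classical
  have := h.isProbabilityMeasure
  rw [iIndepFun_iff_measure_inter_preimage_eq_mul]
  intro T
  induction T using Finset.induction_on with
  | empty => intro s _; simp
  | insert k T hk ih =>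
    intro s hs
    rw [Finset.set_biInter_insert, Finset.prod_insert hk,
      ← ih fun l hl => hs l (Finset.mem_insert_of_mem hl)]
    set U := T.biUnion S with hU
    have hd : Disjoint (S k) U := by
      rw [hU, Finset.disjoint_biUnion_right]
      intro l hl
      exact hS (fun hkl => hk (hkl ▸ hl))
    have hsub : ∀ l ∈ T, ∀ i ∈ S l, i ∈ U := fun l hl i hi => Finset.mem_biUnion.2 ⟨l, hl, hi⟩
    have hind := h.indepFun_finset (S k) U hd hX
    set V : Set (U → β) :=
      ⋂ l : T, (fun (x : U → β) (i : S l) => x ⟨i, hsub l l.2 i i.2⟩) ⁻¹' s l with hV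
    have hVm : MeasurableSet V := by
      refine MeasurableSet.iInter fun l => ?_
      exact (measurable_pi_lambda _ fun i => measurable_pi_apply _)
        (hs l (Finset.mem_insert_of_mem l.2))
    have e : (⋂ l ∈ T, (fun ω (i : S l) => X i ω) ⁻¹' s l) =
        (fun ω (i : U) => X i ω) ⁻¹' V := by
      ext ω
      simp [hV]
    rw [e]
    exact hind.measure_inter_preimage_eq_mul _ _ (hs k (Finset.mem_insert_self _ _)) hVm

theorem integrable_prod_of_iIndepFun {ι β : Type*} [Fintype ι] [MeasurableSpace β] {X : ι → Ω → β}
    (h : iIndepFun X P) (hX : ∀ i, Measurable (X i)) {f : ι → β → ℝ} (hf : ∀ i, Measurable (f i))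
    (hint : ∀ i, Integrable (fun ω => f i (X i ω)) P) :
    Integrable (fun ω => ∏ i, f i (X i ω)) P := by
  have := h.isProbabilityMeasure
  have hm : Measurable fun ω i => X i ω := measurable_pi_lambda _ hX
  have hprob : ∀ i, IsProbabilityMeasure (P.map (X i)) := fun i =>
    Measure.isProbabilityMeasure_map (hX i).aemeasurable
  have h1 : Integrable (fun x : ι → β => ∏ i, f i (x i)) (Measure.pi fun i => P.map (X i)) := by
    refine Integrable.fintype_prod_dep fun i => ?_
    rw [integrable_map_measure (hf i).aestronglyMeasurable (hX i).aemeasurable]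
    exact hint i
  rw [← h.map_fun_eq_pi_map fun i => (hX i).aemeasurable] at h1
  exact h1.comp_measurable hm

/-- The symmetric matrix with entries `a s(i, j)`. -/
def symMatrix {n : ℕ} (a : Sym2 (Fin n) → ℝ) : Matrix (Fin n) (Fin n) ℝ :=
  Matrix.of fun i j => a s(i, j)

theorem isSelfAdjoint_symMatrix {n : ℕ} (a : Sym2 (Fin n) → ℝ) : IsSelfAdjoint (symMatrix a) := by
  change (symMatrix a).conjTranspose = symMatrix a
  ext i j
  simp [symMatrix, Sym2.eq_swap]

/-- Regrouping by unordered pairs exhibits independent factors, since transposed entries coincide.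
-/
theorem prod_walk_eq {n K : ℕ} (a : Sym2 (Fin n) → ℝ) (w : Fin (K + 1) → Fin n) :
    ∏ t, symMatrix a (w t) (w (t + 1)) = ∏ e, a e ^ walkMult w e := by
  have h1 : ∏ t, symMatrix a (w t) (w (t + 1)) = ∏ t, a (walkEdge w t) := rfl
  rw [h1, Finset.prod_comp a (walkEdge w)]
  refine Finset.prod_subset (Finset.subset_univ _) fun e _ he => ?_
  have : (Finset.univ.filter fun t => walkEdge w t = e).card = 0 := by
    rw [Finset.card_eq_zero, Finset.filter_eq_empty_iff]
    intro t _ ht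
    exact he (ht ▸ Finset.mem_image_of_mem _ (Finset.mem_univ _))
  rw [this, pow_zero]

theorem walkWeight_eq_prod_univ {n K : ℕ} {μ : ℕ → ℝ} (hμ : μ 0 = 1) (w : Fin (K + 1) → Fin n) :
    walkWeight μ w = ∏ e, μ (walkMult w e) := by
  refine Finset.prod_subset (Finset.subset_univ _) fun e _ he => ?_
  have : walkMult w e = 0 := by
    rw [walkMult, Finset.card_eq_zero, Finset.filter_eq_empty_iff]
    intro t _ ht
    exact he (ht ▸ Finset.mem_image_of_mem _ (Finset.mem_univ _))
  rw [this, hμ]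

theorem trace_moment {n K : ℕ} {a : Sym2 (Fin n) → Ω → ℝ} (h : iIndepFun a P)
    (ha : ∀ e, Measurable (a e)) (hint : ∀ e m, Integrable (fun ω => a e ω ^ m) P) {μ : ℕ → ℝ}
    (hμ : ∀ e m, ∫ ω, a e ω ^ m ∂P = μ m) (hμ0 : μ 0 = 1) :
    Integrable (fun ω => (symMatrix (fun e => a e ω) ^ (K + 1)).trace) P ∧
      ∫ ω, (symMatrix (fun e => a e ω) ^ (K + 1)).trace ∂P =
        ∑ w : Fin (K + 1) → Fin n, walkWeight μ w := by
  simp_rw [trace_pow_eq_sum_walks, prod_walk_eq]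
  have hI : ∀ w : Fin (K + 1) → Fin n, Integrable (fun ω => ∏ e, a e ω ^ walkMult w e) P := fun w =>
    integrable_prod_of_iIndepFun h ha (f := fun e x => x ^ walkMult w e)
      (fun e => by fun_prop) (fun e => hint e _)
  refine ⟨integrable_finsetSum _ fun w _ => hI w, ?_⟩
  rw [integral_finsetSum _ fun w _ => hI w]
  refine Finset.sum_congr rfl fun w _ => ?_
  rw [walkWeight_eq_prod_univ hμ0, h.integral_fun_prod_comp (f := fun e x => x ^ walkMult w e)
    (fun e => (ha e).aemeasurable) (fun e => by fun_prop)]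
  exact Finset.prod_congr rfl fun e _ => hμ e _

variable {n : ℕ} {p B : ℝ} {δ ξ : Sym2 (Fin n) → Ω → ℝ}

theorem IsSparseModel.iIndepFun_pair (h : IsSparseModel P n p B δ ξ) :
    iIndepFun (fun e ω => (δ e ω, ξ e ω)) P := by
  classical
  have hm : ∀ i, Measurable (Sum.elim δ ξ i) := by
    rintro (e | e)
    · exact h.measurable_delta e
    · exact h.measurable_xi e
  have hb := iIndepFun_blocks h.indep hm (S := fun e => {Sum.inl e, Sum.inr e}) (by
    intro e f hef
    simp [hef.symm])
  exact hb.comp (fun e x => (x ⟨Sum.inl e, by simp⟩, x ⟨Sum.inr e, by simp⟩))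
    (fun e => (measurable_pi_apply _).prodMk (measurable_pi_apply _))

theorem IsSparseModel.measurable_pair (h : IsSparseModel P n p B δ ξ) (e : Sym2 (Fin n)) :
    Measurable (fun ω => (δ e ω, ξ e ω)) :=
  (h.measurable_delta e).prodMk (h.measurable_xi e)

theorem IsSparseModel.indepFun_delta_xi (h : IsSparseModel P n p B δ ξ) (e : Sym2 (Fin n)) :
    IndepFun (δ e) (ξ e) P :=
  h.indep.indepFun (i := Sum.inl e) (j := Sum.inr e) (by simp)

theorem integral_sq_eq_one [IsProbabilityMeasure P] {X : Ω → ℝ} (hX : Measurable X)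
    (h0 : ∫ ω, X ω ∂P = 0) (h1 : variance X P = 1) : ∫ ω, X ω ^ 2 ∂P = 1 := by
  rw [variance_eq_integral hX.aemeasurable, h0] at h1
  simpa using h1

theorem SubgaussianMomentLE.integrable_abs_pow [IsProbabilityMeasure P] {X : Ω → ℝ} {B : ℝ}
    (hB : 0 < B) (hX : Measurable X) (h : SubgaussianMomentLE P X B) (m : ℕ) :
    Integrable (fun ω => |X ω| ^ m) P := by
  have hc : 0 < Real.sqrt (2 * B ^ 2) := by positivity
  refine ((h.integrable_exp_sq hB hX).const_mul
    (Real.sqrt (2 * B ^ 2) ^ m * (m.factorial * Real.exp 1))).mono' (by fun_prop) ?_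
  filter_upwards with ω
  rw [Real.norm_of_nonneg (by positivity)]
  set y := |X ω| / Real.sqrt (2 * B ^ 2) with hy
  have hy0 : 0 ≤ y := by positivity
  have e1 : |X ω| = Real.sqrt (2 * B ^ 2) * y := by rw [hy]; field_simp
  have e2 : X ω ^ 2 / (2 * B ^ 2) = y ^ 2 := by
    rw [hy, div_pow, sq_abs, Real.sq_sqrt (by positivity)]
  rw [e2, e1, mul_pow]
  have h1 := Real.pow_div_factorial_le_exp y hy0 m
  rw [div_le_iff₀ (by positivity)] at h1
  have h2 : Real.exp y ≤ Real.exp 1 * Real.exp (y ^ 2) := by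
    rw [← Real.exp_add]
    exact Real.exp_le_exp.2 (by nlinarith [sq_nonneg (y - 1)])
  calc Real.sqrt (2 * B ^ 2) ^ m * y ^ m
      ≤ Real.sqrt (2 * B ^ 2) ^ m * (Real.exp y * m.factorial) := by gcongr
    _ ≤ Real.sqrt (2 * B ^ 2) ^ m * ((Real.exp 1 * Real.exp (y ^ 2)) * m.factorial) := by gcongr
    _ = _ := by ring

theorem SubgaussianMomentLE.integrable_pow [IsProbabilityMeasure P] {X : Ω → ℝ} {B : ℝ}
    (hB : 0 < B) (hX : Measurable X) (h : SubgaussianMomentLE P X B) (m : ℕ) :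
    Integrable (fun ω => X ω ^ m) P :=
  (h.integrable_abs_pow hB hX m).mono' (by fun_prop) (by
    filter_upwards with ω; rw [Real.norm_eq_abs, abs_pow])

theorem IsSparseModel.integral_delta_pow [IsProbabilityMeasure P] (h : IsSparseModel P n p B δ ξ)
    (e : Sym2 (Fin n)) {m : ℕ} (hm : m ≠ 0) :
    Integrable (fun ω => δ e ω ^ m) P ∧ ∫ ω, δ e ω ^ m ∂P = p := by
  have hmeas : MeasurableSet {ω | δ e ω = 1} := h.measurable_delta e (measurableSet_singleton 1)
  have hae : (fun ω => δ e ω ^ m) =ᵐ[P] ({ω | δ e ω = 1}).indicator fun _ => (1 : ℝ) := by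
    filter_upwards [h.delta_zero_or_one e] with ω hω
    rcases hω with hω | hω <;> simp [Set.indicator, hω, hm]
  refine ⟨((integrable_const (1 : ℝ)).indicator hmeas).congr hae.symm, ?_⟩
  rw [integral_congr_ae hae, integral_indicator_const _ hmeas, h.delta_prob e]
  simp

theorem IsSparseModel.integral_entry_pow [IsProbabilityMeasure P] (h : IsSparseModel P n p B δ ξ)
    (hB : 0 < B) (e e' : Sym2 (Fin n)) {m : ℕ} (hm : m ≠ 0) :
    Integrable (fun ω => (δ e ω * ξ e ω) ^ m) P ∧
      ∫ ω, (δ e ω * ξ e ω) ^ m ∂P = p * ∫ ω, ξ e' ω ^ m ∂P := by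
  obtain ⟨h1, h2⟩ := h.integral_delta_pow e hm
  have h3 := (h.xi_subgaussian e).integrable_pow hB (h.measurable_xi e) m
  have hind : IndepFun (fun ω => δ e ω ^ m) (fun ω => ξ e ω ^ m) P :=
    (h.indepFun_delta_xi e).comp (φ := fun x => x ^ m) (ψ := fun x => x ^ m)
      (by fun_prop) (by fun_prop)
  simp_rw [mul_pow]
  refine ⟨hind.integrable_mul h1 h3, ?_⟩
  have := hind.integral_fun_mul_eq_mul_integral h1.aestronglyMeasurable h3.aestronglyMeasurable
  rw [this, h2]
  congr 1
  exact ((h.xi_identDistrib e e').comp (u := fun x => x ^ m) (by fun_prop)).integral_eq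

/-- A centered subgaussian law whose moments dominate those of a given subgaussian variable. -/
theorem exists_dominating_law {B : ℝ} (hB : 0 < B) : ∃ c : ℝ≥0, ∀ {Ω : Type*} [MeasurableSpace Ω]
    (P : Measure Ω) [IsProbabilityMeasure P] (X : Ω → ℝ), Measurable X → ∫ ω, X ω ∂P = 0 →
    variance X P = 1 → SubgaussianMomentLE P X B →
    ∃ γ : Measure ℝ, IsProbabilityMeasure γ ∧ HasSubgaussianMGF id c γ ∧ ∫ x, x ∂γ = 0 ∧
      (∀ m : ℕ, 0 ≤ ∫ x, x ^ m ∂γ) ∧ ∀ m : ℕ, 2 ≤ m → |∫ ω, X ω ^ m ∂P| ≤ ∫ x, x ^ m ∂γ := by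
  refine ⟨Real.toNNReal (2 * (1 + Real.exp (1 / (8 * B ^ 2))) / (1 / (12 * B ^ 2))),
    fun {Ω} _ P _ X hX h0 h1 hs => ?_⟩
  set s := Real.sqrt 6 with hs6
  have hs2 : s ^ 2 = 6 := Real.sq_sqrt (by norm_num)
  have hs0 : 0 < s := by positivity
  set E := ∫ ω, |X ω| ∂P with hE
  have hI1 : Integrable (fun ω => |X ω|) P := by simpa using hs.integrable_abs_pow hB hX 1
  have hE0 : 0 ≤ E := integral_nonneg fun _ => abs_nonneg _
  have hJ : ∀ m : ℕ, E ^ m ≤ ∫ ω, |X ω| ^ m ∂P := by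
    intro m
    exact (convexOn_pow m).map_integral_le (continuous_pow m).continuousOn isClosed_Ici
      (Filter.Eventually.of_forall fun ω => abs_nonneg (X ω)) hI1 (hs.integrable_abs_pow hB hX m)
  have hE1 : E ≤ 1 := by
    have := hJ 2
    simp_rw [sq_abs, integral_sq_eq_one hX h0 h1] at this
    nlinarith
  set b := s * E / 2 with hb
  have hb0 : 0 ≤ b := by positivity
  have hY : Measurable fun ω => s * |X ω| := by fun_prop
  have hprob : IsProbabilityMeasure (P.map fun ω => s * |X ω|) :=
    Measure.isProbabilityMeasure_map hY.aemeasurable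
  -- Mixture of the law of √6|X| with weight 1/3 and an atom at -b with weight 2/3; b = √6 E|X|/2
  -- makes the mean zero. For m ≥ 2, Jensen and 2^m ≥ 4 bound the atom's contribution by half of the
  -- other one, leaving at least (√6)^m E|X|^m/6 ≥ E|X|^m.
  set γ : Measure ℝ := ENNReal.ofReal (1 / 3) • (P.map fun ω => s * |X ω|) +
    ENNReal.ofReal (2 / 3) • Measure.dirac (-b) with hγ
  have hγp : IsProbabilityMeasure γ := by
    constructor
    simp only [hγ, Measure.coe_add, Measure.coe_smul, Pi.add_apply, Pi.smul_apply, measure_univ,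
      smul_eq_mul, mul_one]
    rw [← ENNReal.ofReal_add (by norm_num) (by norm_num)]
    norm_num
  have hint : ∀ f : ℝ → ℝ, Measurable f → Integrable (fun ω => f (s * |X ω|)) P →
      Integrable f γ ∧ ∫ x, f x ∂γ = 1 / 3 * ∫ ω, f (s * |X ω|) ∂P + 2 / 3 * f (-b) := by
    intro f hf hfi
    have i1 : Integrable f (P.map fun ω => s * |X ω|) := by
      rw [integrable_map_measure hf.aestronglyMeasurable hY.aemeasurable]; exact hfi
    have i2 : Integrable f (Measure.dirac (-b)) :=
      integrable_dirac (by simp)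
    have j1 := i1.smul_measure (ENNReal.ofReal_ne_top (r := 1 / 3))
    have j2 := i2.smul_measure (ENNReal.ofReal_ne_top (r := 2 / 3))
    refine ⟨j1.add_measure j2, ?_⟩
    rw [hγ, integral_add_measure j1 j2, integral_smul_measure, integral_smul_measure,
      integral_dirac, integral_map hY.aemeasurable hf.aestronglyMeasurable,
      ENNReal.toReal_ofReal (by norm_num), ENNReal.toReal_ofReal (by norm_num)]
    simp
  have hmom : ∀ m : ℕ, ∫ x, x ^ m ∂γ = 1 / 3 * (s ^ m * ∫ ω, |X ω| ^ m ∂P) + 2 / 3 * (-b) ^ m := by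
    intro m
    have := (hint (fun x => x ^ m) (by fun_prop) (by
      simp_rw [mul_pow]
      exact (hs.integrable_abs_pow hB hX m).const_mul _)).2
    rw [this]
    simp_rw [mul_pow]
    rw [integral_const_mul]
  have hmean : ∫ x, x ∂γ = 0 := by
    have := hmom 1
    simp only [pow_one] at this
    rw [this, ← hE, hb]; ring
  have hbig : ∀ m : ℕ, 2 ≤ m → |∫ ω, X ω ^ m ∂P| ≤ ∫ x, x ^ m ∂γ := by
    intro m hm
    set A := ∫ ω, |X ω| ^ m ∂P with hA
    have hA0 : 0 ≤ A := integral_nonneg fun _ => by positivity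
    have hXA : |∫ ω, X ω ^ m ∂P| ≤ A := by
      refine abs_integral_le_integral_abs.trans (le_of_eq ?_)
      simp_rw [abs_pow]; rfl
    refine hXA.trans ?_
    rw [hmom m]
    have h6 : 6 ≤ s ^ m := by
      have hs1 : 1 ≤ s := by nlinarith
      calc (6 : ℝ) = s ^ 2 := hs2.symm
        _ ≤ s ^ m := pow_le_pow_right₀ hs1 hm
    have h4 : (4 : ℝ) ≤ 2 ^ m := by
      calc (4 : ℝ) = 2 ^ 2 := by norm_num
        _ ≤ 2 ^ m := pow_le_pow_right₀ (by norm_num) hm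
    have hbm : (-b) ^ m ≥ -(s ^ m * A / 4) := by
      have h5 : |(-b) ^ m| ≤ s ^ m * A / 4 := by
        rw [abs_pow, abs_neg, abs_of_nonneg hb0, hb, div_pow, mul_pow]
        have := hJ m
        exact div_le_div₀ (by positivity) (by gcongr) (by norm_num) h4
      exact (abs_le.1 h5).1
    nlinarith [mul_le_mul_of_nonneg_right h6 hA0]
  have hexp := hint (fun x => Real.exp (1 / (12 * B ^ 2) * x ^ 2)) (by fun_prop) (by
      refine (hs.integrable_exp_sq hB hX).congr (Filter.Eventually.of_forall fun ω => ?_)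
      simp only
      rw [mul_pow, sq_abs, hs2]
      congr 1; field_simp; ring)
  refine ⟨γ, hγp, ?_, hmean, ?_, hbig⟩
  · refine hasSubgaussianMGF_of_exp_sq (by positivity) measurable_id.aemeasurable hexp.1 ?_ hmean
    simp only [id]
    rw [hexp.2]
    have e1 : ∫ ω, Real.exp (1 / (12 * B ^ 2) * (s * |X ω|) ^ 2) ∂P ≤ 3 := by
      refine le_trans (le_of_eq ?_) (hs.integral_exp_sq_le hB hX)
      refine integral_congr_ae (Filter.Eventually.of_forall fun ω => ?_)
      simp only
      rw [mul_pow, sq_abs, hs2]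
      congr 1; field_simp; ring
    have e2 : Real.exp (1 / (12 * B ^ 2) * (-b) ^ 2) ≤ Real.exp (1 / (8 * B ^ 2)) := by
      refine Real.exp_le_exp.2 ?_
      have : (-b) ^ 2 ≤ 3 / 2 := by
        have e : (-b) ^ 2 = s ^ 2 * E ^ 2 / 4 := by rw [hb]; ring
        rw [e, hs2]
        nlinarith
      calc 1 / (12 * B ^ 2) * (-b) ^ 2 ≤ 1 / (12 * B ^ 2) * (3 / 2) := by gcongr
        _ = 1 / (8 * B ^ 2) := by field_simp; norm_num
    have := Real.exp_pos (1 / (8 * B ^ 2))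
    linarith
  · intro m
    rcases Nat.lt_or_ge m 2 with hm | hm
    · interval_cases m
      · simp
      · simp [hmean]
    · exact (abs_nonneg _).trans (hbig m hm)

end Independence
end SparseRandomMatrix

namespace SparseRandomMatrix

open scoped NNReal ENNReal

/-! ### Operator norms through traces and nets. -/

section OperatorNorm

open scoped Matrix.Norms.L2Operator

variable {n : ℕ}

theorem sq_norm_le_sum_sq (A : Matrix (Fin n) (Fin n) ℝ) : ‖A‖ ^ 2 ≤ ∑ i, ∑ j, A i j ^ 2 := by
  set F := ∑ i, ∑ j, A i j ^ 2 with hF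
  have hF0 : 0 ≤ F := Finset.sum_nonneg fun _ _ => Finset.sum_nonneg fun _ _ => sq_nonneg _
  have h : ‖A‖ ≤ Real.sqrt F := by
    rw [Matrix.cstar_norm_def]
    refine ContinuousLinearMap.opNorm_le_bound _ (Real.sqrt_nonneg _) fun x => ?_
    refine abs_le_of_sq_le_sq' ?_ (by positivity) |>.2
    rw [mul_pow, Real.sq_sqrt hF0, EuclideanSpace.real_norm_sq_eq, EuclideanSpace.real_norm_sq_eq,
      hF, Finset.sum_mul]
    refine Finset.sum_le_sum fun i _ => ?_
    exact Finset.sum_mul_sq_le_sq_mul_sq Finset.univ (fun j => A i j) (fun j => x j)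
  calc ‖A‖ ^ 2 ≤ Real.sqrt F ^ 2 := by gcongr
    _ = F := Real.sq_sqrt hF0

/-- The C*-identity gives ‖A^(2^j)‖ = ‖A‖^(2^j), and the squared Hilbert–Schmidt norm of A^(2^j) is
the trace of A^(2^(j+1)). Hence the exponents that are powers of two. -/
theorem norm_pow_le_trace {A : Matrix (Fin n) (Fin n) ℝ} (hA : IsSelfAdjoint A) (j : ℕ) :
    ‖A‖ ^ (2 ^ (j + 1)) ≤ (A ^ (2 ^ (j + 1))).trace := by
  set M := A ^ (2 ^ j) with hM
  have hMs : IsSelfAdjoint M := hA.pow _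
  have h1 : ‖M‖ = ‖A‖ ^ (2 ^ j) := by
    have := hA.nnnorm_pow_two_pow j
    exact congrArg NNReal.toReal this
  have h2 : ∑ i, ∑ j, M i j ^ 2 = (A ^ (2 ^ (j + 1))).trace := by
    rw [pow_succ 2 j, mul_two, pow_add, ← hM, Matrix.trace]
    refine Finset.sum_congr rfl fun i _ => ?_
    rw [Matrix.diag_apply, Matrix.mul_apply]
    refine Finset.sum_congr rfl fun j _ => ?_
    have : M j i = M i j := by
      have := congrFun (congrFun hMs i) j
      simpa [Matrix.star_apply] using this
    rw [this, sq]
  rw [pow_succ 2 j, pow_mul, ← h1, ← pow_succ, ← h2]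
  exact sq_norm_le_sum_sq M

theorem trace_pow_le (A : Matrix (Fin n) (Fin n) ℝ) (N : ℕ) :
    (A ^ (N + 1)).trace ≤ n * ‖A‖ ^ (N + 1) := by
  set M := A ^ (N + 1) with hM
  have h : ∀ i, M i i ≤ ‖M‖ := by
    intro i
    have h1 := Matrix.l2_opNorm_mulVec M (EuclideanSpace.single i 1)
    rw [PiLp.norm_single, norm_one, mul_one] at h1
    have h2 := (PiLp.norm_apply_le (WithLp.toLp 2 (M.mulVec
      (EuclideanSpace.single i (1 : ℝ)).ofLp)) i).trans h1
    have h3 : (WithLp.toLp 2 (M.mulVec (EuclideanSpace.single i (1 : ℝ)).ofLp)) i = M i i := by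
      simp
    rw [h3] at h2
    exact (le_abs_self _).trans h2
  calc M.trace = ∑ i, M i i := rfl
    _ ≤ ∑ _i : Fin n, ‖M‖ := Finset.sum_le_sum fun i _ => h i
    _ = n * ‖M‖ := by simp
    _ ≤ n * ‖A‖ ^ (N + 1) := by gcongr; exact norm_pow_le' A (Nat.succ_pos N)

/-- Replacing both unit vectors by points of a 1/4-net costs 2·‖A‖/4, which is absorbed on the left.
Rounding towards zero keeps the net points in the unit ball. -/
theorem norm_le_of_latticePoint (hn : 0 < n) {A : Matrix (Fin n) (Fin n) ℝ} {m : ℝ}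
    (h : ∀ z ∈ latticeNet n 4 n, ∀ z' ∈ latticeNet n 4 n, ‖latticePoint (1 / 4) n z‖ ≤ 1 →
      ‖latticePoint (1 / 4) n z'‖ ≤ 1 →
      |inner ℝ (latticePoint (1 / 4) n z) (Matrix.toEuclideanCLM (n := Fin n) (𝕜 := ℝ) A
        (latticePoint (1 / 4) n z'))| ≤ m) : ‖A‖ ≤ 2 * m := by
  set T := Matrix.toEuclideanCLM (n := Fin n) (𝕜 := ℝ) A with hT
  have hAT : ‖A‖ = ‖T‖ := Matrix.cstar_norm_def A
  have happ : ∀ x : EuclideanSpace ℝ (Fin n), ‖x‖ ≤ 1 → ∃ z ∈ latticeNet n 4 n,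
      ‖latticePoint (1 / 4) n z‖ ≤ 1 ∧ ‖x - latticePoint (1 / 4) n z‖ ≤ 1 / 4 := by
    intro x hx
    obtain ⟨z, hz, hz1, hz2⟩ := exists_latticePoint_near x hn (ε := 1 / 4) (by norm_num) hx
      ((Finset.card_le_univ _).trans (by simp))
    refine ⟨z, by norm_num at hz; exact hz, ?_, hz1⟩
    refine le_trans ?_ hx
    refine abs_le_of_sq_le_sq' ?_ (norm_nonneg _) |>.2
    rw [EuclideanSpace.real_norm_sq_eq, EuclideanSpace.real_norm_sq_eq]
    refine Finset.sum_le_sum fun j _ => ?_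
    rw [← sq_abs, ← sq_abs (x j)]
    exact pow_le_pow_left₀ (abs_nonneg _) (hz2 j).1 2
  have hb : ∀ x y : EuclideanSpace ℝ (Fin n), ‖x‖ ≤ 1 → ‖y‖ ≤ 1 →
      inner ℝ y (T x) ≤ m + 1 / 2 * ‖T‖ := by
    intro x y hx hy
    obtain ⟨z, hz, hz1, hz2⟩ := happ y hy
    obtain ⟨z', hz', hz1', hz2'⟩ := happ x hx
    set y' := latticePoint (1 / 4) n z
    set x' := latticePoint (1 / 4) n z'
    have e : inner ℝ y (T x) = inner ℝ (y - y') (T x) + inner ℝ y' (T (x - x')) +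
        inner ℝ y' (T x') := by
      rw [map_sub, inner_sub_left, inner_sub_right]; ring
    have b1 : inner ℝ (y - y') (T x) ≤ 1 / 4 * ‖T‖ := by
      refine (real_inner_le_norm _ _).trans ?_
      refine mul_le_mul hz2 ?_ (norm_nonneg _) (by norm_num)
      exact (T.le_opNorm x).trans (mul_le_of_le_one_right (norm_nonneg _) hx)
    have b2 : inner ℝ y' (T (x - x')) ≤ 1 * (‖T‖ * (1 / 4)) := by
      refine (real_inner_le_norm _ _).trans ?_
      refine mul_le_mul hz1 ?_ (norm_nonneg _) (by norm_num)
      exact (T.le_opNorm _).trans (mul_le_mul_of_nonneg_left hz2' (norm_nonneg _))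
    have b3 := (abs_le.1 (h z hz z' hz' hz1 hz1')).2
    linarith
  have hm0 : 0 ≤ m := by
    have h0 : (0 : Fin n → ℤ) ∈ latticeNet n 4 n := mem_latticeNet.2 (by simp)
    have : latticePoint (n := n) (1 / 4) n 0 = 0 := by ext j; simp [latticePoint]
    exact (abs_nonneg _).trans (h 0 h0 0 h0 (by rw [this]; simp) (by rw [this]; simp))
  have hfin : ‖T‖ ≤ m + 1 / 2 * ‖T‖ := by
    refine ContinuousLinearMap.opNorm_le_of_unit_norm (by positivity) fun x hx => ?_
    by_cases hTx : T x = 0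
    · rw [hTx, norm_zero]; positivity
    have hne : ‖T x‖ ≠ 0 := norm_ne_zero_iff.2 hTx
    have := hb x ((‖T x‖)⁻¹ • T x) hx.le (by
      rw [norm_smul, norm_inv, norm_norm, inv_mul_cancel₀ hne])
    rwa [real_inner_smul_left, real_inner_self_eq_norm_sq, sq, ← mul_assoc,
      inv_mul_cancel₀ hne, one_mul] at this
  rw [hAT]; linarith

end OperatorNorm

/-! ### Moments of bilinear forms in subgaussian entries. -/

section DenseMoment

variable {Ω : Type*} [MeasurableSpace Ω] {P : Measure Ω} {n : ℕ}

/-- The parameter u = √k balances u^(2k) = k^k against (2k)! ≤ (4k)^k k^k, while the generating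
function at ±√k is only exponential in k. -/
theorem HasSubgaussianMGF.integral_pow_le {S : Ω → ℝ} {v : ℝ≥0} (h : HasSubgaussianMGF S v P)
    {k : ℕ} (hk : 0 < k) :
    Integrable (fun ω => S ω ^ (2 * k)) P ∧
      ∫ ω, S ω ^ (2 * k) ∂P ≤ 2 * (4 * Real.exp (v / 2) * k) ^ k := by
  have hk' : (0 : ℝ) < k := by exact_mod_cast hk
  set u := Real.sqrt k with hu
  have hu0 : 0 < u := Real.sqrt_pos.2 hk'
  have hu2 : u ^ 2 = k := Real.sq_sqrt hk'.le
  have i1 := h.integrable_exp_mul u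
  have i2 := h.integrable_exp_mul (-u)
  have hpt : ∀ ω, S ω ^ (2 * k) ≤
      (4 * k : ℝ) ^ k * (Real.exp (u * S ω) + Real.exp (-u * S ω)) := by
    intro ω
    have h1 := Real.pow_div_factorial_le_exp (u * |S ω|) (by positivity) (2 * k)
    rw [div_le_iff₀ (by positivity)] at h1
    have h2 : Real.exp (u * |S ω|) ≤ Real.exp (u * S ω) + Real.exp (-u * S ω) := by
      rcases abs_choice (S ω) with h | h <;> rw [h]
      · linarith [Real.exp_pos (-u * S ω)]
      · have : u * -S ω = -u * S ω := by ring
        rw [this]; linarith [Real.exp_pos (u * S ω)]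
    have h3 : ((2 * k).factorial : ℝ) ≤ (4 * k : ℝ) ^ k * k ^ k := by
      calc ((2 * k).factorial : ℝ) ≤ ((2 * k : ℕ) : ℝ) ^ (2 * k) := by
            exact_mod_cast Nat.factorial_le_pow (2 * k)
        _ = (4 * k : ℝ) ^ k * k ^ k := by
            rw [← mul_pow, pow_mul]; push_cast; ring
    have h4 : (u * |S ω|) ^ (2 * k) = (k : ℝ) ^ k * S ω ^ (2 * k) := by
      rw [mul_pow, pow_mul, hu2, pow_mul |S ω|, sq_abs, ← pow_mul]
    rw [h4] at h1
    have h5 : (k : ℝ) ^ k * S ω ^ (2 * k) ≤ (k : ℝ) ^ k *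
        ((4 * k : ℝ) ^ k * (Real.exp (u * S ω) + Real.exp (-u * S ω))) := by
      calc (k : ℝ) ^ k * S ω ^ (2 * k) ≤ Real.exp (u * |S ω|) * (2 * k).factorial := h1
        _ ≤ (Real.exp (u * S ω) + Real.exp (-u * S ω)) * ((4 * k : ℝ) ^ k * k ^ k) := by gcongr
        _ = _ := by ring
    exact le_of_mul_le_mul_left h5 (by positivity)
  have hI : Integrable (fun ω => (4 * k : ℝ) ^ k * (Real.exp (u * S ω) + Real.exp (-u * S ω))) P :=
    (i1.add i2).const_mul _
  have hSI : Integrable (fun ω => S ω ^ (2 * k)) P := by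
    refine hI.mono' (h.aestronglyMeasurable.pow _) (Filter.Eventually.of_forall fun ω => ?_)
    rw [Real.norm_of_nonneg (by rw [pow_mul]; positivity)]
    exact hpt ω
  refine ⟨hSI, (integral_mono hSI hI hpt).trans ?_⟩
  rw [integral_const_mul, integral_add i1 i2]
  have m1 := h.mgf_le u
  have m2 := h.mgf_le (-u)
  rw [mgf] at m1 m2
  rw [neg_sq, hu2] at m2
  rw [hu2] at m1
  have e : Real.exp (v * k / 2) = Real.exp (v / 2) ^ k := by
    rw [← Real.exp_nat_mul]; congr 1; ring
  rw [e] at m1 m2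
  calc (4 * k : ℝ) ^ k * (∫ ω, Real.exp (u * S ω) ∂P + ∫ ω, Real.exp (-u * S ω) ∂P)
      ≤ (4 * k : ℝ) ^ k * (Real.exp (v / 2) ^ k + Real.exp (v / 2) ^ k) := by gcongr
    _ = _ := by rw [mul_right_comm 4, mul_pow (4 * (k : ℝ))]; ring

/-- Each independent entry occupies at most two positions of the symmetric matrix, so the squared
coefficients sum to at most 2‖x‖²‖y‖². -/
theorem hasSubgaussianMGF_bilinear {a : Sym2 (Fin n) → Ω → ℝ} (h : iIndepFun a P) {c : ℝ≥0}
    (hs : ∀ e, HasSubgaussianMGF (a e) c P) {x y : EuclideanSpace ℝ (Fin n)} (hx : ‖x‖ ≤ 1)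
    (hy : ‖y‖ ≤ 1) :
    HasSubgaussianMGF (fun ω => inner ℝ y (Matrix.toEuclideanCLM (n := Fin n) (𝕜 := ℝ)
      (symMatrix fun e => a e ω) x)) (2 * c) P := by
  set T : Sym2 (Fin n) → Finset (Fin n × Fin n) := fun e =>
    Finset.univ.filter fun q => s(q.1, q.2) = e with hT
  set b : Sym2 (Fin n) → ℝ := fun e => ∑ q ∈ T e, y q.1 * x q.2 with hb
  have hsum : ∀ ω, inner ℝ y (Matrix.toEuclideanCLM (n := Fin n) (𝕜 := ℝ)
      (symMatrix fun e => a e ω) x) = ∑ e, b e * a e ω := by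
    intro ω
    rw [Matrix.inner_toEuclideanCLM]
    simp only [dotProduct, Matrix.mulVec, symMatrix, Matrix.of_apply]
    calc _ = ∑ q : Fin n × Fin n, (y q.1 * x q.2) * a s(q.1, q.2) ω := by
          rw [Fintype.sum_prod_type]
          refine Finset.sum_congr rfl fun i _ => ?_
          rw [Finset.mul_sum]
          refine Finset.sum_congr rfl fun j _ => ?_
          ring
      _ = ∑ e, ∑ q ∈ T e, (y q.1 * x q.2) * a s(q.1, q.2) ω :=
          (Finset.sum_fiberwise Finset.univ (fun q : Fin n × Fin n => s(q.1, q.2)) _).symm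
      _ = _ := by
          refine Finset.sum_congr rfl fun e _ => ?_
          rw [hb, Finset.sum_mul]
          refine Finset.sum_congr rfl fun q hq => ?_
          rw [(Finset.mem_filter.1 hq).2]
  simp_rw [hsum]
  have hb2 : ∑ e, b e ^ 2 ≤ 2 := by
    have hcard : ∀ e, (T e).card ≤ 2 := by
      intro e
      induction e using Sym2.ind with
      | _ i j =>
        have : T s(i, j) ⊆ {(i, j), (j, i)} := by
          rintro ⟨k, l⟩ hq
          have := (Finset.mem_filter.1 hq).2
          simp only [Sym2.eq_iff] at this
          simp only [Finset.mem_insert, Finset.mem_singleton, Prod.mk.injEq]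
          tauto
        exact (Finset.card_le_card this).trans Finset.card_le_two
    calc ∑ e, b e ^ 2 ≤ ∑ e, 2 * ∑ q ∈ T e, (y q.1 * x q.2) ^ 2 := by
          refine Finset.sum_le_sum fun e _ => ?_
          refine sq_sum_le_card_mul_sum_sq.trans ?_
          have : ((T e).card : ℝ) ≤ 2 := by exact_mod_cast hcard e
          gcongr
      _ = 2 * ∑ q : Fin n × Fin n, (y q.1 * x q.2) ^ 2 := by
          rw [← Finset.mul_sum]
          congr 1
          exact Finset.sum_fiberwise Finset.univ (fun q : Fin n × Fin n => s(q.1, q.2)) _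
      _ = 2 * (‖y‖ ^ 2 * ‖x‖ ^ 2) := by
          rw [EuclideanSpace.real_norm_sq_eq, EuclideanSpace.real_norm_sq_eq,
            Finset.sum_mul_sum, Fintype.sum_prod_type]
          simp_rw [mul_pow]
      _ ≤ 2 * (1 ^ 2 * 1 ^ 2) := by gcongr
      _ = 2 := by norm_num
  have hind : iIndepFun (fun e ω => b e * a e ω) P :=
    h.comp (fun e x => b e * x) (fun e => by fun_prop)
  have hS := HasSubgaussianMGF.sum_of_iIndepFun hind (s := Finset.univ)
    (fun e _ => (hs e).const_mul (b e))
  refine ⟨hS.integrable_exp_mul, fun t => (hS.mgf_le t).trans (Real.exp_le_exp.2 ?_)⟩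
  have : ((∑ e, (⟨b e ^ 2, sq_nonneg _⟩ * c : ℝ≥0) : ℝ≥0) : ℝ) ≤ (2 * c : ℝ≥0) := by
    have e : ((∑ e, (⟨b e ^ 2, sq_nonneg _⟩ * c : ℝ≥0) : ℝ≥0) : ℝ) = ∑ e, b e ^ 2 * (c : ℝ) := by
      rw [NNReal.coe_sum]; rfl
    rw [e, ← Finset.sum_mul, NNReal.coe_mul]
    gcongr
    exact hb2
  gcongr

end DenseMoment
end SparseRandomMatrix

namespace SparseRandomMatrix

open scoped NNReal ENNReal

/-! ### Operator norm of the sparse matrix. -/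

section NormBound

open scoped Matrix.Norms.L2Operator

variable {Ω : Type*} [MeasurableSpace Ω] {P : Measure Ω}

/-- Moments of the trace of a dense symmetric matrix with independent subgaussian entries. -/
theorem integral_trace_pow_le {r k : ℕ} (hk : 0 < k) (hr : r = 2 * k)
    {a : Sym2 (Fin r) → Ω → ℝ} (h : iIndepFun a P) {c : ℝ≥0}
    (hs : ∀ e, HasSubgaussianMGF (a e) c P)
    (hint : Integrable (fun ω => (symMatrix (fun e => a e ω) ^ (2 * k)).trace) P) :
    ∫ ω, (symMatrix (fun e => a e ω) ^ (2 * k)).trace ∂P ≤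
      4 * k * (16 * Real.exp (36 + c) * k) ^ k := by
  classical
  have hr0 : 0 < r := by omega
  set N := (latticeNet r 4 r).filter fun z => ‖latticePoint (1 / 4) r z‖ ≤ 1 with hN
  set S : (Fin r → ℤ) × (Fin r → ℤ) → Ω → ℝ := fun q ω =>
    inner ℝ (latticePoint (1 / 4) r q.1) (Matrix.toEuclideanCLM (n := Fin r) (𝕜 := ℝ)
      (symMatrix fun e => a e ω) (latticePoint (1 / 4) r q.2)) with hS
  have hmom : ∀ q ∈ N ×ˢ N, Integrable (fun ω => S q ω ^ (2 * k)) P ∧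
      ∫ ω, S q ω ^ (2 * k) ∂P ≤ 2 * (4 * Real.exp c * k) ^ k := by
    intro q hq
    obtain ⟨h1, h2⟩ := Finset.mem_product.1 hq
    have := HasSubgaussianMGF.integral_pow_le (hasSubgaussianMGF_bilinear h hs
      (Finset.mem_filter.1 h2).2 (Finset.mem_filter.1 h1).2) hk
    refine ⟨this.1, this.2.trans (le_of_eq ?_)⟩
    push_cast
    rw [mul_div_cancel_left₀ _ (two_ne_zero)]
  have hpt : ∀ ω, (symMatrix (fun e => a e ω) ^ (2 * k)).trace ≤
      r * (4 ^ k * ∑ q ∈ N ×ˢ N, S q ω ^ (2 * k)) := by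
    intro ω
    set A := symMatrix fun e => a e ω with hA
    set F := ∑ q ∈ N ×ˢ N, S q ω ^ (2 * k) with hF
    have hterm : ∀ q, 0 ≤ S q ω ^ (2 * k) := fun q => by rw [pow_mul]; positivity
    have hF0 : 0 ≤ F := Finset.sum_nonneg fun q _ => hterm q
    have h2k : (2 * k) ≠ 0 := by omega
    -- The maximum over the net is replaced by the ℓ^(2k) norm; as the net has exp(O(k)) points,
    -- this costs only a constant to the power k.
    set m := F ^ ((1 : ℝ) / (2 * k : ℕ)) with hm
    have hm0 : 0 ≤ m := Real.rpow_nonneg hF0 _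
    have hmk : m ^ (2 * k) = F := by
      rw [hm, one_div, Real.rpow_inv_natCast_pow hF0 h2k]
    have hA2 : ‖A‖ ≤ 2 * m := by
      refine norm_le_of_latticePoint hr0 fun z hz z' hz' hz1 hz1' => ?_
      refine le_of_pow_le_pow_left₀ h2k hm0 ?_
      have hmem : (z, z') ∈ N ×ˢ N :=
        Finset.mem_product.2 ⟨Finset.mem_filter.2 ⟨hz, hz1⟩, Finset.mem_filter.2 ⟨hz', hz1'⟩⟩
      have hle : S (z, z') ω ^ (2 * k) ≤ F :=
        Finset.single_le_sum (f := fun q => S q ω ^ (2 * k)) (fun q _ => hterm q) hmem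
      rw [hmk, (even_two_mul k).pow_abs]
      exact hle
    have h1 := trace_pow_le A (2 * k - 1)
    rw [Nat.sub_add_cancel (by omega)] at h1
    refine h1.trans ?_
    gcongr
    calc ‖A‖ ^ (2 * k) ≤ (2 * m) ^ (2 * k) := by gcongr
      _ = 4 ^ k * F := by rw [mul_pow, hmk, pow_mul]; norm_num
  have hcard : ((N ×ˢ N).card : ℝ) ≤ Real.exp 36 ^ k := by
    -- With R = 4 and δ = 1 the count is exp(8r)·exp(r) = exp(18k), because r = 2k.
    have h1 := card_latticeNet_le r (R := 4) (δ := 1) (by norm_num) (by norm_num) le_rfl r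
    have h2 : (N.card : ℝ) ≤ Real.exp 18 ^ k := by
      calc (N.card : ℝ) ≤ ((latticeNet r 4 r).card : ℝ) := by
            exact_mod_cast Finset.card_filter_le _ _
        _ ≤ _ := h1
        _ = Real.exp 18 ^ k := by
            rw [div_one, ← Real.exp_nat_mul, ← Real.exp_nat_mul, ← Real.exp_add, hr]
            congr 1; push_cast; ring
    rw [Finset.card_product]
    push_cast
    calc (N.card : ℝ) * N.card ≤ Real.exp 18 ^ k * Real.exp 18 ^ k := by gcongr
      _ = Real.exp 36 ^ k := by rw [← mul_pow, ← Real.exp_add]; norm_num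
  have hI : Integrable (fun ω => (r : ℝ) * (4 ^ k * ∑ q ∈ N ×ˢ N, S q ω ^ (2 * k))) P :=
    ((integrable_finsetSum _ fun q hq => (hmom q hq).1).const_mul _).const_mul _
  refine (integral_mono hint hI hpt).trans ?_
  rw [integral_const_mul, integral_const_mul, integral_finsetSum _ fun q hq => (hmom q hq).1]
  have h3 : ∑ q ∈ N ×ˢ N, ∫ ω, S q ω ^ (2 * k) ∂P ≤
      Real.exp 36 ^ k * (2 * (4 * Real.exp c * k) ^ k) := by
    refine (Finset.sum_le_card_nsmul _ _ _ fun q hq => (hmom q hq).2).trans ?_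
    rw [nsmul_eq_mul]
    gcongr
  calc (r : ℝ) * (4 ^ k * ∑ q ∈ N ×ˢ N, ∫ ω, S q ω ^ (2 * k) ∂P)
      ≤ r * (4 ^ k * (Real.exp 36 ^ k * (2 * (4 * Real.exp c * k) ^ k))) := by gcongr
    _ = _ := by
      rw [hr, Real.exp_add]
      have : (16 * (Real.exp 36 * Real.exp c) * (k : ℝ)) ^ k =
        4 ^ k * Real.exp 36 ^ k * (4 * Real.exp c * k) ^ k := by
        rw [← mul_pow, ← mul_pow]; congr 1; ring
      rw [this]; push_cast; ring

theorem sparseMatrix_eq_symMatrix {Ω : Type*} {n : ℕ} (δ ξ : Sym2 (Fin n) → Ω → ℝ) (ω : Ω) :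
    sparseMatrix δ ξ ω = symMatrix fun e => δ e ω * ξ e ω := rfl

theorem IsSparseModel.integral_trace_pow_le {B : ℝ} (hB : 0 < B) : ∃ c : ℝ, 0 < c ∧
    ∀ {Ω : Type*} [MeasurableSpace Ω] (P : Measure Ω) [IsProbabilityMeasure P]
      (n : ℕ) (p : ℝ) (δ ξ : Sym2 (Fin n) → Ω → ℝ), IsSparseModel P n p B δ ξ → 0 < n →
      0 < p → p ≤ 1 → ∀ k : ℕ, 0 < k → n * p ≤ k →
      Integrable (fun ω => (sparseMatrix δ ξ ω ^ (2 * k)).trace) P ∧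
      ∫ ω, (sparseMatrix δ ξ ω ^ (2 * k)).trace ∂P ≤ 1 / p * (4 * k * (c * k) ^ k) := by
  obtain ⟨c, hc⟩ := exists_dominating_law hB
  refine ⟨16 * Real.exp (36 + c), by positivity, fun {Ω} _ P _ n p δ ξ h hn hp0 hp1 k hk hkn => ?_⟩
  set e₀ : Sym2 (Fin n) := s(⟨0, hn⟩, ⟨0, hn⟩)
  obtain ⟨γ, hγ, hγs, hγ1, hγ0, hγ2⟩ := hc P (ξ e₀) (h.measurable_xi e₀) (h.xi_mean e₀)
    (h.xi_variance e₀) (h.xi_subgaussian e₀)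
  obtain ⟨K, hK⟩ : ∃ K, K + 1 = 2 * k := ⟨2 * k - 1, by omega⟩
  -- The moment of order 0 is 1 and not p, hence the case distinction.
  set μ : ℕ → ℝ := fun m => if m = 0 then 1 else p * ∫ ω, ξ e₀ ω ^ m ∂P with hμ
  set ν : ℕ → ℝ := fun m => ∫ x, x ^ m ∂γ with hν
  have hindA : iIndepFun (fun e ω => δ e ω * ξ e ω) P :=
    h.iIndepFun_pair.comp (fun _ x => x.1 * x.2) (fun _ => by fun_prop)
  have hA := trace_moment (K := K) hindA
    (fun e => (h.measurable_delta e).mul (h.measurable_xi e))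
    (fun e m => by
      rcases eq_or_ne m 0 with rfl | hm
      · simp
      · exact (h.integral_entry_pow hB e e₀ hm).1) (μ := μ)
    (fun e m => by
      rcases eq_or_ne m 0 with rfl | hm
      · simp [hμ]
      · simp only [hμ, if_neg hm]
        exact (h.integral_entry_pow hB e e₀ hm).2) (by simp [hμ])
  simp_rw [← sparseMatrix_eq_symMatrix, hK] at hA
  refine ⟨hA.1, ?_⟩
  rw [hA.2]
  set r := 2 * k with hr
  have hcomp := sum_walkWeight_le (K := K) (n := n) (r := r) (k := k) hp0 hn hK
    (by rw [hr]; push_cast; linarith) hp1 (μ := μ) (ν := ν) (by simp [hμ, h.xi_mean e₀]) hγ0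
    (fun m hm => by
      simp only [hμ, if_neg (by omega : m ≠ 0)]
      rw [abs_mul, abs_of_pos hp0]
      gcongr
      exact hγ2 m hm)
  refine hcomp.trans ?_
  gcongr
  -- The coordinates of a product measure provide the dense matrix of size 2k whose walk sum appears
  -- after the comparison.
  set Q := Measure.pi fun _ : Sym2 (Fin r) => γ with hQ
  have hindY : iIndepFun (fun (e : Sym2 (Fin r)) (y : Sym2 (Fin r) → ℝ) => y e) Q :=
    iIndepFun_pi (X := fun _ x => x) fun _ => measurable_id.aemeasurable
  have hmp : ∀ e, MeasurePreserving (Function.eval e) Q γ := fun e =>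
    measurePreserving_eval (fun _ : Sym2 (Fin r) => γ) e
  have hsY : ∀ e, HasSubgaussianMGF (fun y : Sym2 (Fin r) → ℝ => y e) c Q := by
    intro e
    refine ⟨fun t => (hmp e).integrable_comp_of_integrable (hγs.integrable_exp_mul t), fun t => ?_⟩
    have : mgf (fun y : Sym2 (Fin r) → ℝ => y e) Q t = mgf id γ t := by
      rw [mgf, mgf, ← (hmp e).map_eq, integral_map (hmp e).measurable.aemeasurable (by fun_prop)]
      rfl
    rw [this]; exact hγs.mgf_le t
  have hγi : ∀ m : ℕ, Integrable (fun x => x ^ m) γ := by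
    intro m
    have h2 := (hγs.memLp (m : ℝ≥0)).integrable_norm_pow'
    refine h2.mono' (by fun_prop) (Filter.Eventually.of_forall fun x => ?_)
    simp
  have hY := trace_moment (K := K) hindY (fun e => measurable_pi_apply e)
    (fun e m => (hmp e).integrable_comp_of_integrable (hγi m)) (μ := ν)
    (fun e m => by
      change _ = ∫ x, x ^ m ∂γ
      rw [← (hmp e).map_eq, integral_map (hmp e).measurable.aemeasurable (by fun_prop)])
    (by simp [hν])
  obtain ⟨hY1, hY2⟩ := hY
  rw [← hY2]
  rw [hK] at hY1 ⊢
  exact SparseRandomMatrix.integral_trace_pow_le hk rfl hindY hsY hY1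

/-- The operator norm of a sparse symmetric random matrix. -/
theorem IsSparseModel.norm_le {B : ℝ} (hB : 0 < B) : ∃ K : ℝ, 0 < K ∧
    ∀ {Ω : Type*} [MeasurableSpace Ω] (P : Measure Ω) [IsProbabilityMeasure P]
      (n : ℕ) (p : ℝ) (δ ξ : Sym2 (Fin n) → Ω → ℝ), IsSparseModel P n p B δ ξ →
      0 < p → p ≤ 1 → 1 ≤ p * n → Real.log n ≤ p * n →
      P.real {ω | ¬ ∀ x, ‖Matrix.toEuclideanLin (sparseMatrix δ ξ ω) x‖ ≤
        K * Real.sqrt (p * n) * ‖x‖} ≤ Real.exp (-(p * n)) := by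
  obtain ⟨c, hc0, hc⟩ := IsSparseModel.integral_trace_pow_le hB
  refine ⟨Real.sqrt (2 * c * Real.exp 4), by positivity,
    fun {Ω} _ P _ n p δ ξ h hp0 hp1 hd hlog => ?_⟩
  set d := p * n with hd'
  have hn : 0 < n := by
    rcases Nat.eq_zero_or_pos n with h0 | h0
    · rw [hd', h0] at hd; norm_num at hd
    · exact h0
  have hn' : (0 : ℝ) < n := by exact_mod_cast hn
  -- A power of two between d and 2d, as `norm_pow_le_trace` requires.
  obtain ⟨j, hj1, hj2⟩ : ∃ j : ℕ, d ≤ (2 ^ j : ℕ) ∧ ((2 ^ j : ℕ) : ℝ) ≤ 2 * d := by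
    have hex : ∃ j : ℕ, d ≤ (2 ^ j : ℕ) := by
      obtain ⟨j, hj⟩ := pow_unbounded_of_one_lt d (one_lt_two)
      exact ⟨j, by push_cast; exact hj.le⟩
    classical
    refine ⟨Nat.find hex, Nat.find_spec hex, ?_⟩
    rcases Nat.eq_zero_or_pos (Nat.find hex) with h0 | h0
    · rw [h0]; push_cast; linarith
    · have := Nat.find_min hex (Nat.sub_lt h0 one_pos)
      push Not at this
      have e : Nat.find hex = (Nat.find hex - 1) + 1 := by omega
      rw [e, pow_succ]
      push_cast at this ⊢
      linarith
  set k := 2 ^ j with hk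
  have hk0 : 0 < k := by positivity
  have hk' : (1 : ℝ) ≤ k := by exact_mod_cast hk0
  obtain ⟨hI, hT⟩ := hc P n p δ ξ h hn hp0 hp1 k hk0 (by rw [mul_comm]; exact hj1)
  -- Since k ≤ 2d, the threshold exceeds (ck)^k by a factor exp(4k). This pays for 4k ≤ exp(2k) and
  -- 1/p ≤ n ≤ exp(d), and leaves exp(d - 2k) ≤ exp(-d).
  set L := (2 * c * Real.exp 4 * d) ^ k with hL
  have hL0 : 0 < L := by positivity
  have hTnn : ∀ ω, 0 ≤ (sparseMatrix δ ξ ω ^ (2 * k)).trace := by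
    intro ω
    have := norm_pow_le_trace (isSelfAdjoint_symMatrix fun e => δ e ω * ξ e ω) j
    rw [← sparseMatrix_eq_symMatrix, pow_succ' 2 j, ← hk] at this
    exact (by positivity : (0 : ℝ) ≤ _).trans this
  have hsub : {ω | ¬ ∀ x, ‖Matrix.toEuclideanLin (sparseMatrix δ ξ ω) x‖ ≤
      Real.sqrt (2 * c * Real.exp 4) * Real.sqrt d * ‖x‖} ⊆
      {ω | L ≤ (sparseMatrix δ ξ ω ^ (2 * k)).trace} := by
    intro ω hω
    by_contra hcon
    refine hω fun x => ?_
    have h1 : ‖sparseMatrix δ ξ ω‖ ≤ Real.sqrt (2 * c * Real.exp 4) * Real.sqrt d := by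
      have h2 := norm_pow_le_trace (isSelfAdjoint_symMatrix fun e => δ e ω * ξ e ω) j
      rw [← sparseMatrix_eq_symMatrix, pow_succ' 2 j, ← hk] at h2
      have h3 : ‖sparseMatrix δ ξ ω‖ ^ (2 * k) ≤ L := h2.trans (not_le.1 hcon).le
      refine le_of_pow_le_pow_left₀ (n := 2 * k) (by omega) (by positivity) (h3.trans (le_of_eq ?_))
      rw [hL, pow_mul]
      congr 1
      rw [mul_pow, Real.sq_sqrt (by positivity), Real.sq_sqrt (by linarith)]
    have h4 := (Matrix.toEuclideanCLM (n := Fin n) (𝕜 := ℝ) (sparseMatrix δ ξ ω)).le_opNorm x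
    rw [← Matrix.cstar_norm_def] at h4
    exact h4.trans (by gcongr)
  refine (measureReal_mono hsub).trans ?_
  have hmk := mul_meas_ge_le_integral_of_nonneg (Filter.Eventually.of_forall hTnn) hI L
  have hnd : (1 : ℝ) / p ≤ n := by rw [div_le_iff₀ hp0]; linarith
  have hnexp : (n : ℝ) ≤ Real.exp d := by
    rw [← Real.exp_log hn']; exact Real.exp_le_exp.2 hlog
  have h4k : 4 * (k : ℝ) ≤ Real.exp (2 * k) := by
    have := Real.quadratic_le_exp_of_nonneg (x := 2 * (k : ℝ)) (by positivity)
    nlinarith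
  have hfrac : (c * k : ℝ) ^ k ≤ Real.exp (-4 * k) * L := by
    have e : Real.exp (-4 * k) = Real.exp (-4) ^ k := by
      rw [← Real.exp_nat_mul]; congr 1; ring
    rw [e, hL, ← mul_pow]
    refine pow_le_pow_left₀ (by positivity) ?_ k
    have e2 : Real.exp (-4) * (2 * c * Real.exp 4 * d) = c * (2 * d) := by
      have : Real.exp (-4) * Real.exp 4 = 1 := by rw [← Real.exp_add]; norm_num
      linear_combination (2 * c * d) * this
    rw [e2]; gcongr
  have hfinal : L * P.real {ω | L ≤ (sparseMatrix δ ξ ω ^ (2 * k)).trace} ≤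
      L * Real.exp (-d) := by
    calc _ ≤ 1 / p * (4 * k * (c * k) ^ k) := hmk.trans hT
      _ ≤ Real.exp d * (Real.exp (2 * k) * (Real.exp (-4 * k) * L)) := by
          gcongr
          exact hnd.trans hnexp
      _ = L * Real.exp (d + (2 * k + -4 * k)) := by rw [Real.exp_add, Real.exp_add]; ring
      _ ≤ L * Real.exp (-d) := by
          gcongr; linarith
  exact le_of_mul_le_mul_left hfinal hL0

end NormBound
end SparseRandomMatrix

namespace SparseRandomMatrix

theorem measureReal_inter_of_indepFun {Ω β γ : Type*} [MeasurableSpace Ω] {P : Measure Ω}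
    [MeasurableSpace β] [MeasurableSpace γ] {X : Ω → β} {Y : Ω → γ} (h : IndepFun X Y P)
    {s : Set β} {t : Set γ} (hs : MeasurableSet s) (ht : MeasurableSet t) :
    P.real (X ⁻¹' s ∩ Y ⁻¹' t) = P.real (X ⁻¹' s) * P.real (Y ⁻¹' t) := by
  simp only [measureReal_def, h.measure_inter_preimage_eq_mul s t hs ht, ENNReal.toReal_mul]

/-! ### Chernoff bounds for counts of independent events. -/

section Chernoff

variable {Ω : Type*} [MeasurableSpace Ω] {P : Measure Ω}

open Classical in
theorem integral_pow_card {ι γ : Type*} [Fintype ι] [MeasurableSpace γ] [IsProbabilityMeasure P]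
    {X : ι → Ω → γ} (h : iIndepFun X P) (hX : ∀ i, Measurable (X i)) {T : ι → Set γ}
    (hT : ∀ i, MeasurableSet (T i)) {r : ℝ} :
    Integrable (fun ω => r ^ (Finset.univ.filter fun i => X i ω ∈ T i).card) P ∧
    ∫ ω, r ^ (Finset.univ.filter fun i => X i ω ∈ T i).card ∂P =
      ∏ i, (1 + (r - 1) * P.real (X i ⁻¹' T i)) := by
  set f : ι → γ → ℝ := fun i x => (T i).indicator (fun _ => r) x + (T i)ᶜ.indicator (fun _ => 1) x
  have hf : ∀ i, Measurable (f i) := fun i =>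
    (measurable_const.indicator (hT i)).add (measurable_const.indicator (hT i).compl)
  have hpt : ∀ ω, r ^ (Finset.univ.filter fun i => X i ω ∈ T i).card = ∏ i, f i (X i ω) := by
    intro ω
    rw [← Finset.prod_const, Finset.prod_filter]
    refine Finset.prod_congr rfl fun i _ => ?_
    by_cases hi : X i ω ∈ T i <;> simp [f, hi]
  have hfe : ∀ i, (fun ω => f i (X i ω)) = fun ω => (X i ⁻¹' T i).indicator (fun _ => r - 1) ω + 1 := by
    intro i
    funext ω
    by_cases hi : X i ω ∈ T i <;> simp [f, Set.indicator, hi]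
  have hint : ∀ i, Integrable ((X i ⁻¹' T i).indicator fun _ => r - 1) P := fun i =>
    (integrable_const _).indicator (hX i (hT i))
  simp_rw [hpt]
  constructor
  · refine integrable_prod_of_iIndepFun h hX hf fun i => ?_
    rw [hfe i]
    exact (hint i).add (integrable_const _)
  · rw [h.integral_fun_prod_comp (fun i => (hX i).aemeasurable)
      (fun i => (hf i).aestronglyMeasurable)]
    refine Finset.prod_congr rfl fun i _ => ?_
    rw [hfe i, integral_add (hint i) (integrable_const _),
      integral_indicator_const _ (hX i (hT i))]
    simp only [integral_const, probReal_univ, smul_eq_mul]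
    ring

open Classical in
/-- Chernoff's bound for the lower tail of a sum of independent indicators. -/
theorem chernoff_lower {ι γ : Type*} [Fintype ι] [MeasurableSpace γ] [IsProbabilityMeasure P]
    {X : ι → Ω → γ} (h : iIndepFun X P) (hX : ∀ i, Measurable (X i)) {T : ι → Set γ}
    (hT : ∀ i, MeasurableSet (T i)) {q : ℝ} (hq : ∀ i, q ≤ P.real (X i ⁻¹' T i)) (m : ℝ) :
    P.real {ω | ((Finset.univ.filter fun i => X i ω ∈ T i).card : ℝ) ≤ m} ≤
      Real.exp (m - Fintype.card ι * q / 2) := by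
  -- The value exp(-1) ≤ 1/2 turns each factor into 1 - q/2 at most.
  set r := Real.exp (-1) with hr
  have hr2 : r ≤ 1 / 2 := by
    have h1 : Real.exp (-1) * Real.exp 1 = 1 := by rw [← Real.exp_add]; simp
    have h2 := Real.add_one_le_exp (1 : ℝ)
    have h3 := Real.exp_pos (-1)
    rw [hr]; nlinarith
  obtain ⟨hI, hE⟩ := integral_pow_card h hX hT (r := r)
  have hbound : ∫ ω, r ^ (Finset.univ.filter fun i => X i ω ∈ T i).card ∂P ≤
      Real.exp (-(Fintype.card ι * q / 2)) := by
    rw [hE]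
    calc ∏ i, (1 + (r - 1) * P.real (X i ⁻¹' T i)) ≤ ∏ _i : ι, Real.exp (-(q / 2)) := by
          refine Finset.prod_le_prod (fun i _ => ?_) fun i _ => ?_
          · have h1 : P.real (X i ⁻¹' T i) ≤ 1 := measureReal_le_one
            have h2 : 0 ≤ P.real (X i ⁻¹' T i) := measureReal_nonneg
            have : 0 < r := Real.exp_pos _
            nlinarith
          · have h2 : 0 ≤ P.real (X i ⁻¹' T i) := measureReal_nonneg
            have := Real.add_one_le_exp (-(q / 2))
            have := hq i
            nlinarith
      _ = _ := by
          rw [Finset.prod_const, Finset.card_univ, ← Real.exp_nat_mul]; congr 1; ring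
  have hsub : {ω | ((Finset.univ.filter fun i => X i ω ∈ T i).card : ℝ) ≤ m} ⊆
      {ω | Real.exp (-m) ≤ r ^ (Finset.univ.filter fun i => X i ω ∈ T i).card} := by
    intro ω hω
    simp only [Set.mem_ofPred_eq] at hω ⊢
    rw [hr, ← Real.exp_nat_mul]
    exact Real.exp_le_exp.2 (by linarith)
  have hmk := mul_meas_ge_le_integral_of_nonneg
    (Filter.Eventually.of_forall fun ω => pow_nonneg (Real.exp_pos (-1)).le _) hI (Real.exp (-m))
  have h4 := (mul_le_mul_of_nonneg_left (measureReal_mono (μ := P) hsub) (Real.exp_pos (-m)).le).trans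
    (hmk.trans hbound)
  have h5 : Real.exp (-(Fintype.card ι * q / 2)) =
      Real.exp (-m) * Real.exp (m - Fintype.card ι * q / 2) := by
    rw [← Real.exp_add]; congr 1; ring
  rw [h5] at h4
  exact le_of_mul_le_mul_left h4 (Real.exp_pos _)

open Classical in
/-- Chernoff's bound for the upper tail of a sum of independent indicators. -/
theorem chernoff_upper {ι γ : Type*} [Fintype ι] [MeasurableSpace γ] [IsProbabilityMeasure P]
    {X : ι → Ω → γ} (h : iIndepFun X P) (hX : ∀ i, Measurable (X i)) {T : ι → Set γ}
    (hT : ∀ i, MeasurableSet (T i)) {q : ℝ} (hq : ∀ i, P.real (X i ⁻¹' T i) ≤ q) {r : ℝ}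
    (hr : 1 ≤ r) (m : ℝ) :
    P.real {ω | m ≤ ((Finset.univ.filter fun i => X i ω ∈ T i).card : ℝ)} ≤
      Real.exp (Fintype.card ι * (r * q) - m * Real.log r) := by
  have hr0 : 0 < r := by linarith
  obtain ⟨hI, hE⟩ := integral_pow_card h hX hT (r := r)
  have hbound : ∫ ω, r ^ (Finset.univ.filter fun i => X i ω ∈ T i).card ∂P ≤
      Real.exp (Fintype.card ι * (r * q)) := by
    rw [hE]
    calc ∏ i, (1 + (r - 1) * P.real (X i ⁻¹' T i)) ≤ ∏ _i : ι, Real.exp (r * q) := by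
          refine Finset.prod_le_prod (fun i _ => ?_) fun i _ => ?_
          · have h2 : 0 ≤ P.real (X i ⁻¹' T i) := measureReal_nonneg
            have : 0 ≤ r - 1 := by linarith
            positivity
          · have h2 : 0 ≤ P.real (X i ⁻¹' T i) := measureReal_nonneg
            have := Real.add_one_le_exp (r * q)
            have := hq i
            nlinarith
      _ = _ := by
          rw [Finset.prod_const, Finset.card_univ, ← Real.exp_nat_mul]
  have hsub : {ω | m ≤ ((Finset.univ.filter fun i => X i ω ∈ T i).card : ℝ)} ⊆
      {ω | Real.exp (m * Real.log r) ≤ r ^ (Finset.univ.filter fun i => X i ω ∈ T i).card} := by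
    intro ω hω
    simp only [Set.mem_ofPred_eq] at hω ⊢
    rw [← Real.rpow_natCast, Real.rpow_def_of_pos hr0]
    refine Real.exp_le_exp.2 ?_
    rw [mul_comm (Real.log r)]
    exact mul_le_mul_of_nonneg_right hω (Real.log_nonneg hr)
  have hmk := mul_meas_ge_le_integral_of_nonneg
    (Filter.Eventually.of_forall fun ω => pow_nonneg hr0.le _) hI (Real.exp (m * Real.log r))
  have h4 := (mul_le_mul_of_nonneg_left (measureReal_mono (μ := P) hsub)
    (Real.exp_pos (m * Real.log r)).le).trans (hmk.trans hbound)
  have h5 : Real.exp (Fintype.card ι * (r * q)) =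
      Real.exp (m * Real.log r) * Real.exp (Fintype.card ι * (r * q) - m * Real.log r) := by
    rw [← Real.exp_add]; congr 1; ring
  rw [h5] at h4
  exact le_of_mul_le_mul_left h4 (Real.exp_pos _)

end Chernoff

/-! ### Independent partial rows and rows with a single active entry. -/

section Rows

variable {Ω : Type*} [MeasurableSpace Ω] {P : Measure Ω} {n : ℕ}

/-- The parts of the rows with index outside `U` in the columns of `U` are independent. -/
theorem iIndepFun_rows {β : Type*} [MeasurableSpace β] {Y : Sym2 (Fin n) → Ω → β}
    (h : iIndepFun Y P) (hY : ∀ e, Measurable (Y e)) (U : Finset (Fin n)) :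
    iIndepFun (fun (i : {i // i ∉ U}) ω (j : U) => Y s(i, j) ω) P := by
  classical
  have hb := iIndepFun_blocks h hY (S := fun i : {i // i ∉ U} => U.image fun j => s(i.1, j)) (by
    intro i i' hii
    rw [Finset.disjoint_left]
    intro e he he'
    obtain ⟨j, hj, rfl⟩ := Finset.mem_image.1 he
    obtain ⟨j', hj', hjj⟩ := Finset.mem_image.1 he'
    -- A pair with one end in U and the other outside determines which end is the row, so the
    -- symmetry creates no shared entries.
    rcases Sym2.eq_iff.1 hjj with ⟨h1, -⟩ | ⟨h1, -⟩
    · exact hii (Subtype.ext h1.symm)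
    · exact i'.2 (h1 ▸ hj))
  exact hb.comp (fun i x (j : U) => x ⟨s(i.1, j), Finset.mem_image_of_mem _ j.2⟩)
    (fun i => measurable_pi_lambda _ fun j => measurable_pi_apply _)

theorem iIndepFun_row {β : Type*} [MeasurableSpace β] {Y : Sym2 (Fin n) → Ω → β}
    (h : iIndepFun Y P) (i : Fin n) (U : Finset (Fin n)) :
    iIndepFun (fun (j : U) => Y s(i, j)) P :=
  h.precomp (g := fun j : U => s(i, j.1)) fun j j' hjj => Subtype.ext (by
    rcases Sym2.eq_iff.1 hjj with h | h
    · exact h.2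
    · exact h.2.trans h.1)

/-- Exactly one of the entries is active, and its weight is at least `1 / 2`. -/
def OneGood (ι : Type*) : Set (ι → ℝ × ℝ) :=
  {x | ∃ j, ((x j).1 = 1 ∧ 1 / 2 ≤ |(x j).2|) ∧ ∀ j', j' ≠ j → (x j').1 ≠ 1}

theorem measurableSet_oneGood (ι : Type*) [Countable ι] : MeasurableSet (OneGood ι) := by
  have : OneGood ι = ⋃ j, (({x : ι → ℝ × ℝ | (x j).1 = 1} ∩ {x | 1 / 2 ≤ |(x j).2|}) ∩
      ⋂ j', ⋂ _ : j' ≠ j, {x | (x j').1 = 1}ᶜ) := by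
    ext x; simp [OneGood]
  rw [this]
  have hm : ∀ j : ι, MeasurableSet {x : ι → ℝ × ℝ | (x j).1 = 1} := fun j =>
    (measurable_fst.comp (measurable_pi_apply j)) (measurableSet_singleton 1)
  refine MeasurableSet.iUnion fun j => ((hm j).inter ?_).inter
    (MeasurableSet.iInter fun j' => MeasurableSet.iInter fun _ => (hm j').compl)
  exact measurableSet_le measurable_const
    ((measurable_snd.comp (measurable_pi_apply j)).abs)

/-- The events "j is the only active index" are disjoint. As the expected number of active entries
is at most 1/2, each retains at least half of the probability that j is active with large weight. -/
theorem le_measureReal_oneGood [IsProbabilityMeasure P] {ι : Type*} [Fintype ι]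
    {Z : ι → Ω → ℝ × ℝ} (h : iIndepFun Z P) (hZ : ∀ j, Measurable (Z j)) {p q : ℝ}
    (hp0 : 0 ≤ p)
    (hp : ∀ j, P.real {ω | (Z j ω).1 = 1} = p)
    (hq : ∀ j, p * q ≤ P.real {ω | (Z j ω).1 = 1 ∧ 1 / 2 ≤ |(Z j ω).2|})
    (hι : Fintype.card ι * p ≤ 1 / 2) :
    Fintype.card ι * (p * q / 2) ≤ P.real ((fun ω j => Z j ω) ⁻¹' OneGood ι) := by
  classical
  set D : ι → Set Ω := fun j => {ω | (Z j ω).1 = 1} with hD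
  set E : ι → Set Ω := fun j => {ω | (Z j ω).1 = 1 ∧ 1 / 2 ≤ |(Z j ω).2|} with hE
  set G : ι → Set Ω := fun j => E j \ ⋃ j' ∈ Finset.univ.erase j, D j' with hG
  have hm1 : MeasurableSet {x : ℝ × ℝ | x.1 = 1} := measurable_fst (measurableSet_singleton 1)
  have hm2 : MeasurableSet {x : ℝ × ℝ | x.1 = 1 ∧ 1 / 2 ≤ |x.2|} :=
    hm1.inter (measurableSet_le measurable_const measurable_snd.abs)
  have hDm : ∀ j, MeasurableSet (D j) := fun j => hZ j hm1
  have hEm : ∀ j, MeasurableSet (E j) := fun j => hZ j hm2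
  have hUm : ∀ j, MeasurableSet (⋃ j' ∈ Finset.univ.erase j, D j') := fun j =>
    Finset.measurableSet_biUnion _ fun j' _ => hDm j'
  have hGm : ∀ j, MeasurableSet (G j) := fun j => (hEm j).diff (hUm j)
  have hGE : (fun ω j => Z j ω) ⁻¹' OneGood ι = ⋃ j, G j := by
    ext ω; simp [OneGood, hG, hD, hE]
  have hdisj : Pairwise (Function.onFun Disjoint G) := by
    intro j j' hjj
    rw [Function.onFun, Set.disjoint_left]
    rintro ω ⟨h1, -⟩ ⟨-, h2⟩
    refine h2 (Set.mem_iUnion₂.2 ⟨j, by simp [hjj], ?_⟩)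
    exact h1.1
  rw [hGE, measureReal_iUnion_fintype hdisj hGm]
  have hGj : ∀ j, p * q / 2 ≤ P.real (G j) := by
    intro j
    have h1 : P.real (E j) ≤ P.real (G j) + P.real (⋃ j' ∈ Finset.univ.erase j, E j ∩ D j') := by
      refine (measureReal_mono ?_).trans (measureReal_union_le _ _)
      intro ω hω
      by_cases hU : ω ∈ ⋃ j' ∈ Finset.univ.erase j, D j'
      · right
        obtain ⟨j', hj', hD'⟩ := Set.mem_iUnion₂.1 hU
        exact Set.mem_iUnion₂.2 ⟨j', hj', hω, hD'⟩
      · left; exact ⟨hω, hU⟩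
    have h2 : P.real (⋃ j' ∈ Finset.univ.erase j, E j ∩ D j') ≤
        ∑ j' ∈ Finset.univ.erase j, P.real (E j) * p := by
      refine (measureReal_biUnion_finset_le _ _).trans (Finset.sum_le_sum fun j' hj' => ?_)
      have hne : j ≠ j' := (Finset.ne_of_mem_erase hj').symm
      have := measureReal_inter_of_indepFun (h.indepFun hne) hm2 hm1
      refine le_of_eq ?_
      rw [← hp j']
      exact this
    rw [Finset.sum_const, nsmul_eq_mul] at h2
    have h3 : (((Finset.univ.erase j).card : ℕ) : ℝ) ≤ Fintype.card ι := by
      exact_mod_cast Finset.card_le_univ _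
    have h4 := hq j
    have h5 : 0 ≤ P.real (E j) := measureReal_nonneg
    have h6 : ((Finset.univ.erase j).card : ℝ) * (P.real (E j) * p) ≤ 1 / 2 * P.real (E j) := by
      calc ((Finset.univ.erase j).card : ℝ) * (P.real (E j) * p)
          ≤ Fintype.card ι * (P.real (E j) * p) := by gcongr
        _ = (Fintype.card ι * p) * P.real (E j) := by ring
        _ ≤ _ := by gcongr
    linarith
  calc (Fintype.card ι : ℝ) * (p * q / 2) = ∑ _j : ι, p * q / 2 := by simp
    _ ≤ _ := Finset.sum_le_sum fun j _ => hGj j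

variable {p B : ℝ} {δ ξ : Sym2 (Fin n) → Ω → ℝ}

theorem IsSparseModel.integral_xi_sq_sq_le [IsProbabilityMeasure P]
    (h : IsSparseModel P n p B δ ξ) (hB : 0 < B) (e : Sym2 (Fin n)) :
    ∫ ω, (ξ e ω ^ 2) ^ 2 ∂P ≤ 24 * B ^ 4 := by
  have hs := h.xi_subgaussian e
  have hm := h.measurable_xi e
  calc ∫ ω, (ξ e ω ^ 2) ^ 2 ∂P ≤ ∫ ω, 8 * B ^ 4 * Real.exp (ξ e ω ^ 2 / (2 * B ^ 2)) ∂P := by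
        refine integral_mono_of_nonneg (Filter.Eventually.of_forall fun ω => by positivity)
          ((hs.integrable_exp_sq hB hm).const_mul _) (Filter.Eventually.of_forall fun ω => ?_)
        simp only
        set y := ξ e ω ^ 2 / (2 * B ^ 2) with hy
        have hy0 : 0 ≤ y := by positivity
        have e1 : ξ e ω ^ 2 = 2 * B ^ 2 * y := by rw [hy]; field_simp
        have := Real.quadratic_le_exp_of_nonneg hy0
        rw [e1]
        have h1 : y ^ 2 ≤ 2 * Real.exp y := by linarith
        calc (2 * B ^ 2 * y) ^ 2 = 4 * B ^ 4 * y ^ 2 := by ring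
          _ ≤ 4 * B ^ 4 * (2 * Real.exp y) := by gcongr
          _ = _ := by ring
    _ ≤ 8 * B ^ 4 * 3 := by
        rw [integral_const_mul]
        have := hs.integral_exp_sq_le hB hm
        gcongr
    _ = _ := by ring

/-- Paley–Zygmund for ξ², whose mean is 1 and whose second moment is at most 24B⁴. -/
theorem IsSparseModel.le_measureReal_xi [IsProbabilityMeasure P] (h : IsSparseModel P n p B δ ξ)
    (hB : 0 < B) (e : Sym2 (Fin n)) : 1 / (96 * B ^ 4) ≤ P.real {ω | 1 / 2 ≤ |ξ e ω|} := by
  have hs := h.xi_subgaussian e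
  have hm := h.measurable_xi e
  have h4 := h.integral_xi_sq_sq_le hB e
  have hpz := paleyZygmund (P := P) (Z := fun ω => ξ e ω ^ 2) (by fun_prop) (fun ω => sq_nonneg _)
    (by simp_rw [← pow_mul]; exact hs.integrable_pow hB hm 4) (m := 1) zero_le_one
    (integral_sq_eq_one hm (h.xi_mean e) (h.xi_variance e)).ge h4 (by positivity)
  refine le_trans (le_of_eq (by ring)) (hpz.trans (measureReal_mono ?_))
  intro ω hω
  simp only [Set.mem_ofPred_eq] at hω ⊢
  by_contra hcon
  push Not at hcon
  have : ξ e ω ^ 2 < (1 / 2) ^ 2 := by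
    rw [← sq_abs]; exact pow_lt_pow_left₀ hcon (abs_nonneg _) two_ne_zero
  linarith

theorem IsSparseModel.le_measureReal_good [IsProbabilityMeasure P] (h : IsSparseModel P n p B δ ξ)
    (hB : 0 < B) (hp0 : 0 ≤ p) (e : Sym2 (Fin n)) :
    p * (1 / (96 * B ^ 4)) ≤ P.real {ω | δ e ω = 1 ∧ 1 / 2 ≤ |ξ e ω|} := by
  have := measureReal_inter_of_indepFun (h.indepFun_delta_xi e) (s := {1})
    (t := {x | 1 / 2 ≤ |x|}) (measurableSet_singleton 1)
    (measurableSet_le measurable_const measurable_id.abs)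
  have e1 : P.real (δ e ⁻¹' {1}) = p := h.delta_prob e
  calc p * (1 / (96 * B ^ 4)) ≤ p * P.real {ω | 1 / 2 ≤ |ξ e ω|} := by
        gcongr; exact h.le_measureReal_xi hB e
    _ = P.real (δ e ⁻¹' {1} ∩ ξ e ⁻¹' {x | 1 / 2 ≤ |x|}) := by rw [this, e1]; rfl
    _ = _ := rfl

end Rows
end SparseRandomMatrix

namespace SparseRandomMatrix

/-! ### The structural property: many rows with a unique nonzero entry. -/

section Structure

open Classical in
/-- There are at least `m` rows outside `T` in which exactly one entry with column in `T` is
nonzero; the column of this entry belongs to `J` and the entry is at least `1 / 2`. -/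
def HasUniqueRows {n : ℕ} (A : Matrix (Fin n) (Fin n) ℝ) (T J : Finset (Fin n)) (m : ℝ) : Prop :=
  m ≤ (Finset.univ.filter fun i => i ∉ T ∧ ∃ j ∈ J, 1 / 2 ≤ |A i j| ∧
    ∀ j' ∈ T, j' ≠ j → A i j' = 0).card

variable {Ω : Type*} [MeasurableSpace Ω] {P : Measure Ω} {n : ℕ} {p B : ℝ}
  {δ ξ : Sym2 (Fin n) → Ω → ℝ}

/-- Two entries are active, one with index in `J` and one with index outside `J`. -/
def HitSet {n : ℕ} (T J : Finset (Fin n)) : Set (T → ℝ × ℝ) :=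
  {x | ∃ j j' : T, j.1 ∈ J ∧ j'.1 ∉ J ∧ (x j).1 = 1 ∧ (x j').1 = 1}

theorem measurableSet_hitSet (T J : Finset (Fin n)) : MeasurableSet (HitSet T J) := by
  have : HitSet T J = ⋃ j : T, ⋃ j' : T, ⋃ _ : j.1 ∈ J, ⋃ _ : j'.1 ∉ J,
      ({x : T → ℝ × ℝ | (x j).1 = 1} ∩ {x | (x j').1 = 1}) := by
    ext x
    simp only [HitSet, Set.mem_ofPred_eq, Set.mem_iUnion, Set.mem_inter_iff, exists_prop]
  rw [this]
  have hm : ∀ j : T, MeasurableSet {x : T → ℝ × ℝ | (x j).1 = 1} := fun j =>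
    (measurable_fst.comp (measurable_pi_apply j)) (measurableSet_singleton 1)
  exact MeasurableSet.iUnion fun j => MeasurableSet.iUnion fun j' => MeasurableSet.iUnion fun _ =>
    MeasurableSet.iUnion fun _ => (hm j).inter (hm j')

theorem measureReal_hitSet_le [IsProbabilityMeasure P] {T J : Finset (Fin n)}
    {Z : T → Ω → ℝ × ℝ} (h : iIndepFun Z P)
    (hp : ∀ j, P.real {ω | (Z j ω).1 = 1} = p) :
    P.real ((fun ω j => Z j ω) ⁻¹' HitSet T J) ≤ J.card * T.card * p ^ 2 := by
  classical
  set F : Finset (T × T) := Finset.univ.filter fun r => r.1.1 ∈ J ∧ r.2.1 ∉ J with hF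
  have hm1 : MeasurableSet {x : ℝ × ℝ | x.1 = 1} := measurable_fst (measurableSet_singleton 1)
  have hsub : (fun ω j => Z j ω) ⁻¹' HitSet T J ⊆
      ⋃ r ∈ F, (Z r.1 ⁻¹' {x | x.1 = 1} ∩ Z r.2 ⁻¹' {x | x.1 = 1}) := by
    rintro ω ⟨j, j', hj, hj', h1, h2⟩
    exact Set.mem_iUnion₂.2 ⟨(j, j'), by simp [hF, hj, hj'], h1, h2⟩
  have hcard : (F.card : ℝ) ≤ J.card * T.card := by
    have h1 : F ⊆ (Finset.univ.filter fun j : T => j.1 ∈ J) ×ˢ Finset.univ := by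
      intro r hr
      simp only [hF, Finset.mem_filter, Finset.mem_univ, true_and] at hr
      simp [hr.1]
    have h2 : (Finset.univ.filter fun j : T => j.1 ∈ J).card ≤ J.card :=
      Finset.card_le_card_of_injOn (fun j => j.1) (fun j hj => (Finset.mem_filter.1 hj).2)
        Subtype.val_injective.injOn
    have h3 := Finset.card_le_card h1
    rw [Finset.card_product, Finset.card_univ, Fintype.card_coe] at h3
    exact_mod_cast h3.trans (Nat.mul_le_mul_right _ h2)
  refine (measureReal_mono hsub (measure_ne_top _ _)).trans
    ((measureReal_biUnion_finset_le _ _).trans ?_)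
  calc ∑ r ∈ F, P.real (Z r.1 ⁻¹' {x | x.1 = 1} ∩ Z r.2 ⁻¹' {x | x.1 = 1})
      = ∑ r ∈ F, p ^ 2 := by
        refine Finset.sum_congr rfl fun r hr => ?_
        have hr' := (Finset.mem_filter.1 hr).2
        have hne : r.1 ≠ r.2 := fun he => hr'.2 (he ▸ hr'.1)
        rw [measureReal_inter_of_indepFun (h.indepFun hne) hm1 hm1, sq]
        exact congrArg₂ (· * ·) (hp _) (hp _)
    _ = F.card * p ^ 2 := by simp
    _ ≤ _ := by gcongr

open Classical in
theorem IsSparseModel.measureReal_oneGood_rows_le [IsProbabilityMeasure P]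
    (h : IsSparseModel P n p B δ ξ) (hp0 : 0 ≤ p) {q : ℝ} (hq0 : 0 ≤ q)
    (hq : ∀ e, p * q ≤ P.real {ω | δ e ω = 1 ∧ 1 / 2 ≤ |ξ e ω|}) (J : Finset (Fin n))
    (hJp : J.card * p ≤ 1 / 2) (hJn : (J.card : ℝ) ≤ n / 2) :
    P.real {ω | ((Finset.univ.filter fun i : {i // i ∉ J} =>
      (fun j : J => (δ s(i, j) ω, ξ s(i, j) ω)) ∈ OneGood J).card : ℝ) ≤
        J.card * (p * n) * q / 16} ≤ Real.exp (-(J.card * (p * n) * q / 16)) := by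
  have hrow := iIndepFun_rows h.iIndepFun_pair h.measurable_pair J
  have hJc : (Fintype.card J : ℝ) = J.card := by rw [Fintype.card_coe]
  have hlow : ∀ i : {i // i ∉ J}, (J.card : ℝ) * (p * q / 2) ≤
      P.real ((fun ω (j : J) => (δ s(i, j) ω, ξ s(i, j) ω)) ⁻¹' OneGood J) := by
    intro i
    have := le_measureReal_oneGood (iIndepFun_row h.iIndepFun_pair i J)
      (fun j => h.measurable_pair _) hp0 (fun j => h.delta_prob _) (fun j => hq _)
      (by rw [hJc]; exact hJp)
    rwa [hJc] at this
  have hch := chernoff_lower hrow (fun i => measurable_pi_lambda _ fun j => h.measurable_pair _)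
    (fun _ => measurableSet_oneGood J) hlow (J.card * (p * n) * q / 16)
  refine hch.trans (Real.exp_le_exp.2 ?_)
  have hcard : (n : ℝ) / 2 ≤ Fintype.card {i // i ∉ J} := by
    have h1 : Fintype.card {i // i ∉ J} = n - J.card := by
      rw [Fintype.card_subtype_compl, Fintype.card_fin, Fintype.card_coe]
    have h2 : J.card ≤ n := by simpa using Finset.card_le_univ J
    rw [h1, Nat.cast_sub h2]
    linarith
  have h3 : (n : ℝ) / 2 * (J.card * (p * q / 2)) / 2 ≤
      Fintype.card {i // i ∉ J} * (J.card * (p * q / 2)) / 2 := by gcongr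
  have h4 : (n : ℝ) / 2 * (J.card * (p * q / 2)) / 2 = J.card * (p * n) * q / 8 := by ring
  rw [h4] at h3
  linarith

-- The tilting parameter r = 1/(|T|p) brings the mean term to |J|pn while gaining m log(1/(|T|p)),
-- the factor that beats the number of choices of T.
open Classical in
theorem IsSparseModel.measureReal_hit_rows_le [IsProbabilityMeasure P]
    (h : IsSparseModel P n p B δ ξ) (hp0 : 0 < p) {T J : Finset (Fin n)}
    (hT : 0 < T.card) (hTp : T.card * p ≤ 1) (m : ℝ) :
    P.real {ω | m ≤ ((Finset.univ.filter fun i : {i // i ∉ T} =>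
      (fun j : T => (δ s(i, j) ω, ξ s(i, j) ω)) ∈ HitSet T J).card : ℝ)} ≤
        Real.exp (J.card * (p * n) - m * Real.log (1 / (T.card * p))) := by
  have hrow := iIndepFun_rows h.iIndepFun_pair h.measurable_pair T
  have hT' : (0 : ℝ) < T.card := by exact_mod_cast hT
  have hup : ∀ i : {i // i ∉ T},
      P.real ((fun ω (j : T) => (δ s(i, j) ω, ξ s(i, j) ω)) ⁻¹' HitSet T J) ≤
      (J.card : ℝ) * T.card * p ^ 2 := fun i =>
    measureReal_hitSet_le (iIndepFun_row h.iIndepFun_pair i T) fun j => h.delta_prob _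
  have hch := chernoff_upper hrow (fun i => measurable_pi_lambda _ fun j => h.measurable_pair _)
    (fun _ => measurableSet_hitSet T J) hup (r := 1 / (T.card * p))
    (by rw [le_div_iff₀ (by positivity)]; linarith) m
  refine hch.trans (Real.exp_le_exp.2 ?_)
  have hcard : (Fintype.card {i // i ∉ T} : ℝ) ≤ n := by
    have := Fintype.card_subtype_le (fun i : Fin n => i ∉ T)
    rw [Fintype.card_fin] at this
    exact_mod_cast this
  have h1 : 1 / ((T.card : ℝ) * p) * (J.card * T.card * p ^ 2) = J.card * p := by
    field_simp
  rw [h1]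
  have : (Fintype.card {i // i ∉ T} : ℝ) * (J.card * p) ≤ n * (J.card * p) := by gcongr
  linarith

-- Among the rows with a single active entry in J, it suffices to discard those with index in T and
-- those with a further active entry in T outside J.
open Classical in
theorem hasUniqueRows_of_counts {Ω : Type*} {n : ℕ} {δ ξ : Sym2 (Fin n) → Ω → ℝ} {ω : Ω} (h01 : ∀ e, δ e ω = 0 ∨ δ e ω = 1)
    {T J : Finset (Fin n)} (hJT : J ⊆ T) {m₁ m₂ : ℝ}
    (h1 : m₁ ≤ ((Finset.univ.filter fun i : {i // i ∉ J} =>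
      (fun j : J => (δ s(i, j) ω, ξ s(i, j) ω)) ∈ OneGood J).card : ℝ))
    (h2 : ((Finset.univ.filter fun i : {i // i ∉ T} =>
      (fun j : T => (δ s(i, j) ω, ξ s(i, j) ω)) ∈ HitSet T J).card : ℝ) ≤ m₂) :
    HasUniqueRows (sparseMatrix δ ξ ω) T J (m₁ - T.card - m₂) := by
  set N : Finset (Fin n) := (Finset.univ.filter fun i : {i // i ∉ J} =>
      (fun j : J => (δ s(i, j) ω, ξ s(i, j) ω)) ∈ OneGood J).image Subtype.val with hN
  set H : Finset (Fin n) := (Finset.univ.filter fun i : {i // i ∉ T} =>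
      (fun j : T => (δ s(i, j) ω, ξ s(i, j) ω)) ∈ HitSet T J).image Subtype.val with hH
  rw [← Finset.card_image_of_injective _ Subtype.val_injective, ← hN] at h1
  rw [← Finset.card_image_of_injective _ Subtype.val_injective, ← hH] at h2
  set G : Finset (Fin n) := Finset.univ.filter fun i => i ∉ T ∧ ∃ j ∈ J,
    1 / 2 ≤ |sparseMatrix δ ξ ω i j| ∧ ∀ j' ∈ T, j' ≠ j → sparseMatrix δ ξ ω i j' = 0 with hG
  have hsub : N ⊆ G ∪ (T ∪ H) := by
    intro i hi
    simp only [hN, Finset.mem_image, Finset.mem_filter, Finset.mem_univ, true_and] at hi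
    obtain ⟨⟨i', hi'⟩, hgood, rfl⟩ := hi
    by_cases hiT : i' ∈ T
    · simp [hiT]
    by_cases hiH : i' ∈ H
    · simp [hiH]
    refine Finset.mem_union_left _ (Finset.mem_filter.2 ⟨Finset.mem_univ _, hiT, ?_⟩)
    obtain ⟨j, ⟨hj1, hj2⟩, hj3⟩ := hgood
    refine ⟨j, j.2, ?_, ?_⟩
    · simp only at hj1 hj2
      simp only [sparseMatrix, Matrix.of_apply, hj1, one_mul]
      exact hj2
    · intro j' hj'T hne
      have hd : δ s(i', j') ω ≠ 1 := by
        intro hd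
        by_cases hj'J : j' ∈ J
        · exact hj3 ⟨j', hj'J⟩ (fun he => hne (congrArg Subtype.val he)) hd
        · refine hiH (Finset.mem_image.2 ⟨⟨i', hiT⟩, Finset.mem_filter.2 ⟨Finset.mem_univ _, ?_⟩, rfl⟩)
          exact ⟨⟨j, hJT j.2⟩, ⟨j', hj'T⟩, j.2, hj'J, hj1, hd⟩
      have hd0 := (h01 s(i', j')).resolve_right hd
      simp [sparseMatrix, hd0]
  have hc := (Finset.card_le_card hsub).trans
    ((Finset.card_union_le _ _).trans (Nat.add_le_add_left (Finset.card_union_le _ _) _))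
  have hc' : (N.card : ℝ) ≤ G.card + (T.card + H.card) := by exact_mod_cast hc
  change m₁ - T.card - m₂ ≤ (G.card : ℝ)
  linarith

theorem choose_le_exp {n k : ℕ} (hk : 0 < k) (hn : 0 < n) :
    (n.choose k : ℝ) ≤ Real.exp (k * (1 + Real.log (n / k))) := by
  have hk' : (0 : ℝ) < k := by exact_mod_cast hk
  have hn' : (0 : ℝ) < n := by exact_mod_cast hn
  have h1 : (n.choose k : ℝ) ≤ (n : ℝ) ^ k / k.factorial := Nat.choose_le_pow_div k n
  have h2 := Real.pow_div_factorial_le_exp (k : ℝ) hk'.le k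
  have h3 : Real.exp (k * (1 + Real.log (n / k))) = Real.exp k * ((n : ℝ) / k) ^ k := by
    rw [mul_add, mul_one, Real.exp_add, Real.exp_nat_mul, Real.exp_log (by positivity)]
  rw [h3]
  calc (n.choose k : ℝ) ≤ (n : ℝ) ^ k / k.factorial := h1
    _ = ((k : ℝ) ^ k / k.factorial) * ((n : ℝ) / k) ^ k := by rw [div_pow]; field_simp
    _ ≤ _ := by gcongr

/-- Here L stands for log(1/(lp)). The entropy of the pairs (T, J) is of order l(log d + L) with l ≤
2√d k, hence of order k√d L log d, against a tail exponent of order kdL; L ≥ 128/q also dominates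
the mean term kd. -/
theorem union_exponent_le {q d k l L : ℝ} (hq0 : 0 < q) (hq1 : q ≤ 1) (hd1 : 1 ≤ d)
    (hk : 1 ≤ k) (hlk : l ≤ 2 * Real.sqrt d * k)
    (hd : 8 * (3 + Real.log d) ≤ q / 64 * Real.sqrt d) (hL : 128 / q ≤ L) :
    l * (2 + Real.log d + L) + (k * d - q / 64 * (k * d) * L) ≤ -(d * q / 32) := by
  have hlogd : 0 ≤ Real.log d := Real.log_nonneg hd1
  have hqL : 128 ≤ q * L := by rw [div_le_iff₀ hq0] at hL; linarith
  have hL0 : 0 < L := lt_of_lt_of_le (by positivity) hL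
  have hL1 : 128 ≤ L := hqL.trans (mul_le_of_le_one_left hL0.le hq1)
  have h6 : Real.sqrt d * Real.sqrt d = d := Real.mul_self_sqrt (by linarith)
  have e1 : 2 + Real.log d + L ≤ (3 + Real.log d) * L := by
    have : Real.log d * 1 ≤ Real.log d * L := mul_le_mul_of_nonneg_left (by linarith) hlogd
    linarith
  have e2 : l * (2 + Real.log d + L) ≤ (k * d * (q * L)) / 256 := by
    calc l * (2 + Real.log d + L) ≤ (2 * Real.sqrt d * k) * ((3 + Real.log d) * L) := by gcongr
      _ = Real.sqrt d * k * L / 4 * (8 * (3 + Real.log d)) := by ring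
      _ ≤ Real.sqrt d * k * L / 4 * (q / 64 * Real.sqrt d) := by gcongr
      _ = (k * (Real.sqrt d * Real.sqrt d) * (q * L)) / 256 := by ring
      _ = _ := by rw [h6]
  have hkd : d ≤ k * d := le_mul_of_one_le_left (by linarith) hk
  have e3 : k * d * 128 ≤ k * d * (q * L) := mul_le_mul_of_nonneg_left hqL (by linarith)
  have e4 : d * q ≤ d := mul_le_of_le_one_right (by linarith) hq1
  have e5 : q / 64 * (k * d) * L = k * d * (q * L) / 64 := by ring
  rw [e5]
  linarith

theorem IsSparseModel.measureReal_not_hasUniqueRows_le [IsProbabilityMeasure P]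
    (h : IsSparseModel P n p B δ ξ) (hp0 : 0 < p) {q : ℝ} (hq0 : 0 < q) (hq1 : q ≤ 1)
    (hq : ∀ e, p * q ≤ P.real {ω | δ e ω = 1 ∧ 1 / 2 ≤ |ξ e ω|})
    (hlog : Real.log n ≤ p * n * q / 32) (hd1 : 1 ≤ p * n)
    (hd : 8 * (3 + Real.log (p * n)) ≤ q / 64 * Real.sqrt (p * n))
    (hd2 : 128 / q ≤ Real.sqrt (p * n)) {k l : ℕ} (hk : 0 < k) (hkl : k ≤ l)
    (hlk : (l : ℝ) ≤ 2 * Real.sqrt (p * n) * k) (ha : Real.exp (128 / q) ≤ 1 / (l * p)) :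
    P.real {ω | ∃ T J : Finset (Fin n), T.card = l ∧ J.card = k ∧ J ⊆ T ∧
      ¬ HasUniqueRows (sparseMatrix δ ξ ω) T J (q / 32 * (k * (p * n)))} ≤
      2 * Real.exp (-(p * n * q / 32)) := by
  classical
  set d := p * n with hd'
  set η := q / 64 with hη
  have hη0 : 0 < η := by positivity
  have hl : 0 < l := hk.trans_le hkl
  have hk' : (1 : ℝ) ≤ k := by exact_mod_cast hk
  have hl' : (0 : ℝ) < l := by exact_mod_cast hl
  have hkl' : (k : ℝ) ≤ l := by exact_mod_cast hkl
  have hn : 0 < n := by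
    rcases Nat.eq_zero_or_pos n with h0 | h0
    · rw [hd', h0] at hd1; norm_num at hd1
    · exact h0
  have hn' : (0 : ℝ) < n := by exact_mod_cast hn
  have hd0 : 0 < d := by linarith
  have hlp : 0 < (l : ℝ) * p := by positivity
  set a := 1 / ((l : ℝ) * p) with ha'
  have hq128 : 128 ≤ 128 / q := by rw [le_div_iff₀ hq0]; nlinarith
  have ha2 : 2 ≤ a := by
    have := Real.add_one_le_exp (128 / q)
    linarith
  have ha0 : 0 < a := by linarith
  have hla : 128 / q ≤ Real.log a := by
    rw [Real.le_log_iff_exp_le ha0]; exact ha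
  have hlp2 : (l : ℝ) * p ≤ 1 / 2 := by
    rw [ha', le_div_iff₀ hlp] at ha2
    linarith
  have hkp : (k : ℝ) * p ≤ 1 / 2 := by
    have : (k : ℝ) * p ≤ l * p := by gcongr
    linarith
  have hkn : (k : ℝ) ≤ n / 2 := by
    have h1 : (k : ℝ) * (p * n) ≤ 1 / 2 * n := by
      rw [← mul_assoc]; gcongr
    have h2 : (k : ℝ) * 1 ≤ k * (p * n) := by gcongr
    linarith
  set m₁ := (k : ℝ) * d * q / 16 with hm₁
  set m₂ := η * (k * d) with hm₂
  set N : Finset (Fin n) → Ω → ℕ := fun J ω => (Finset.univ.filter fun i : {i // i ∉ J} =>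
      (fun j : J => (δ s(i, j) ω, ξ s(i, j) ω)) ∈ OneGood J).card with hN
  set H : Finset (Fin n) → Finset (Fin n) → Ω → ℕ := fun T J ω =>
    (Finset.univ.filter fun i : {i // i ∉ T} =>
      (fun j : T => (δ s(i, j) ω, ξ s(i, j) ω)) ∈ HitSet T J).card with hH
  set Jset := Finset.powersetCard k (Finset.univ : Finset (Fin n)) with hJset
  set Pset := (Finset.powersetCard l (Finset.univ : Finset (Fin n))).sigma fun T => T.powerset
    with hPset
  -- The lower-tail event depends on J alone, so its union bound costs only `n.choose k`; only the
  -- much rarer collision event is summed over pairs (T, J).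
  have hsub : {ω | ∃ T J : Finset (Fin n), T.card = l ∧ J.card = k ∧ J ⊆ T ∧
      ¬ HasUniqueRows (sparseMatrix δ ξ ω) T J (q / 32 * (k * d))} ⊆
      {ω | ¬ ∀ e, δ e ω = 0 ∨ δ e ω = 1} ∪
      ((⋃ J ∈ Jset, {ω | (N J ω : ℝ) ≤ m₁}) ∪
        ⋃ r ∈ Pset.filter (fun r => r.2.card = k), {ω | m₂ ≤ (H r.1 r.2 ω : ℝ)}) := by
    rintro ω ⟨T, J, hT, hJ, hJT, hnot⟩
    by_contra hcon
    simp only [Set.mem_union, not_or, Set.mem_iUnion, not_exists, Set.mem_ofPred_eq, not_not,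
      not_le] at hcon
    obtain ⟨h01, hc1, hc2⟩ := hcon
    have h1 := hc1 J (Finset.mem_powersetCard.2 ⟨Finset.subset_univ _, hJ⟩)
    have h2 := hc2 ⟨T, J⟩ (Finset.mem_filter.2 ⟨Finset.mem_sigma.2
      ⟨Finset.mem_powersetCard.2 ⟨Finset.subset_univ _, hT⟩, Finset.mem_powerset.2 hJT⟩, hJ⟩)
    have h3 := hasUniqueRows_of_counts h01 hJT h1.le h2.le
    refine hnot (le_trans ?_ h3)
    rw [hT]
    -- The rows with index in T are negligible because l ≤ 2√d k is much smaller than kd.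
    have h4 : (l : ℝ) ≤ η * (k * d) := by
      refine hlk.trans ?_
      have h5 : 2 ≤ η * Real.sqrt d := by
        rw [div_le_iff₀ hq0] at hd2
        rw [hη]; linarith
      have h6 : Real.sqrt d * Real.sqrt d = d := Real.mul_self_sqrt hd0.le
      calc 2 * Real.sqrt d * k ≤ (η * Real.sqrt d) * Real.sqrt d * k := by gcongr
        _ = η * (k * (Real.sqrt d * Real.sqrt d)) := by ring
        _ = _ := by rw [h6]
    have h5 : m₁ - η * (k * d) - m₂ = q / 32 * (k * d) := by
      rw [hm₁, hm₂, hη]; ring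
    linarith
  have hnull : P.real {ω | ¬ ∀ e, δ e ω = 0 ∨ δ e ω = 1} = 0 := by
    rw [measureReal_def]
    have : ∀ᵐ ω ∂P, ∀ e, δ e ω = 0 ∨ δ e ω = 1 := ae_all_iff.2 h.delta_zero_or_one
    rw [ae_iff.1 this]; rfl
  have hpart1 : P.real (⋃ J ∈ Jset, {ω | (N J ω : ℝ) ≤ m₁}) ≤ Real.exp (-(d * q / 32)) := by
    refine (measureReal_biUnion_finset_le _ _).trans ?_
    calc ∑ J ∈ Jset, P.real {ω | (N J ω : ℝ) ≤ m₁} ≤ ∑ J ∈ Jset, Real.exp (-m₁) := by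
          refine Finset.sum_le_sum fun J hJ => ?_
          have hJk : J.card = k := (Finset.mem_powersetCard.1 hJ).2
          have := h.measureReal_oneGood_rows_le hp0.le hq0.le hq J (by rw [hJk]; exact hkp)
            (by rw [hJk]; exact hkn)
          rw [hJk] at this
          exact this
      _ = n.choose k * Real.exp (-m₁) := by
          rw [Finset.sum_const, hJset, Finset.card_powersetCard, Finset.card_univ,
            Fintype.card_fin, nsmul_eq_mul]
      _ ≤ Real.exp (k * (d * q / 32)) * Real.exp (-m₁) := by
          gcongr
          calc (n.choose k : ℝ) ≤ (n : ℝ) ^ k := by exact_mod_cast Nat.choose_le_pow n k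
            _ = Real.exp (k * Real.log n) := by rw [Real.exp_nat_mul, Real.exp_log hn']
            _ ≤ _ := Real.exp_le_exp.2 (by gcongr)
      _ ≤ Real.exp (-(d * q / 32)) := by
          rw [← Real.exp_add]
          refine Real.exp_le_exp.2 ?_
          have : 1 * (d * q / 32) ≤ k * (d * q / 32) := by gcongr
          rw [hm₁]; linarith
  have hpart2 : P.real (⋃ r ∈ Pset.filter (fun r => r.2.card = k), {ω | m₂ ≤ (H r.1 r.2 ω : ℝ)}) ≤
      Real.exp (-(d * q / 32)) := by
    refine (measureReal_biUnion_finset_le _ _).trans ?_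
    -- At most C(n, l)·2^l pairs, and n/l = d·a with a = 1/(lp), so the entropy is expressed through
    -- log d and log a.
    have hcard : ((Pset.filter fun r => r.2.card = k).card : ℝ) ≤
        Real.exp (l * (2 + Real.log d + Real.log a)) := by
      have h1 : Pset.card = n.choose l * 2 ^ l := by
        rw [hPset, Finset.card_sigma, Finset.sum_congr rfl (g := fun _ => 2 ^ l)]
        · rw [Finset.sum_const, Finset.card_powersetCard, Finset.card_univ, Fintype.card_fin,
            smul_eq_mul]
        · intro T hT
          rw [Finset.card_powerset, (Finset.mem_powersetCard.1 hT).2]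
      have h2 : (2 : ℝ) ^ l ≤ Real.exp l := by
        rw [← mul_one (l : ℝ), Real.exp_nat_mul]
        have := Real.add_one_le_exp (1 : ℝ)
        exact pow_le_pow_left₀ (by norm_num) (by linarith) l
      have h3 : (n : ℝ) / l = d * a := by rw [ha', hd']; field_simp
      calc ((Pset.filter fun r => r.2.card = k).card : ℝ) ≤ (Pset.card : ℝ) := by
            exact_mod_cast Finset.card_filter_le _ _
        _ = n.choose l * 2 ^ l := by rw [h1]; push_cast; ring
        _ ≤ Real.exp (l * (1 + Real.log (n / l))) * Real.exp l := by
            gcongr; exact choose_le_exp hl hn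
        _ = _ := by
            rw [← Real.exp_add, h3, Real.log_mul hd0.ne' ha0.ne']; congr 1; ring
    calc ∑ r ∈ Pset.filter (fun r => r.2.card = k), P.real {ω | m₂ ≤ (H r.1 r.2 ω : ℝ)}
        ≤ ∑ r ∈ Pset.filter (fun r => r.2.card = k), Real.exp (k * d - m₂ * Real.log a) := by
          refine Finset.sum_le_sum fun r hr => ?_
          obtain ⟨hr1, hr2⟩ := Finset.mem_filter.1 hr
          obtain ⟨hr3, hr4⟩ := Finset.mem_sigma.1 hr1
          have hTl : r.1.card = l := (Finset.mem_powersetCard.1 hr3).2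
          have := h.measureReal_hit_rows_le hp0 (J := r.2) (by rw [hTl]; exact hl)
            (by rw [hTl]; linarith) m₂
          rw [hTl, hr2] at this
          exact this
      _ ≤ Real.exp (l * (2 + Real.log d + Real.log a)) * Real.exp (k * d - m₂ * Real.log a) := by
          rw [Finset.sum_const, nsmul_eq_mul]; gcongr
      _ ≤ Real.exp (-(d * q / 32)) := by
          rw [← Real.exp_add]
          refine Real.exp_le_exp.2 ?_
          rw [hm₂, hη]
          exact union_exponent_le hq0 hq1 hd1 (by simpa using hk') hlk hd hla
  refine (measureReal_mono hsub).trans ((measureReal_union_le _ _).trans ?_)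
  rw [hnull, zero_add]
  refine (measureReal_union_le _ _).trans ?_
  linarith

/-- All pairs of column sets of comparable and not too large sizes have many unique rows. -/
def HasStructure {n : ℕ} (A : Matrix (Fin n) (Fin n) ℝ) (p q : ℝ) : Prop :=
  ∀ T J : Finset (Fin n), 0 < J.card → J ⊆ T → (T.card : ℝ) ≤ 2 * Real.sqrt (p * n) * J.card →
    Real.exp (128 / q) ≤ 1 / (T.card * p) → HasUniqueRows A T J (q / 32 * (J.card * (p * n)))

theorem IsSparseModel.measureReal_not_hasStructure_le [IsProbabilityMeasure P]
    (h : IsSparseModel P n p B δ ξ) (hp0 : 0 < p) {q : ℝ} (hq0 : 0 < q) (hq1 : q ≤ 1)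
    (hq : ∀ e, p * q ≤ P.real {ω | δ e ω = 1 ∧ 1 / 2 ≤ |ξ e ω|})
    (hlog : Real.log n ≤ p * n * q / 128) (hd1 : 1 ≤ p * n)
    (hd : 8 * (3 + Real.log (p * n)) ≤ q / 64 * Real.sqrt (p * n))
    (hd2 : 128 / q ≤ Real.sqrt (p * n)) :
    P.real {ω | ¬ HasStructure (sparseMatrix δ ξ ω) p q} ≤ 2 * Real.exp (-(p * n * q / 64)) := by
  classical
  set E : ℕ × ℕ → Set Ω := fun r => {ω | ∃ T J : Finset (Fin n), T.card = r.2 ∧ J.card = r.1 ∧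
    J ⊆ T ∧ ¬ HasUniqueRows (sparseMatrix δ ξ ω) T J (q / 32 * (r.1 * (p * n)))} with hE
  set F : Finset (ℕ × ℕ) := (Finset.Icc 1 n ×ˢ Finset.Icc 1 n).filter fun r =>
    r.1 ≤ r.2 ∧ (r.2 : ℝ) ≤ 2 * Real.sqrt (p * n) * r.1 ∧
      Real.exp (128 / q) ≤ 1 / (r.2 * p) with hF
  have hn : 0 < n := by
    rcases Nat.eq_zero_or_pos n with h0 | h0
    · rw [h0] at hd1; norm_num at hd1
    · exact h0
  have hn' : (0 : ℝ) < n := by exact_mod_cast hn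
  have hsub : {ω | ¬ HasStructure (sparseMatrix δ ξ ω) p q} ⊆ ⋃ r ∈ F, E r := by
    intro ω hω
    simp only [HasStructure, Set.mem_ofPred_eq, not_forall] at hω
    obtain ⟨T, J, h1, h2, h3, h4, h5⟩ := hω
    have h6 := Finset.card_le_card h2
    have h7 : T.card ≤ n := by simpa using Finset.card_le_univ T
    refine Set.mem_iUnion₂.2 ⟨(J.card, T.card), ?_, T, J, rfl, rfl, h2, h5⟩
    simp only [hF, Finset.mem_filter, Finset.mem_product, Finset.mem_Icc]
    exact ⟨⟨⟨h1, h6.trans h7⟩, h1.trans_le h6, h7⟩, h6, h3, h4⟩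
  refine (measureReal_mono hsub (measure_ne_top _ _)).trans
    ((measureReal_biUnion_finset_le _ _).trans ?_)
  calc ∑ r ∈ F, P.real (E r) ≤ ∑ r ∈ F, 2 * Real.exp (-(p * n * q / 32)) := by
        refine Finset.sum_le_sum fun r hr => ?_
        simp only [hF, Finset.mem_filter, Finset.mem_product, Finset.mem_Icc] at hr
        obtain ⟨⟨⟨h1, -⟩, -⟩, h2, h3, h4⟩ := hr
        exact h.measureReal_not_hasUniqueRows_le hp0 hq0 hq1 hq
          (hlog.trans (div_le_div_of_nonneg_left (by positivity) (by norm_num) (by norm_num)))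
          hd1 hd hd2 h1 h2 h3 h4
    _ = F.card * (2 * Real.exp (-(p * n * q / 32))) := by rw [Finset.sum_const, nsmul_eq_mul]
    -- At most n² pairs of sizes, paid for by half of the exponent.
    _ ≤ Real.exp (2 * Real.log n) * (2 * Real.exp (-(p * n * q / 32))) := by
        have h1 : F.card ≤ n * n := by
          refine (Finset.card_filter_le _ _).trans ?_
          simp
        have h2 : Real.exp (2 * Real.log n) = (n : ℝ) * n := by
          rw [two_mul, Real.exp_add, Real.exp_log hn']
        rw [h2]
        gcongr
        exact_mod_cast h1
    _ = 2 * Real.exp (2 * Real.log n + -(p * n * q / 32)) := by rw [Real.exp_add]; ring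
    _ ≤ _ := by
        gcongr
        linarith

end Structure
end SparseRandomMatrix

namespace SparseRandomMatrix

/-! ### What unique rows say about the coordinates of a vector. -/

section Restriction

variable {n : ℕ}

/-- The restriction of a vector to a set of coordinates. -/
noncomputable def restrict (T : Finset (Fin n)) (x : EuclideanSpace ℝ (Fin n)) :
    EuclideanSpace ℝ (Fin n) :=
  WithLp.toLp 2 fun j => if j ∈ T then x j else 0

theorem restrict_apply (T : Finset (Fin n)) (x : EuclideanSpace ℝ (Fin n)) (j : Fin n) :
    restrict T x j = if j ∈ T then x j else 0 := rfl

theorem norm_restrict_sq (T : Finset (Fin n)) (x : EuclideanSpace ℝ (Fin n)) :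
    ‖restrict T x‖ ^ 2 = ∑ j ∈ T, x j ^ 2 := by
  rw [EuclideanSpace.real_norm_sq_eq]
  simp only [restrict_apply, ite_pow, ne_eq, OfNat.ofNat_ne_zero, not_false_eq_true, zero_pow,
    Finset.sum_ite_mem, Finset.univ_inter]

theorem toEuclideanLin_sub_scalar_apply (A : Matrix (Fin n) (Fin n) ℝ) (l : ℝ)
    (x : EuclideanSpace ℝ (Fin n)) (i : Fin n) :
    Matrix.toEuclideanLin (A - Matrix.scalar (Fin n) l) x i = ∑ j, A i j * x j - l * x i := by
  simp [Matrix.toLpLin_apply, Matrix.mulVec, dotProduct]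

theorem sum_mul_eq_sub_restrict_compl (A : Matrix (Fin n) (Fin n) ℝ) (l : ℝ)
    (x : EuclideanSpace ℝ (Fin n)) {T : Finset (Fin n)} {i : Fin n} (hi : i ∉ T) :
    ∑ j ∈ T, A i j * x j = Matrix.toEuclideanLin (A - Matrix.scalar (Fin n) l) x i -
      Matrix.toEuclideanLin (A - Matrix.scalar (Fin n) l) (restrict Tᶜ x) i := by
  rw [toEuclideanLin_sub_scalar_apply, toEuclideanLin_sub_scalar_apply]
  have h1 : ∑ j, A i j * restrict Tᶜ x j = ∑ j ∈ Tᶜ, A i j * x j := by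
    simp only [restrict_apply, mul_ite, mul_zero, Finset.sum_ite_mem, Finset.univ_inter]
  rw [h1, ← Finset.sum_add_sum_compl T]
  simp [restrict_apply, hi]

/-- On a unique row the sum over T reduces to one product of modulus at least μ_s/2. The unique
column determines s, so rows for different s are disjoint and the squares add up. -/
theorem sum_uniqueRows_le {A : Matrix (Fin n) (Fin n) ℝ} {l m : ℝ}
    (x : EuclideanSpace ℝ (Fin n)) {T : Finset (Fin n)} {N : ℕ} {J : ℕ → Finset (Fin n)}
    (hJT : ∀ s < N, J s ⊆ T) (hJ : ∀ s < N, ∀ s' < N, s ≠ s' → Disjoint (J s) (J s'))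
    (hrows : ∀ s < N, HasUniqueRows A T (J s) m) {μ : ℕ → ℝ} (hμ0 : ∀ s, 0 ≤ μ s)
    (hμ : ∀ s < N, ∀ j ∈ J s, μ s ≤ |x j|) :
    m * ∑ s ∈ Finset.range N, μ s ^ 2 ≤
      8 * (‖Matrix.toEuclideanLin (A - Matrix.scalar (Fin n) l) x‖ ^ 2 +
        ‖Matrix.toEuclideanLin (A - Matrix.scalar (Fin n) l) (restrict Tᶜ x)‖ ^ 2) := by
  classical
  set L := Matrix.toEuclideanLin (A - Matrix.scalar (Fin n) l) with hL
  set G : ℕ → Finset (Fin n) := fun s => Finset.univ.filter fun i => i ∉ T ∧ ∃ j ∈ J s,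
    1 / 2 ≤ |A i j| ∧ ∀ j' ∈ T, j' ≠ j → A i j' = 0 with hG
  set h : Fin n → ℝ := fun i => 8 * (L x i ^ 2 + L (restrict Tᶜ x) i ^ 2) with hh
  have hh0 : ∀ i, 0 ≤ h i := fun i => by positivity
  have hpt : ∀ s < N, ∀ i ∈ G s, μ s ^ 2 ≤ h i := by
    intro s hs i hi
    obtain ⟨hiT, j, hj, hA, hz⟩ := (Finset.mem_filter.1 hi).2
    have h1 := sum_mul_eq_sub_restrict_compl A l x hiT
    rw [Finset.sum_eq_single_of_mem j (hJT s hs hj)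
      (fun j' hj' hne => by rw [hz j' hj' hne, zero_mul]), ← hL] at h1
    have h2 : μ s / 2 ≤ |A i j * x j| := by
      rw [abs_mul]
      calc μ s / 2 = 1 / 2 * μ s := by ring
        _ ≤ |A i j| * |x j| := mul_le_mul hA (hμ s hs j hj) (hμ0 s) (abs_nonneg _)
    have h3 : (μ s / 2) ^ 2 ≤ (A i j * x j) ^ 2 := by
      rw [← sq_abs (A i j * x j)]
      exact pow_le_pow_left₀ (by linarith [hμ0 s]) h2 2
    rw [h1] at h3
    simp only [hh]
    nlinarith [sq_nonneg (L x i + L (restrict Tᶜ x) i)]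
  have hdisj : (↑(Finset.range N) : Set ℕ).PairwiseDisjoint G := by
    intro s hs s' hs' hne
    have hs := Finset.mem_range.1 hs
    have hs' := Finset.mem_range.1 hs'
    refine Finset.disjoint_left.2 fun i hi hi' => ?_
    obtain ⟨-, j, hj, hA, hz⟩ := (Finset.mem_filter.1 hi).2
    obtain ⟨-, j', hj', hA', -⟩ := (Finset.mem_filter.1 hi').2
    have hjj : j' ≠ j := fun he =>
      Finset.disjoint_left.1 (hJ s hs s' hs' hne) hj (he ▸ hj')
    rw [hz j' (hJT s' hs' hj') hjj, abs_zero] at hA'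
    norm_num at hA'
  calc m * ∑ s ∈ Finset.range N, μ s ^ 2 = ∑ s ∈ Finset.range N, m * μ s ^ 2 := Finset.mul_sum _ _ _
    _ ≤ ∑ s ∈ Finset.range N, ∑ i ∈ G s, h i := by
        refine Finset.sum_le_sum fun s hs => ?_
        have hs := Finset.mem_range.1 hs
        calc m * μ s ^ 2 ≤ (G s).card * μ s ^ 2 :=
              mul_le_mul_of_nonneg_right (hrows s hs) (sq_nonneg _)
          _ = ∑ i ∈ G s, μ s ^ 2 := by rw [Finset.sum_const, nsmul_eq_mul]
          _ ≤ _ := Finset.sum_le_sum (hpt s hs)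
    _ = ∑ i ∈ (Finset.range N).biUnion G, h i := (Finset.sum_biUnion hdisj).symm
    _ ≤ ∑ i, h i := Finset.sum_le_sum_of_subset_of_nonneg (Finset.subset_univ _) fun i _ _ => hh0 i
    _ = _ := by
        rw [EuclideanSpace.real_norm_sq_eq, EuclideanSpace.real_norm_sq_eq, ← Finset.sum_add_distrib,
          Finset.mul_sum]

end Restriction

/-! ### Decreasing rearrangement and the climb from rank 1 to rank of order 1/p. -/

section Rearrangement

variable {n : ℕ}

/-- The rearrangement is continued by zero past n, so that blocks of ranks may overshoot n. -/
theorem exists_antitone_rearrangement (x : Fin n → ℝ) :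
    ∃ (r : Equiv.Perm (Fin n)) (f : ℕ → ℝ), Antitone f ∧ (∀ i, 0 ≤ f i) ∧
      ∀ j, f (r j) = |x j| := by
  set σ := Tuple.sort fun j => -|x j| with hσ
  have hmono := Tuple.monotone_sort fun j => -|x j|
  refine ⟨σ.symm, fun i => if h : i < n then |x (σ ⟨i, h⟩)| else 0, ?_, ?_, ?_⟩
  · intro a b hab
    by_cases hb : b < n
    · have ha : a < n := hab.trans_lt hb
      have := hmono (a := ⟨a, ha⟩) (b := ⟨b, hb⟩) hab
      simp only [Function.comp_apply] at this
      simp only [ha, hb, dif_pos]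
      linarith
    · simp only [hb, dif_neg, not_false_eq_true]
      split_ifs <;> positivity
  · intro i
    dsimp only
    split_ifs <;> positivity
  · intro j
    simp

/-- The coordinates with rank in `[a, b)`. -/
def rankSet (r : Equiv.Perm (Fin n)) (a b : ℕ) : Finset (Fin n) :=
  Finset.univ.filter fun j => a ≤ (r j : ℕ) ∧ (r j : ℕ) < b

theorem mem_rankSet {r : Equiv.Perm (Fin n)} {a b : ℕ} {j : Fin n} :
    j ∈ rankSet r a b ↔ a ≤ (r j : ℕ) ∧ (r j : ℕ) < b := by simp [rankSet]

theorem sum_rankSet (r : Equiv.Perm (Fin n)) (a : ℕ) {b : ℕ} (hb : b ≤ n) (g : ℕ → ℝ) :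
    ∑ j ∈ rankSet r a b, g (r j) = ∑ i ∈ Finset.Ico a b, g i := by
  refine Finset.sum_bij (fun j _ => (r j : ℕ)) (fun j hj => Finset.mem_Ico.2 (mem_rankSet.1 hj))
    (fun j _ j' _ h => r.injective (Fin.ext h)) (fun i hi => ?_) (fun _ _ => rfl)
  have hi' := Finset.mem_Ico.1 hi
  exact ⟨r.symm ⟨i, hi'.2.trans_le hb⟩, by simpa [mem_rankSet] using hi', by simp⟩

theorem card_rankSet (r : Equiv.Perm (Fin n)) (a : ℕ) {b : ℕ} (hb : b ≤ n) :
    (rankSet r a b).card = b - a := by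
  have := sum_rankSet r a hb fun _ => 1
  simp only [Finset.sum_const, nsmul_eq_mul, mul_one, Nat.card_Ico] at this
  exact_mod_cast this

/-- Each block of length k is dominated by the last value of the preceding block, which is why the
first block is left out. -/
theorem sum_Ico_le_of_antitone {f : ℕ → ℝ} (hf : Antitone f) (k N : ℕ) :
    ∑ i ∈ Finset.Ico k ((N + 1) * k), f i ≤ k * ∑ s ∈ Finset.range N, f ((s + 1) * k - 1) := by
  induction N with
  | zero => simp
  | succ N ih =>
    rw [← Finset.sum_Ico_consecutive _ (show k ≤ (N + 1) * k by nlinarith)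
      (show (N + 1) * k ≤ (N + 1 + 1) * k by nlinarith), Finset.sum_range_succ, mul_add]
    refine add_le_add ih ?_
    calc ∑ i ∈ Finset.Ico ((N + 1) * k) ((N + 1 + 1) * k), f i
        ≤ ∑ i ∈ Finset.Ico ((N + 1) * k) ((N + 1 + 1) * k), f ((N + 1) * k - 1) :=
          Finset.sum_le_sum fun i hi => hf (by have := (Finset.mem_Ico.1 hi).1; omega)
      _ = k * f ((N + 1) * k - 1) := by
          rw [Finset.sum_const, Nat.card_Ico, nsmul_eq_mul, add_mul (N + 1) 1 k, one_mul,
            Nat.add_sub_cancel_left]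

variable {A : Matrix (Fin n) (Fin n) ℝ} {p q l R K : ℝ} {x : EuclideanSpace ℝ (Fin n)}
  {r : Equiv.Perm (Fin n)} {f : ℕ → ℝ}

theorem norm_restrict_rankSet_compl_sq (hfx : ∀ j, f (r j) = |x j|) (k : ℕ) :
    ‖restrict (rankSet r 0 k)ᶜ x‖ ^ 2 = ∑ i ∈ Finset.Ico k n, f i ^ 2 := by
  rw [norm_restrict_sq, ← sum_rankSet r k le_rfl fun i => f i ^ 2]
  have : (rankSet r 0 k)ᶜ = rankSet r k n := by
    ext j
    simp [mem_rankSet]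
  rw [this]
  exact Finset.sum_congr rfl fun j _ => by rw [hfx, sq_abs]

/-- The top k' ranks form T and are cut into blocks of length k, each serving as J; the last rank of
a block carries its smallest modulus. -/
theorem HasStructure.group_sum_le (hA : HasStructure A p q) (hq : 0 < q) (hd : 0 < p * n)
    (hK : ∀ y, ‖Matrix.toEuclideanLin (A - Matrix.scalar (Fin n) l) y‖ ≤
      K * Real.sqrt (p * n) * ‖y‖)
    (hR : ‖Matrix.toEuclideanLin (A - Matrix.scalar (Fin n) l) x‖ ≤ R * Real.sqrt (p * n))
    (hf : Antitone f) (hf0 : ∀ i, 0 ≤ f i) (hfx : ∀ j, f (r j) = |x j|) {k k' : ℕ} (hk : 0 < k)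
    (hk'n : k' ≤ n) (hk'k : (k' : ℝ) ≤ 2 * Real.sqrt (p * n) * k)
    (ha : Real.exp (128 / q) ≤ 1 / (k' * p)) :
    k * ∑ s ∈ Finset.range (k' / k), f ((s + 1) * k - 1) ^ 2 ≤
      256 / q * (R ^ 2 + K ^ 2 * ∑ i ∈ Finset.Ico k' n, f i ^ 2) := by
  have hsk : ∀ s < k' / k, (s + 1) * k ≤ k' := fun s hs =>
    (Nat.mul_le_mul_right k hs).trans (Nat.div_mul_le_self k' k)
  set T := rankSet r 0 k' with hT
  set J : ℕ → Finset (Fin n) := fun s => rankSet r (s * k) ((s + 1) * k) with hJ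
  have hTc : T.card = k' := by rw [hT, card_rankSet r 0 hk'n, Nat.sub_zero]
  have hJc : ∀ s < k' / k, (J s).card = k := fun s hs => by
    rw [hJ, card_rankSet r _ ((hsk s hs).trans hk'n), add_mul, one_mul, Nat.add_sub_cancel_left]
  have hJT : ∀ s < k' / k, J s ⊆ T := fun s hs j hj =>
    mem_rankSet.2 ⟨Nat.zero_le _, (mem_rankSet.1 hj).2.trans_le (hsk s hs)⟩
  have hdis : ∀ s s' : ℕ, s < s' → Disjoint (J s) (J s') := by
    intro s s' hss
    refine Finset.disjoint_left.2 fun j hj hj' => ?_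
    have h1 := (mem_rankSet.1 hj).2
    have h2 := (mem_rankSet.1 hj').1
    have h3 : (s + 1) * k ≤ s' * k := Nat.mul_le_mul_right k hss
    omega
  have hmain := sum_uniqueRows_le (A := A) (l := l) (m := q / 32 * (k * (p * n))) x hJT
    (fun s _ s' _ hne => by
      rcases lt_or_gt_of_ne hne with h | h
      · exact hdis s s' h
      · exact (hdis s' s h).symm)
    (fun s hs => by
      have := hA T (J s) (by rw [hJc s hs]; exact hk) (hJT s hs)
        (by rw [hJc s hs, hTc]; exact hk'k) (by rw [hTc]; exact ha)
      rwa [hJc s hs] at this)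
    (μ := fun s => f ((s + 1) * k - 1)) (fun s => hf0 _)
    (fun s hs j hj => by
      rw [← hfx]
      exact hf (by have := (mem_rankSet.1 hj).2; omega))
  set L := Matrix.toEuclideanLin (A - Matrix.scalar (Fin n) l) with hL
  have hsd : Real.sqrt (p * n) ^ 2 = p * n := Real.sq_sqrt hd.le
  have h1 : ‖L x‖ ^ 2 ≤ R ^ 2 * (p * n) := by
    calc ‖L x‖ ^ 2 ≤ (R * Real.sqrt (p * n)) ^ 2 := pow_le_pow_left₀ (norm_nonneg _) hR 2
      _ = _ := by rw [mul_pow, hsd]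
  have h2 : ‖L (restrict Tᶜ x)‖ ^ 2 ≤ K ^ 2 * (p * n) * ∑ i ∈ Finset.Ico k' n, f i ^ 2 := by
    calc ‖L (restrict Tᶜ x)‖ ^ 2 ≤ (K * Real.sqrt (p * n) * ‖restrict Tᶜ x‖) ^ 2 :=
          pow_le_pow_left₀ (norm_nonneg _) (hK _) 2
      _ = _ := by rw [mul_pow, mul_pow, hsd, norm_restrict_rankSet_compl_sq hfx]
  set S := ∑ s ∈ Finset.range (k' / k), f ((s + 1) * k - 1) ^ 2 with hS
  set t := ∑ i ∈ Finset.Ico k' n, f i ^ 2 with ht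
  have h3 : q / 32 * (k * (p * n)) * S ≤ 8 * (R ^ 2 + K ^ 2 * t) * (p * n) := by linarith
  have h4 : q / 32 * (k * S) ≤ 8 * (R ^ 2 + K ^ 2 * t) := by
    refine le_of_mul_le_mul_right ?_ hd
    linarith
  rw [div_mul_eq_mul_div, le_div_iff₀ hq]
  linarith

/-- One step of the climb: the mass beyond rank k is controlled by the mass beyond rank k', with k'
up to 2√(pn) times larger. -/
theorem HasStructure.tail_le (hA : HasStructure A p q) (hq : 0 < q) (hd : 0 < p * n)
    (hK : ∀ y, ‖Matrix.toEuclideanLin (A - Matrix.scalar (Fin n) l) y‖ ≤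
      K * Real.sqrt (p * n) * ‖y‖)
    (hR : ‖Matrix.toEuclideanLin (A - Matrix.scalar (Fin n) l) x‖ ≤ R * Real.sqrt (p * n))
    (hf : Antitone f) (hf0 : ∀ i, 0 ≤ f i) (hfx : ∀ j, f (r j) = |x j|) {k k' : ℕ} (hk : 0 < k)
    (hkk' : k ≤ k') (hk'n : k' ≤ n) (hk'k : (k' : ℝ) ≤ 2 * Real.sqrt (p * n) * k)
    (ha : Real.exp (128 / q) ≤ 1 / (k' * p)) :
    ∑ i ∈ Finset.Ico k n, f i ^ 2 ≤
      256 / q * R ^ 2 + (256 / q * K ^ 2 + 1) * ∑ i ∈ Finset.Ico k' n, f i ^ 2 := by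
  have h1 := hA.group_sum_le hq hd hK hR hf hf0 hfx hk hk'n hk'k ha
  have h2 := sum_Ico_le_of_antitone (f := fun i => f i ^ 2)
    (fun a b hab => pow_le_pow_left₀ (hf0 b) (hf hab) 2) k (k' / k)
  have h3 : ∑ i ∈ Finset.Ico k k', f i ^ 2 ≤
      ∑ i ∈ Finset.Ico k ((k' / k + 1) * k), f i ^ 2 := by
    refine Finset.sum_le_sum_of_subset_of_nonneg (Finset.Ico_subset_Ico le_rfl ?_)
      fun i _ _ => sq_nonneg _
    have := Nat.lt_div_mul_add (a := k') hk
    rw [add_mul, one_mul]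
    exact this.le
  rw [← Finset.sum_Ico_consecutive _ hkk' hk'n]
  linarith

/-- The size of the largest set of columns to which the structural property applies. -/
noncomputable def coreSize (p q : ℝ) : ℕ := ⌊1 / (Real.exp (128 / q) * p)⌋₊

theorem coreSize_mul_le {p q : ℝ} (hp : 0 < p) : coreSize p q * p ≤ 1 / Real.exp (128 / q) := by
  have h := Nat.floor_le (a := 1 / (Real.exp (128 / q) * p)) (by positivity)
  calc (coreSize p q : ℝ) * p ≤ 1 / (Real.exp (128 / q) * p) * p := by gcongr; exact h
    _ = _ := by field_simp

/-- If the tail beyond the core were too small, the steps would propagate smallness back to rank 1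
and contradict ‖x‖ = 1. -/
theorem HasStructure.exists_core (hA : HasStructure A p q) (hq : 0 < q) (hp : 0 < p)
    (hd : 1 ≤ p * n)
    (hK : ∀ y, ‖Matrix.toEuclideanLin (A - Matrix.scalar (Fin n) l) y‖ ≤
      K * Real.sqrt (p * n) * ‖y‖)
    (hR : ‖Matrix.toEuclideanLin (A - Matrix.scalar (Fin n) l) x‖ ≤ R * Real.sqrt (p * n))
    (hx : ‖x‖ = 1) (hpq : p ≤ 1 / Real.exp (128 / q)) {D : ℝ} {N : ℕ} (hN : 0 < N)
    (hDK : 2 * (256 / q * K ^ 2 + 1) ≤ D ^ 2) (hDR : 2 * (256 / q * R ^ 2) * (D ^ 2) ^ N ≤ 1)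
    (hNk : (coreSize p q : ℝ) ≤ Real.sqrt (p * n) ^ N) :
    ∃ T : Finset (Fin n), T.card = coreSize p q ∧ (∀ j ∈ T, ∀ j' ∉ T, |x j'| ≤ |x j|) ∧
      1 ≤ (D ^ 2) ^ N * ‖restrict Tᶜ x‖ ^ 2 := by
  obtain ⟨r, f, hf, hf0, hfx⟩ := exists_antitone_rearrangement x.ofLp
  set k₀ := coreSize p q with hk₀
  set s := ⌈Real.sqrt (p * n)⌉₊ with hs
  have hd0 : 0 < p * n := by linarith
  have hsq1 : 1 ≤ Real.sqrt (p * n) := Real.one_le_sqrt.2 hd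
  have hs1 : 1 ≤ s := Nat.one_le_iff_ne_zero.2 (Nat.ceil_pos.2 (by linarith)).ne'
  -- Rounding √(pn) up is what the factor 2 in `HasStructure` allows for.
  have hs2 : (s : ℝ) ≤ 2 * Real.sqrt (p * n) := by
    have := Nat.ceil_lt_add_one (a := Real.sqrt (p * n)) (by linarith)
    linarith
  have hk₀1 : 1 ≤ k₀ := by
    refine Nat.le_floor ?_
    rw [Nat.cast_one, le_div_iff₀ (by positivity)]
    rw [le_div_iff₀ (by positivity)] at hpq
    linarith
  have hk₀p := coreSize_mul_le (p := p) (q := q) hp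
  rw [← hk₀] at hk₀p
  have hk₀n : k₀ ≤ n := by
    have h1 : (1 : ℝ) / Real.exp (128 / q) ≤ 1 := by
      rw [div_le_one (by positivity)]
      exact Real.one_le_exp (by positivity)
    have h2 : (k₀ : ℝ) * p ≤ n * p := by linarith
    exact_mod_cast le_of_mul_le_mul_right h2 hp
  -- Ranks grow geometrically and stop at the core size.
  set κ : ℕ → ℕ := fun i => min (s ^ i) k₀ with hκ
  have hκ1 : ∀ i, 1 ≤ κ i := fun i => le_min (Nat.one_le_pow _ _ hs1) hk₀1
  have hκn : ∀ i, κ i ≤ n := fun i => (min_le_right _ _).trans hk₀n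
  have hκm : ∀ i, κ i ≤ κ (i + 1) := fun i =>
    min_le_min_right _ (Nat.pow_le_pow_right hs1 (Nat.le_succ i))
  have hκs : ∀ i, (κ (i + 1) : ℝ) ≤ 2 * Real.sqrt (p * n) * κ i := by
    intro i
    have h1 : κ (i + 1) ≤ s * κ i := by
      rw [hκ]
      dsimp only
      rw [← Nat.mul_min_mul_left, pow_succ']
      exact min_le_min_left _ (Nat.le_mul_of_pos_left _ hs1)
    calc (κ (i + 1) : ℝ) ≤ s * κ i := by exact_mod_cast h1
      _ ≤ _ := by gcongr
  have hκa : ∀ i, Real.exp (128 / q) ≤ 1 / (κ i * p) := by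
    intro i
    have h1 : (κ i : ℝ) * p ≤ 1 / Real.exp (128 / q) := by
      refine le_trans ?_ hk₀p
      gcongr
      exact min_le_right _ _
    have h2 : (0 : ℝ) < κ i := by exact_mod_cast hκ1 i
    rw [le_div_iff₀ (by positivity)]
    rw [le_div_iff₀ (by positivity)] at h1
    linarith
  set t : ℕ → ℝ := fun i => ∑ j ∈ Finset.Ico (κ i) n, f j ^ 2 with ht
  have ht0 : ∀ i, 0 ≤ t i := fun i => Finset.sum_nonneg fun _ _ => sq_nonneg _
  have hD1 : 1 ≤ D ^ 2 := by
    have : 0 ≤ 256 / q * K ^ 2 := by positivity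
    linarith
  -- D² is at least twice the multiplicative loss, and the residual term uses at most half of the
  -- lower bound at every stage.
  have hstep : ∀ i ≤ N, ∀ u v : ℝ, 0 ≤ v → 1 ≤ (D ^ 2) ^ i * u →
      u ≤ 256 / q * R ^ 2 + (256 / q * K ^ 2 + 1) * v → 1 ≤ (D ^ 2) ^ (i + 1) * v := by
    intro i hi u v hv hu huv
    have h1 : 2 * (256 / q * R ^ 2) * (D ^ 2) ^ i ≤ 1 := by
      refine le_trans ?_ hDR
      gcongr
    have h2 : (D ^ 2) ^ i * u ≤
        (D ^ 2) ^ i * (256 / q * R ^ 2 + (256 / q * K ^ 2 + 1) * v) := by gcongr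
    have h3 : (D ^ 2) ^ i * v * (2 * (256 / q * K ^ 2 + 1)) ≤ (D ^ 2) ^ i * v * D ^ 2 := by gcongr
    rw [pow_succ]
    linarith
  have htot : ∑ j ∈ Finset.Ico 0 n, f j ^ 2 = 1 := by
    have h1 := norm_restrict_rankSet_compl_sq hfx 0
    have h2 : restrict (rankSet r 0 0)ᶜ x = x := by
      ext j
      simp [restrict_apply, mem_rankSet]
    rw [← h1, h2, hx, one_pow]
  have hind : ∀ i, 1 ≤ i → i ≤ N → 1 ≤ (D ^ 2) ^ i * t i := by
    intro i hi
    induction i, hi using Nat.le_induction with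
    | base =>
      intro _
      refine hstep 0 (Nat.zero_le _) 1 (t 1) (ht0 1) (by simp) ?_
      -- In the first step the blocks are singletons and cover all ranks from 0, so the whole mass
      -- is bounded and not only a tail.
      have h1 := hA.group_sum_le hq hd0 hK hR hf hf0 hfx one_pos (hκn 1)
        (by have := hκs 0; have h0 : κ 0 = 1 := by simp [hκ, hk₀1]
            rw [h0] at this; exact this) (hκa 1)
      simp only [Nat.cast_one, one_mul, Nat.div_one, mul_one, Nat.add_sub_cancel] at h1
      rw [← Finset.sum_Ico_consecutive _ (Nat.zero_le _) (hκn 1), ← Finset.range_eq_Ico] at htot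
      simp only [ht]
      linarith
    | succ i hi ih =>
      intro hiN
      exact hstep i (by omega) (t i) (t (i + 1)) (ht0 _) (ih (by omega))
        (hA.tail_le hq hd0 hK hR hf hf0 hfx (hκ1 i) (hκm i) (hκn _) (hκs i) (hκa _))
  have hκN : κ N = k₀ := by
    refine min_eq_right ?_
    have h1 : Real.sqrt (p * n) ^ N ≤ (s : ℝ) ^ N :=
      pow_le_pow_left₀ (by linarith) (Nat.le_ceil _) N
    exact_mod_cast hNk.trans h1
  refine ⟨rankSet r 0 k₀, by rw [card_rankSet r 0 hk₀n, Nat.sub_zero], ?_, ?_⟩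
  · intro j hj j' hj'
    rw [← hfx, ← hfx]
    rw [mem_rankSet] at hj hj'
    exact hf (by omega)
  · rw [norm_restrict_rankSet_compl_sq hfx]
    have := hind N hN le_rfl
    simp only [ht] at this
    rwa [hκN] at this

end Rearrangement
end SparseRandomMatrix

namespace SparseRandomMatrix

/-! ### Small ball estimates for sums of independent variables. -/

section SmallBall

variable {Ω : Type*} [MeasurableSpace Ω] {P : Measure Ω}

/-- Conditioning on Y by Fubini: anti-concentration uniform in the shift ignores the rest of the
sum. -/
theorem measureReal_abs_add_le_of_indepFun [IsProbabilityMeasure P] {X Y : Ω → ℝ}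
    (h : IndepFun X Y P) (hX : Measurable X) (hY : Measurable Y) {t q : ℝ}
    (hq : ∀ w, P.real {ω | |X ω + w| ≤ t} ≤ q) : P.real {ω | |X ω + Y ω| ≤ t} ≤ q := by
  have hq0 : 0 ≤ q := measureReal_nonneg.trans (hq 0)
  have hs : MeasurableSet {z : ℝ × ℝ | |z.1 + z.2| ≤ t} :=
    measurableSet_le (by fun_prop) measurable_const
  have hmap := (indepFun_iff_map_prod_eq_prod_map_map hX.aemeasurable hY.aemeasurable).1 h
  have := Measure.isProbabilityMeasure_map (μ := P) hX.aemeasurable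
  have := Measure.isProbabilityMeasure_map (μ := P) hY.aemeasurable
  have h1 : P {ω | |X ω + Y ω| ≤ t} ≤ ENNReal.ofReal q := by
    calc P {ω | |X ω + Y ω| ≤ t}
        = P.map (fun ω => (X ω, Y ω)) {z : ℝ × ℝ | |z.1 + z.2| ≤ t} := by
          rw [Measure.map_apply (hX.prodMk hY) hs]; rfl
      _ = ∫⁻ w, P.map X ((fun x => (x, w)) ⁻¹' {z : ℝ × ℝ | |z.1 + z.2| ≤ t}) ∂(P.map Y) := by
          rw [hmap, Measure.prod_apply_symm hs]
      _ ≤ ∫⁻ _, ENNReal.ofReal q ∂(P.map Y) := by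
          refine lintegral_mono fun w => ?_
          rw [Measure.map_apply hX (measurable_prodMk_right hs), ← ofReal_measureReal]
          exact ENNReal.ofReal_le_ofReal (hq w)
      _ = ENNReal.ofReal q := by simp
  rw [measureReal_def]
  exact ENNReal.toReal_le_of_le_ofReal hq0 h1

theorem integrable_add_pow_of_indepFun {X Y : Ω → ℝ} (h : IndepFun X Y P)
    (hX : ∀ m : ℕ, Integrable (fun ω => X ω ^ m) P)
    (hY : ∀ m : ℕ, Integrable (fun ω => Y ω ^ m) P) (m : ℕ) :
    Integrable (fun ω => (X ω + Y ω) ^ m) P := by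
  simp_rw [add_pow]
  refine integrable_finsetSum _ fun k _ => Integrable.mul_const ?_ _
  exact (h.comp (measurable_id.pow_const k) (measurable_id.pow_const (m - k))).integrable_mul
    (hX k) (hY (m - k))

theorem moments_add_of_indepFun [IsProbabilityMeasure P] {X Y : Ω → ℝ} (h : IndepFun X Y P)
    (hX : ∀ m : ℕ, Integrable (fun ω => X ω ^ m) P)
    (hY : ∀ m : ℕ, Integrable (fun ω => Y ω ^ m) P)
    (hX0 : ∫ ω, X ω ∂P = 0) (hY0 : ∫ ω, Y ω ∂P = 0) :
    ∫ ω, X ω + Y ω ∂P = 0 ∧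
    ∫ ω, (X ω + Y ω) ^ 2 ∂P = ∫ ω, X ω ^ 2 ∂P + ∫ ω, Y ω ^ 2 ∂P ∧
    ∫ ω, (X ω + Y ω) ^ 4 ∂P = ∫ ω, X ω ^ 4 ∂P +
      6 * ((∫ ω, X ω ^ 2 ∂P) * ∫ ω, Y ω ^ 2 ∂P) + ∫ ω, Y ω ^ 4 ∂P := by
  have hprod : ∀ a b : ℕ, Integrable (fun ω => X ω ^ a * Y ω ^ b) P ∧
      ∫ ω, X ω ^ a * Y ω ^ b ∂P = (∫ ω, X ω ^ a ∂P) * ∫ ω, Y ω ^ b ∂P := fun a b => by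
    have := h.comp (measurable_id.pow_const a) (measurable_id.pow_const b)
    exact ⟨this.integrable_mul (hX a) (hY b),
      this.integral_mul_eq_mul_integral (hX a).aestronglyMeasurable (hY b).aestronglyMeasurable⟩
  have hX1 : Integrable X P := by simpa using hX 1
  have hY1 : Integrable Y P := by simpa using hY 1
  refine ⟨by rw [integral_add hX1 hY1, hX0, hY0, add_zero], ?_, ?_⟩
  · obtain ⟨i11, e11⟩ := hprod 1 1
    simp only [pow_one] at i11 e11
    have : ∀ ω, (X ω + Y ω) ^ 2 = X ω ^ 2 + 2 * (X ω * Y ω) + Y ω ^ 2 := fun ω => by ring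
    simp_rw [this]
    have k1 : Integrable (fun ω => X ω ^ 2 + 2 * (X ω * Y ω)) P := (hX 2).add (i11.const_mul 2)
    rw [integral_add k1 (hY 2), integral_add (hX 2) (i11.const_mul 2),
      integral_const_mul, e11, hX0]
    ring
  · obtain ⟨i31, e31⟩ := hprod 3 1
    obtain ⟨i22, e22⟩ := hprod 2 2
    obtain ⟨i13, e13⟩ := hprod 1 3
    simp only [pow_one] at i31 e31 i13 e13
    have : ∀ ω, (X ω + Y ω) ^ 4 = X ω ^ 4 + 4 * (X ω ^ 3 * Y ω) + 6 * (X ω ^ 2 * Y ω ^ 2) +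
        4 * (X ω * Y ω ^ 3) + Y ω ^ 4 := fun ω => by ring
    simp_rw [this]
    have j1 := i31.const_mul 4
    have j2 := i22.const_mul 6
    have j3 := i13.const_mul 4
    have k1 : Integrable (fun ω => X ω ^ 4 + 4 * (X ω ^ 3 * Y ω)) P := (hX 4).add j1
    have k2 : Integrable (fun ω => X ω ^ 4 + 4 * (X ω ^ 3 * Y ω) + 6 * (X ω ^ 2 * Y ω ^ 2)) P :=
      k1.add j2
    have k3 : Integrable (fun ω => X ω ^ 4 + 4 * (X ω ^ 3 * Y ω) + 6 * (X ω ^ 2 * Y ω ^ 2) +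
      4 * (X ω * Y ω ^ 3)) P := k2.add j3
    rw [integral_add k3 (hY 4), integral_add k2 j3, integral_add k1 j2,
      integral_add (hX 4) j1, integral_const_mul, integral_const_mul, integral_const_mul,
      e31, e22, e13, hX0, hY0]
    ring

/-- Centering kills the odd cross terms, and the mixed term 6E[X²]E[Y²] fits into three times the
square of the total variance. -/
theorem moments_sum_of_iIndepFun [IsProbabilityMeasure P] {ι : Type*} {W : ι → Ω → ℝ}
    (h : iIndepFun W P) (hW : ∀ j, Measurable (W j))
    (hI : ∀ j, ∀ m : ℕ, Integrable (fun ω => W j ω ^ m) P) (h0 : ∀ j, ∫ ω, W j ω ∂P = 0)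
    (s : Finset ι) :
    (∀ m : ℕ, Integrable (fun ω => (∑ j ∈ s, W j ω) ^ m) P) ∧ ∫ ω, ∑ j ∈ s, W j ω ∂P = 0 ∧
    ∫ ω, (∑ j ∈ s, W j ω) ^ 2 ∂P = ∑ j ∈ s, ∫ ω, W j ω ^ 2 ∂P ∧
    ∫ ω, (∑ j ∈ s, W j ω) ^ 4 ∂P ≤
      ∑ j ∈ s, ∫ ω, W j ω ^ 4 ∂P + 3 * (∑ j ∈ s, ∫ ω, W j ω ^ 2 ∂P) ^ 2 := by
  classical
  induction s using Finset.induction_on with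
  | empty =>
    refine ⟨fun m => ?_, by simp, by simp, by simp⟩
    simp only [Finset.sum_empty]
    exact integrable_const _
  | insert a s ha ih =>
    obtain ⟨i1, i2, i3, i4⟩ := ih
    have hind : IndepFun (W a) (fun ω => ∑ j ∈ s, W j ω) P := by
      have := (h.indepFun_finsetSum_of_notMem hW ha).symm
      convert this using 1
      ext ω
      simp
    obtain ⟨e1, e2, e3⟩ := moments_add_of_indepFun hind (hI a) i1 (h0 a) i2
    simp only [Finset.sum_insert ha]
    refine ⟨integrable_add_pow_of_indepFun hind (hI a) i1, e1, by rw [e2, i3], ?_⟩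
    rw [e3, i3]
    have : 0 ≤ (∫ ω, W a ω ^ 2 ∂P) ^ 2 := sq_nonneg _
    nlinarith

/-- A sum of independent centered random variables with controlled fourth moment is not
concentrated near any point. -/
theorem measureReal_abs_add_const_le_of_moments [IsProbabilityMeasure P] {X : Ω → ℝ}
    (hX : Measurable X) (hI : ∀ m : ℕ, Integrable (fun ω => X ω ^ m) P) (h0 : ∫ ω, X ω ∂P = 0)
    {C t : ℝ} (hC : 1 ≤ C) (hV : 0 < ∫ ω, X ω ^ 2 ∂P)
    (h4 : ∫ ω, X ω ^ 4 ∂P ≤ C * (∫ ω, X ω ^ 2 ∂P) ^ 2)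
    (ht : 2 * t ^ 2 ≤ ∫ ω, X ω ^ 2 ∂P) (w : ℝ) :
    P.real {ω | |X ω + w| ≤ t} ≤ 1 - 1 / (32 * C) := by
  set V := ∫ ω, X ω ^ 2 ∂P with hVdef
  have hI1 : Integrable X P := by simpa using hI 1
  have hmean : ∫ ω, (X ω + w) ^ 2 ∂P = V + w ^ 2 := by
    have : ∀ ω, (X ω + w) ^ 2 = X ω ^ 2 + (2 * w) * X ω + w ^ 2 := fun ω => by ring
    simp_rw [this]
    have k1 : Integrable (fun ω => X ω ^ 2 + (2 * w) * X ω) P := (hI 2).add (hI1.const_mul _)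
    rw [integral_add k1 (integrable_const _),
      integral_add (hI 2) (hI1.const_mul _), integral_const_mul, h0, integral_const]
    simp [hVdef]
  have hI4 : Integrable (fun ω => (X ω + w) ^ 4) P := by
    have : ∀ ω, (X ω + w) ^ 4 = X ω ^ 4 + (4 * w) * X ω ^ 3 + (6 * w ^ 2) * X ω ^ 2 +
      (4 * w ^ 3) * X ω + w ^ 4 := fun ω => by ring
    simp_rw [this]
    exact ((((hI 4).add ((hI 3).const_mul _)).add ((hI 2).const_mul _)).add
      (hI1.const_mul _)).add (integrable_const _)
  -- The second moment of (X + w)² is compared with its squared mean V + w², so the constant does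
  -- not depend on w.
  have hsq : ∫ ω, ((X ω + w) ^ 2) ^ 2 ∂P ≤ 8 * C * (V + w ^ 2) ^ 2 := by
    calc ∫ ω, ((X ω + w) ^ 2) ^ 2 ∂P ≤ ∫ ω, 8 * X ω ^ 4 + 8 * w ^ 4 ∂P := by
          refine integral_mono (by simpa [← pow_mul] using hI4)
            (((hI 4).const_mul 8).add (integrable_const _)) fun ω => ?_
          have h1 : (X ω + w) ^ 2 ≤ 2 * (X ω ^ 2 + w ^ 2) := by nlinarith [sq_nonneg (X ω - w)]
          have h2 := pow_le_pow_left₀ (sq_nonneg _) h1 2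
          dsimp only
          nlinarith [sq_nonneg (X ω ^ 2 - w ^ 2)]
      _ = 8 * ∫ ω, X ω ^ 4 ∂P + 8 * w ^ 4 := by
          rw [integral_add ((hI 4).const_mul 8) (integrable_const _), integral_const_mul,
            integral_const]
          simp
      _ ≤ 8 * (C * V ^ 2) + 8 * (C * w ^ 4) := by
          have : w ^ 4 ≤ C * w ^ 4 := le_mul_of_one_le_left (by positivity) hC
          linarith
      _ ≤ _ := by
          have : 0 ≤ C * (V * w ^ 2) := by positivity
          nlinarith
  have hpz := paleyZygmund (P := P) (Z := fun ω => (X ω + w) ^ 2) (by fun_prop)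
    (fun ω => sq_nonneg _) (by simpa [← pow_mul] using hI4) (m := V + w ^ 2) (by positivity)
    hmean.ge hsq (by positivity)
  have h1 : (V + w ^ 2) ^ 2 / (4 * (8 * C * (V + w ^ 2) ^ 2)) = 1 / (32 * C) := by
    have : V + w ^ 2 ≠ 0 := by positivity
    field_simp
    norm_num
  rw [h1] at hpz
  have h2 : {ω | (V + w ^ 2) / 2 < (X ω + w) ^ 2} ⊆ {ω | |X ω + w| ≤ t}ᶜ := by
    intro ω hω
    simp only [Set.mem_compl_iff, Set.mem_ofPred_eq, not_le] at hω ⊢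
    by_contra hcon
    have h3 : (X ω + w) ^ 2 ≤ t ^ 2 := by
      rw [← sq_abs]; exact pow_le_pow_left₀ (abs_nonneg _) (not_lt.1 hcon) 2
    nlinarith [sq_nonneg w]
  have h3 := hpz.trans (measureReal_mono h2 (measure_ne_top _ _))
  rw [probReal_compl_eq_one_sub (measurableSet_le (by fun_prop) measurable_const)] at h3
  linarith

/-- Small ball estimate for a sum with large coefficients and about `1 / p` terms. -/
theorem measureReal_abs_add_const_le_of_oneGood [IsProbabilityMeasure P] {ι : Type*} [Fintype ι]
    {Z : ι → Ω → ℝ × ℝ} (h : iIndepFun Z P) (hZ : ∀ j, Measurable (Z j)) {p q b c t : ℝ}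
    (hp0 : 0 ≤ p) (hq0 : 0 ≤ q) (hq1 : q ≤ 1) (h01 : ∀ j, ∀ᵐ ω ∂P, (Z j ω).1 = 0 ∨ (Z j ω).1 = 1)
    (hp : ∀ j, P.real {ω | (Z j ω).1 = 1} = p)
    (hq : ∀ j, p * q ≤ P.real {ω | (Z j ω).1 = 1 ∧ 1 / 2 ≤ |(Z j ω).2|})
    (hι : Fintype.card ι * p ≤ 1 / 2) (hc : c ≤ Fintype.card ι * p) {y : ι → ℝ}
    (hy : ∀ j, b ≤ |y j|) (hb : 0 ≤ b) (ht : t < b / 4) (w : ℝ) :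
    P.real {ω | |∑ j, (Z j ω).1 * (Z j ω).2 * y j + w| ≤ t} ≤ 1 - c * q / 2 := by
  have hmeas : MeasurableSet {ω | |∑ j, (Z j ω).1 * (Z j ω).2 * y j + w| ≤ t} := by
    refine measurableSet_le (Measurable.abs ?_) measurable_const
    refine Measurable.add_const (Finset.measurable_sum _ fun j _ => ?_) w
    exact ((measurable_fst.comp (hZ j)).mul (measurable_snd.comp (hZ j))).mul_const _
  suffices hS : ∃ E : Set Ω, c * q / 2 ≤ P.real E ∧
      ∀ᵐ ω ∂P, ω ∈ E → t < |∑ j, (Z j ω).1 * (Z j ω).2 * y j + w| by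
    obtain ⟨E, hE, hE'⟩ := hS
    have h1 : P.real E ≤ P.real {ω | |∑ j, (Z j ω).1 * (Z j ω).2 * y j + w| ≤ t}ᶜ := by
      refine ENNReal.toReal_mono (measure_ne_top _ _) (measure_mono_ae ?_)
      filter_upwards [hE'] with ω hω hωE
      exact not_le.2 (hω hωE)
    rw [probReal_compl_eq_one_sub hmeas] at h1
    linarith
  have hall : ∀ᵐ ω ∂P, ∀ j, (Z j ω).1 = 0 ∨ (Z j ω).1 = 1 := ae_all_iff.2 h01
  -- A small shift is overcome by exactly one active large entry, of size at least b/2. A large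
  -- shift survives when no entry is active, which has probability at least 1/2.
  by_cases hw : |w| ≤ b / 4
  · refine ⟨(fun ω j => Z j ω) ⁻¹' OneGood ι, ?_, ?_⟩
    · refine le_trans ?_ (le_measureReal_oneGood h hZ hp0 hp hq hι)
      have : c * q ≤ Fintype.card ι * p * q := by gcongr
      linarith
    · filter_upwards [hall] with ω hω hE
      obtain ⟨j, ⟨h1, h2⟩, h3⟩ := hE
      rw [Finset.sum_eq_single_of_mem j (Finset.mem_univ j) fun j' _ hne => by
        rw [(hω j').resolve_right (h3 j' hne)]; ring, h1, one_mul]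
      have h4 : b / 2 ≤ |(Z j ω).2 * y j| := by
        rw [abs_mul]
        calc b / 2 = 1 / 2 * b := by ring
          _ ≤ _ := mul_le_mul h2 (hy j) hb (abs_nonneg _)
      have h5 := abs_sub_abs_le_abs_sub ((Z j ω).2 * y j) (-w)
      rw [sub_neg_eq_add, abs_neg] at h5
      linarith
  · refine ⟨(⋃ j, {ω | (Z j ω).1 = 1})ᶜ, ?_, ?_⟩
    · have hm : MeasurableSet (⋃ j, {ω | (Z j ω).1 = 1}) := MeasurableSet.iUnion fun j =>
        (measurable_fst.comp (hZ j)) (measurableSet_singleton 1)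
      rw [probReal_compl_eq_one_sub hm]
      have h1 : P.real (⋃ j, {ω | (Z j ω).1 = 1}) ≤ Fintype.card ι * p := by
        refine (measureReal_iUnion_fintype_le _).trans ?_
        simp [hp]
      have h2 : c * q ≤ 1 / 2 * 1 := by
        have h3 : c * q ≤ 1 / 2 * q := by gcongr; linarith
        linarith
      linarith
    · filter_upwards [hall] with ω hω hE
      simp only [Set.mem_compl_iff, Set.mem_iUnion, Set.mem_ofPred_eq, not_exists] at hE
      rw [Finset.sum_eq_zero fun j _ => by rw [(hω j).resolve_right (hE j)]; ring, zero_add]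
      linarith

end SmallBall
end SparseRandomMatrix

namespace SparseRandomMatrix

/-! ### Lower bounds for a fixed spread vector. -/

section SpreadVectors

variable {Ω : Type*} [MeasurableSpace Ω] {P : Measure Ω} {n : ℕ} {p B : ℝ}
  {δ ξ : Sym2 (Fin n) → Ω → ℝ}

/-- The vector has about `1 / p` coordinates of order at least `√p`, or a substantial part of it
has coordinates of order at most `√p`. -/
def IsSpread (p a : ℝ) (y : Fin n → ℝ) : Prop :=
  (∃ T : Finset (Fin n), 1 / (2 * a) ≤ T.card * p ∧ T.card * p ≤ 1 / 2 ∧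
    ∀ j ∈ T, Real.sqrt p / 2 ≤ |y j|) ∨
  ∃ V : Finset (Fin n), 1 / 4 ≤ ∑ j ∈ V, y j ^ 2 ∧ ∑ j ∈ V, y j ^ 2 ≤ 1 ∧
    ∀ j ∈ V, |y j| ≤ Real.sqrt (a * p)

/-- The probability with which a row is not almost orthogonal to a spread vector. -/
noncomputable def rowConst (B q a : ℝ) : ℝ := min (q / (4 * a)) (1 / (32 * (96 * B ^ 4 * a + 3)))

theorem rowConst_pos {B q a : ℝ} (hq : 0 < q) (ha : 0 < a) : 0 < rowConst B q a :=
  lt_min (by positivity) (by positivity)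

theorem indepFun_sum_compl {ι : Type*} [Fintype ι] [DecidableEq ι] {W : ι → Ω → ℝ}
    (h : iIndepFun W P) (hW : ∀ j, Measurable (W j)) (S : Finset ι) :
    IndepFun (fun ω => ∑ j ∈ S, W j ω) (fun ω => ∑ j ∈ Sᶜ, W j ω) P := by
  have hind := h.indepFun_finset S Sᶜ disjoint_compl_right hW
  have := hind.comp (φ := fun x : S → ℝ => ∑ j, x j) (ψ := fun x : ↥Sᶜ → ℝ => ∑ j, x j)
    (by fun_prop) (by fun_prop)
  convert this using 1
  · ext ω; exact (Finset.sum_coe_sort S fun j => W j ω).symm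
  · ext ω; exact (Finset.sum_coe_sort Sᶜ fun j => W j ω).symm

theorem IsSparseModel.measureReal_row_le [IsProbabilityMeasure P] (h : IsSparseModel P n p B δ ξ)
    (hB : 0 < B) (hp0 : 0 < p) {q a : ℝ} (hq0 : 0 < q) (hq1 : q ≤ 1) (ha : 0 < a)
    (hq : ∀ e, p * q ≤ P.real {ω | δ e ω = 1 ∧ 1 / 2 ≤ |ξ e ω|})
    {y : Fin n → ℝ} (hy : IsSpread p a y) {U : Finset (Fin n)} (hU : ∀ j, y j ≠ 0 → j ∈ U)
    (i : Fin n) :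
    P.real {ω | |∑ j : U, δ s(i, j) ω * ξ s(i, j) ω * y j| ≤ Real.sqrt p / 9} ≤
      1 - rowConst B q a := by
  classical
  have hsp : 0 < Real.sqrt p := Real.sqrt_pos.2 hp0
  have hsp2 : Real.sqrt p ^ 2 = p := Real.sq_sqrt hp0.le
  set Z : U → Ω → ℝ × ℝ := fun j ω => (δ s(i, j) ω, ξ s(i, j) ω) with hZdef
  have hZ : iIndepFun Z P := iIndepFun_row h.iIndepFun_pair i U
  have hZm : ∀ j, Measurable (Z j) := fun j => h.measurable_pair _
  set W : U → Ω → ℝ := fun j ω => δ s(i, j) ω * ξ s(i, j) ω * y j with hWdef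
  have hWm : ∀ j, Measurable (W j) := fun j =>
    ((h.measurable_delta _).mul (h.measurable_xi _)).mul_const _
  have hW : iIndepFun W P := hZ.comp (fun j x => x.1 * x.2 * y j) fun j => by fun_prop
  -- Only a convenient set S of columns is used; the remaining ones act as an independent shift.
  have key : ∀ S : Finset U, (∀ w, P.real {ω | |∑ j ∈ S, W j ω + w| ≤ Real.sqrt p / 9} ≤
      1 - rowConst B q a) →
      P.real {ω | |∑ j, W j ω| ≤ Real.sqrt p / 9} ≤ 1 - rowConst B q a := by
    intro S hS
    have := measureReal_abs_add_le_of_indepFun (indepFun_sum_compl hW hWm S)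
      (Finset.measurable_sum _ fun j _ => hWm j) (Finset.measurable_sum _ fun j _ => hWm j) hS
    simpa only [Finset.sum_add_sum_compl] using this
  rcases hy with ⟨T, hT1, hT2, hT3⟩ | ⟨V, hV1, hV2, hV3⟩
  · have hTU : ∀ j ∈ T, j ∈ U := fun j hj => hU j fun h0 => by
      have := hT3 j hj
      rw [h0, abs_zero] at this
      linarith
    set S : Finset U := T.subtype (· ∈ U) with hS
    have hScard : Fintype.card S = T.card := by
      rw [Fintype.card_coe, hS, Finset.card_subtype, Finset.filter_true_of_mem hTU]
    refine key S fun w => ?_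
    -- Coordinates of size b = √p/2 give the threshold b/4 = √p/8, just above √p/9.
    have hmain := measureReal_abs_add_const_le_of_oneGood (P := P) (Z := fun (j : S) => Z j)
      (hZ.precomp (g := fun j : S => j.1) Subtype.val_injective) (fun j => hZm j) (p := p) (q := q)
      (b := Real.sqrt p / 2) (c := 1 / (2 * a)) (t := Real.sqrt p / 9) hp0.le hq0.le hq1
      (fun j => h.delta_zero_or_one _) (fun j => h.delta_prob _) (fun j => hq _)
      (by rw [hScard]; exact hT2) (by rw [hScard]; exact hT1) (y := fun j => y j.1)
      (fun j => hT3 _ (Finset.mem_subtype.1 j.2))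
      (by positivity) (by linarith) w
    refine (le_of_eq ?_).trans (hmain.trans ?_)
    · congr 1
      ext ω
      rw [Set.mem_ofPred_eq, Set.mem_ofPred_eq, ← Finset.sum_coe_sort S]
    · have h1 : rowConst B q a ≤ q / (4 * a) := min_le_left _ _
      have h2 : 1 / (2 * a) * q / 2 = q / (4 * a) := by field_simp; norm_num
      rw [h2]
      linarith
  · set S : Finset U := V.subtype (· ∈ U) with hS
    refine key S fun w => ?_
    have hVU : ∀ g : Fin n → ℝ, (∀ j, y j = 0 → g j = 0) →
        ∑ j ∈ S, g j = ∑ j ∈ V, g j := by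
      intro g hg
      rw [hS, Finset.sum_subtype_eq_sum_filter, Finset.sum_filter]
      refine Finset.sum_congr rfl fun j _ => ?_
      split_ifs with hj
      · rfl
      · exact (hg j (by by_contra h0; exact hj (hU j h0))).symm
    have hpow : ∀ (j : U) (m : ℕ), m ≠ 0 → Integrable (fun ω => W j ω ^ m) P ∧
        ∫ ω, W j ω ^ m ∂P = p * (∫ ω, ξ s(i, j) ω ^ m ∂P) * y j ^ m := by
      intro j m hm
      obtain ⟨h1, h2⟩ := h.integral_entry_pow hB s(i, j.1) s(i, j.1) hm
      simp only [hWdef, mul_pow _ (y j)]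
      exact ⟨h1.mul_const _, by rw [integral_mul_const, h2]⟩
    have hW0 : ∀ j, ∫ ω, W j ω ∂P = 0 := fun j => by
      have := (hpow j 1 one_ne_zero).2
      simpa [h.xi_mean] using this
    have hWI : ∀ j, ∀ m : ℕ, Integrable (fun ω => W j ω ^ m) P := fun j m => by
      rcases Nat.eq_zero_or_pos m with rfl | hm
      · simp only [pow_zero]; exact integrable_const _
      · exact (hpow j m hm.ne').1
    have hW2 : ∀ j, ∫ ω, W j ω ^ 2 ∂P = p * y j ^ 2 := fun j => by
      rw [(hpow j 2 two_ne_zero).2,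
        integral_sq_eq_one (h.measurable_xi _) (h.xi_mean _) (h.xi_variance _), mul_one]
    -- The bound y_j² ≤ ap gains the second factor p that the fourth moment of a Bernoulli entry
    -- lacks.
    have hW4 : ∀ j ∈ S, ∫ ω, W j ω ^ 4 ∂P ≤ 24 * B ^ 4 * a * p ^ 2 * y j ^ 2 := fun j hj => by
      rw [hS, Finset.mem_subtype] at hj
      have h1 := h.integral_xi_sq_sq_le hB s(i, j.1)
      simp_rw [← pow_mul] at h1
      have h2 : y j ^ 2 ≤ a * p := by
        rw [← sq_abs, ← Real.sq_sqrt (show 0 ≤ a * p by positivity)]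
        exact pow_le_pow_left₀ (abs_nonneg _) (hV3 j hj) 2
      rw [(hpow j 4 four_ne_zero).2]
      calc p * (∫ ω, ξ s(i, j.1) ω ^ 4 ∂P) * y j ^ 4 ≤ p * (24 * B ^ 4) * y j ^ 4 := by gcongr
        _ = p * (24 * B ^ 4) * (y j ^ 2 * y j ^ 2) := by ring
        _ ≤ p * (24 * B ^ 4) * (a * p * y j ^ 2) := by gcongr
        _ = _ := by ring
    obtain ⟨m1, m2, m3, m4⟩ := moments_sum_of_iIndepFun hW hWm hWI hW0 S
    have hV : ∫ ω, (∑ j ∈ S, W j ω) ^ 2 ∂P = p * ∑ j ∈ V, y j ^ 2 := by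
      rw [m3, Finset.sum_congr rfl fun j _ => hW2 j, ← Finset.mul_sum,
        hVU (fun j => y j ^ 2) (fun j hj => by simp [hj])]
    set s2 := ∑ j ∈ V, y j ^ 2 with hs2
    have h4 : ∫ ω, (∑ j ∈ S, W j ω) ^ 4 ∂P ≤
        (96 * B ^ 4 * a + 3) * (∫ ω, (∑ j ∈ S, W j ω) ^ 2 ∂P) ^ 2 := by
      refine m4.trans ?_
      rw [← m3, hV]
      have h5 : ∑ j ∈ S, ∫ ω, W j ω ^ 4 ∂P ≤ 24 * B ^ 4 * a * p ^ 2 * s2 := by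
        refine (Finset.sum_le_sum hW4).trans (le_of_eq ?_)
        rw [← Finset.mul_sum, hVU (fun j => y j ^ 2) (fun j hj => by simp [hj])]
      -- The mass is at least 1/4, so 1 ≤ 4·s2 makes the bound quadratic in the variance.
      have h6 : 24 * B ^ 4 * a * p ^ 2 * s2 * 1 ≤ 24 * B ^ 4 * a * p ^ 2 * s2 * (4 * s2) := by
        gcongr
        linarith
      nlinarith
    have hmain := measureReal_abs_add_const_le_of_moments (P := P)
      (Finset.measurable_sum S fun j _ => hWm j) m1 m2
      (by have : 0 ≤ 96 * B ^ 4 * a := by positivity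
          linarith : 1 ≤ 96 * B ^ 4 * a + 3) (by rw [hV]; positivity) h4 (t := Real.sqrt p / 9)
      (by rw [hV, div_pow, hsp2]; nlinarith) w
    refine hmain.trans ?_
    have h1 : rowConst B q a ≤ 1 / (32 * (96 * B ^ 4 * a + 3)) := min_le_right _ _
    linarith

-- Rows outside the support of y are independent, number at least n/2, and do not see the shift l
-- because y vanishes there. With cn/8 rows of modulus above √p/9 the squared norm exceeds c·pn/648,
-- where 648 = 8·81.
open Classical in
theorem IsSparseModel.measureReal_norm_le_of_isSpread [IsProbabilityMeasure P]
    (h : IsSparseModel P n p B δ ξ) (hB : 0 < B) (hp0 : 0 < p) {q a : ℝ} (hq0 : 0 < q)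
    (hq1 : q ≤ 1) (ha : 0 < a) (hq : ∀ e, p * q ≤ P.real {ω | δ e ω = 1 ∧ 1 / 2 ≤ |ξ e ω|})
    {y : EuclideanSpace ℝ (Fin n)} (hy : IsSpread p a y)
    (hsupp : ((Finset.univ.filter fun j => y j ≠ 0).card : ℝ) ≤ n / 2) (l : ℝ) :
    P.real {ω | ‖Matrix.toEuclideanLin (sparseMatrix δ ξ ω - Matrix.scalar (Fin n) l) y‖ ≤
      Real.sqrt (rowConst B q a / 648) * Real.sqrt (p * n)} ≤
      Real.exp (-(rowConst B q a / 8 * n)) := by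
  set c := rowConst B q a with hc
  have hc0 : 0 < c := rowConst_pos hq0 ha
  set U : Finset (Fin n) := Finset.univ.filter fun j => y j ≠ 0 with hU
  have hrow := iIndepFun_rows h.iIndepFun_pair h.measurable_pair U
  set Tgood : Set (U → ℝ × ℝ) := {x | Real.sqrt p / 9 < |∑ j, (x j).1 * (x j).2 * y j|} with hTg
  have hTm : MeasurableSet Tgood := measurableSet_lt measurable_const (by fun_prop)
  have hlow : ∀ i : {i // i ∉ U},
      c ≤ P.real ((fun ω (j : U) => (δ s(i, j) ω, ξ s(i, j) ω)) ⁻¹' Tgood) := by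
    intro i
    have h1 := h.measureReal_row_le hB hp0 hq0 hq1 ha hq hy (U := U)
      (fun j hj => by simp [hU, hj]) i
    have hm : MeasurableSet {ω | |∑ j : U, δ s(i.1, j.1) ω * ξ s(i.1, j.1) ω * y j| ≤
        Real.sqrt p / 9} := by
      refine measurableSet_le (Measurable.abs (Finset.measurable_sum _ fun j _ => ?_))
        measurable_const
      exact ((h.measurable_delta _).mul (h.measurable_xi _)).mul_const _
    have h2 : (fun ω (j : U) => (δ s(i.1, j.1) ω, ξ s(i.1, j.1) ω)) ⁻¹' Tgood =
        {ω | |∑ j : U, δ s(i.1, j.1) ω * ξ s(i.1, j.1) ω * y j| ≤ Real.sqrt p / 9}ᶜ := by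
      ext ω
      simp [hTg]
    rw [h2, probReal_compl_eq_one_sub hm]
    linarith
  have hch := chernoff_lower hrow (fun i => measurable_pi_lambda _ fun j => h.measurable_pair _)
    (fun _ => hTm) hlow (c / 8 * n)
  have hcard : (n : ℝ) / 2 ≤ Fintype.card {i // i ∉ U} := by
    have h1 : Fintype.card {i // i ∉ U} = n - U.card := by
      rw [Fintype.card_subtype_compl, Fintype.card_fin, Fintype.card_coe]
    have h2 : U.card ≤ n := by simpa using Finset.card_le_univ U
    rw [h1, Nat.cast_sub h2]
    linarith
  refine (measureReal_mono ?_ (measure_ne_top _ _)).trans (hch.trans (Real.exp_le_exp.2 ?_))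
  · intro ω hω
    simp only [Set.mem_ofPred_eq] at hω ⊢
    set L := Matrix.toEuclideanLin (sparseMatrix δ ξ ω - Matrix.scalar (Fin n) l) with hL
    set F : Finset {i // i ∉ U} := Finset.univ.filter fun i =>
      (fun j : U => (δ s(i.1, j.1) ω, ξ s(i.1, j.1) ω)) ∈ Tgood with hF
    have h1 : ∀ i ∈ F, p / 81 ≤ L y i.1 ^ 2 := by
      intro i hi
      have hi' : Real.sqrt p / 9 < |∑ j : U, δ s(i.1, j.1) ω * ξ s(i.1, j.1) ω * y j| :=
        (Finset.mem_filter.1 hi).2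
      have hy0 : y i.1 = 0 := by
        have := i.2
        simpa [hU] using this
      have h2 : L y i.1 = ∑ j : U, δ s(i.1, j.1) ω * ξ s(i.1, j.1) ω * y j := by
        rw [hL, toEuclideanLin_sub_scalar_apply, hy0, mul_zero, sub_zero,
          Finset.sum_coe_sort U fun j => δ s(i.1, j) ω * ξ s(i.1, j) ω * y j]
        refine (Finset.sum_subset (Finset.subset_univ _) fun j _ hj => ?_).symm
        have : y j = 0 := by simpa [hU] using hj
        rw [this, mul_zero]
      rw [← h2] at hi'
      have h3 := pow_le_pow_left₀ (by positivity) hi'.le 2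
      rw [sq_abs, div_pow, Real.sq_sqrt hp0.le] at h3
      linarith
    have h2 : (F.card : ℝ) * (p / 81) ≤ ‖L y‖ ^ 2 := by
      rw [EuclideanSpace.real_norm_sq_eq]
      calc (F.card : ℝ) * (p / 81) = ∑ i ∈ F, p / 81 := by rw [Finset.sum_const, nsmul_eq_mul]
        _ ≤ ∑ i ∈ F, L y i.1 ^ 2 := Finset.sum_le_sum h1
        _ = ∑ i ∈ F.map (Function.Embedding.subtype _), L y i ^ 2 := by rw [Finset.sum_map]; rfl
        _ ≤ _ := Finset.sum_le_sum_of_subset_of_nonneg (Finset.subset_univ _)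
            fun i _ _ => sq_nonneg _
    have h3 : ‖L y‖ ^ 2 ≤ c / 648 * (p * n) := by
      have := pow_le_pow_left₀ (norm_nonneg _) hω 2
      rwa [mul_pow, Real.sq_sqrt (by positivity), Real.sq_sqrt (by positivity)] at this
    have h4 : (F.card : ℝ) * (p / 81) ≤ c / 8 * n * (p / 81) := by linarith
    exact le_of_mul_le_mul_right h4 (by positivity)
  · have : (n : ℝ) / 2 * c / 2 ≤ Fintype.card {i // i ∉ U} * c / 2 := by gcongr
    linarith

end SpreadVectors
end SparseRandomMatrix

namespace SparseRandomMatrix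

/-! ### Union bound over a net of core vectors. -/

section NetArgument

variable {Ω : Type*} [MeasurableSpace Ω] {P : Measure Ω} {n : ℕ} {p B : ℝ}
  {δ ξ : Sym2 (Fin n) → Ω → ℝ}

theorem norm_restrict_le_of_abs_le {T : Finset (Fin n)} {x y : EuclideanSpace ℝ (Fin n)}
    (h : ∀ j ∈ T, |x j| ≤ |y j|) : ‖restrict T x‖ ≤ ‖restrict T y‖ := by
  refine (sq_le_sq₀ (norm_nonneg _) (norm_nonneg _)).1 ?_
  rw [norm_restrict_sq, norm_restrict_sq]
  refine Finset.sum_le_sum fun j hj => ?_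
  rw [← sq_abs (x j), ← sq_abs (y j)]
  exact pow_le_pow_left₀ (abs_nonneg _) (h j hj) 2

theorem norm_restrict_le (T : Finset (Fin n)) (x : EuclideanSpace ℝ (Fin n)) :
    ‖restrict T x‖ ≤ ‖x‖ := by
  refine (sq_le_sq₀ (norm_nonneg _) (norm_nonneg _)).1 ?_
  rw [norm_restrict_sq, EuclideanSpace.real_norm_sq_eq]
  exact Finset.sum_le_sum_of_subset_of_nonneg (Finset.subset_univ _) fun _ _ _ => sq_nonneg _

theorem norm_restrict_mono {S T : Finset (Fin n)} (h : S ⊆ T) (x : EuclideanSpace ℝ (Fin n)) :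
    ‖restrict S x‖ ≤ ‖restrict T x‖ := by
  refine (sq_le_sq₀ (norm_nonneg _) (norm_nonneg _)).1 ?_
  rw [norm_restrict_sq, norm_restrict_sq]
  exact Finset.sum_le_sum_of_subset_of_nonneg h fun _ _ _ => sq_nonneg _

theorem restrict_sub (T : Finset (Fin n)) (x y : EuclideanSpace ℝ (Fin n)) :
    restrict T (x - y) = restrict T x - restrict T y := by
  ext j
  by_cases hj : j ∈ T <;> simp [restrict_apply, hj]

/-- Vectors of norm at most `R`, of norm one off a small set `T`, almost supported on `T` and
another set `S`, and spread on `T` or outside `T`. -/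
def IsCoreVector (p a ε R : ℝ) (k M : ℕ) (x : EuclideanSpace ℝ (Fin n)) : Prop :=
  ∃ T S : Finset (Fin n), T.card ≤ k ∧ S.card ≤ M ∧ ‖x‖ ≤ R ∧ ‖restrict Tᶜ x‖ = 1 ∧
    ‖restrict (S ∪ T)ᶜ x‖ ≤ ε ∧
    ((1 / (2 * a) ≤ T.card * p ∧ T.card * p ≤ 1 / 2 ∧ ∀ j ∈ T, Real.sqrt p ≤ |x j|) ∨
      ∀ j ∉ T, |x j| ≤ Real.sqrt (a * p))

-- The parts on T and on S outside T get separate nets: the first may have norm up to R but few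
-- coordinates, the second has many coordinates but norm at most 1. With the part off both sets, the
-- error is 3ε.
open Classical in
theorem IsCoreVector.exists_lattice {a ε R : ℝ} {k M : ℕ} (hk : 0 < k) (hM : 0 < M) (hε : 0 < ε)
    (hε6 : ε ≤ 1 / 6) (hεa : 8 * a * ε ^ 2 ≤ 1) (ha : 0 < a) (hp : 0 < p)
    {x : EuclideanSpace ℝ (Fin n)} (hx : IsCoreVector p a ε R k M x) :
    ∃ u ∈ latticeNet n (R / ε) k, ∃ v ∈ latticeNet n (1 / ε) M,
      IsSpread p a (latticePoint ε k u + latticePoint ε M v : EuclideanSpace ℝ (Fin n)) ∧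
      (Finset.univ.filter fun j => (latticePoint ε k u + latticePoint ε M v :
        EuclideanSpace ℝ (Fin n)) j ≠ 0).card ≤ k + M ∧
      ‖x - (latticePoint ε k u + latticePoint ε M v)‖ ≤ 3 * ε := by
  obtain ⟨T, S, hT, hS, hxR, hx1, hxε, hsp⟩ := hx
  have hsub1 : (Finset.univ.filter fun j => restrict T x j ≠ 0) ⊆ T := fun j hj => by
    by_contra hjT
    simp [restrict_apply, hjT] at hj
  have hsub2 : (Finset.univ.filter fun j => restrict (S \ T) x j ≠ 0) ⊆ S := fun j hj => by
    by_contra hjS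
    simp [restrict_apply, hjS] at hj
  obtain ⟨u, hu, hu1, hu2⟩ := exists_latticePoint_near (restrict T x) hk hε
    ((norm_restrict_le T x).trans hxR) ((Finset.card_le_card hsub1).trans hT)
  have hST : S \ T ⊆ Tᶜ := fun j hj => Finset.mem_compl.2 (Finset.mem_sdiff.1 hj).2
  obtain ⟨v, hv, hv1, hv2⟩ := exists_latticePoint_near (restrict (S \ T) x) hM hε
    ((norm_restrict_mono hST x).trans hx1.le) ((Finset.card_le_card hsub2).trans hS)
  refine ⟨u, hu, v, hv, ?_⟩
  set y₁ := latticePoint (n := n) ε k u with hy₁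
  set y₂ := latticePoint (n := n) ε M v with hy₂
  have hy₁0 : ∀ j ∉ T, y₁ j = 0 := fun j hj => by
    have := (hu2 j).1
    simpa [restrict_apply, hj] using this
  have hy₂0 : ∀ j, j ∉ S \ T → y₂ j = 0 := fun j hj => by
    have := (hv2 j).1
    rw [restrict_apply, if_neg hj, abs_zero] at this
    exact abs_nonpos_iff.1 this
  have hdecomp : x - (y₁ + y₂) = (restrict T x - y₁) + (restrict (S \ T) x - y₂) +
      restrict (S ∪ T)ᶜ x := by
    ext j
    by_cases hjT : j ∈ T <;> by_cases hjS : j ∈ S <;> simp [restrict_apply, hjT, hjS] <;> ring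
  have hnear : ‖x - (y₁ + y₂)‖ ≤ 3 * ε := by
    rw [hdecomp]
    refine (norm_add_le _ _).trans ?_
    have := norm_add_le (restrict T x - y₁) (restrict (S \ T) x - y₂)
    linarith
  refine ⟨?_, ?_, hnear⟩
  · rcases hsp with ⟨h1, h2, h3⟩ | h3
    · refine Or.inl ⟨T, h1, h2, fun j hj => ?_⟩
      have hj2 : y₂ j = 0 := hy₂0 j (by simp [hj])
      have h4 := (hu2 j).2
      rw [restrict_apply, if_pos hj] at h4
      -- The mesh is at most √p/2, since kp ≥ |T|p ≥ 1/(2a) ≥ 4ε²; so coordinates of size √p keep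
      -- half of it.
      have h5 : ε / Real.sqrt k ≤ Real.sqrt p / 2 := by
        have hk' : (0 : ℝ) < k := by exact_mod_cast hk
        have hTk : (T.card : ℝ) * p ≤ k * p := by gcongr
        have h6 : 2 * ε ≤ Real.sqrt (k * p) := by
          refine Real.le_sqrt_of_sq_le ?_
          rw [div_le_iff₀ (by positivity)] at h1
          have h7 : (2 * ε) ^ 2 * (2 * a) ≤ k * p * (2 * a) := by nlinarith
          exact le_of_mul_le_mul_right h7 (by positivity)
        rw [Real.sqrt_mul hk'.le] at h6
        rw [div_le_iff₀ (Real.sqrt_pos.2 hk')]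
        linarith
      have h6 := h3 j hj
      have h7 := abs_sub_abs_le_abs_sub (x j) (y₁ j)
      have h8 : (y₁ + y₂ : EuclideanSpace ℝ (Fin n)) j = y₁ j := by simp [hj2]
      rw [h8]
      linarith
    · have hle : ∀ j ∈ Tᶜ, |(y₁ + y₂ : EuclideanSpace ℝ (Fin n)) j| ≤ |x j| := by
        intro j hj
        have hj := Finset.mem_compl.1 hj
        have h4 : (y₁ + y₂ : EuclideanSpace ℝ (Fin n)) j = y₂ j := by simp [hy₁0 j hj]
        rw [h4]
        refine (hv2 j).1.trans ?_
        rw [restrict_apply]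
        split_ifs <;> simp
      have h5 : ‖restrict Tᶜ (y₁ + y₂)‖ ≤ 1 := (norm_restrict_le_of_abs_le hle).trans hx1.le
      have h6 : 1 / 2 ≤ ‖restrict Tᶜ (y₁ + y₂)‖ := by
        have h7 := norm_restrict_le Tᶜ (x - (y₁ + y₂))
        rw [restrict_sub] at h7
        have h8 := norm_sub_norm_le (restrict Tᶜ x) (restrict Tᶜ (y₁ + y₂))
        linarith
      refine Or.inr ⟨Tᶜ, ?_, ?_, fun j hj => (hle j hj).trans (h3 j (Finset.mem_compl.1 hj))⟩
      · rw [← norm_restrict_sq]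
        nlinarith
      · rw [← norm_restrict_sq]
        nlinarith [norm_nonneg (restrict Tᶜ (y₁ + y₂))]
  · refine le_trans (Finset.card_le_card (t := T ∪ S) fun j hj => ?_)
      ((Finset.card_union_le _ _).trans (Nat.add_le_add hT hS))
    by_contra hjTS
    simp only [Finset.mem_union, not_or] at hjTS
    exact (Finset.mem_filter.1 hj).2 (by simp [hy₁0 j hjTS.1, hy₂0 j (by simp [hjTS.2])])

theorem card_latticeNet_le_exp (n : ℕ) {R c : ℝ} (hR : 1 ≤ R) (hc : 0 < c) (hc1 : c ≤ 1) (k : ℕ) :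
    ((latticeNet n R k).card : ℝ) ≤
      Real.exp (c / 64 * n + k * (1 + Real.log (128 / c) + Real.log R)) := by
  have hR0 : 0 < R := by linarith
  have h1 := card_latticeNet_le n hR0 (δ := c / (128 * R)) (by positivity)
    -- The weight δ = c/(128R) makes the support entropy exp(cn/64), leaving log R per coordinate.
    (by rw [div_le_one (by positivity)]; linarith) k
  refine h1.trans (le_of_eq ?_)
  have h2 : Real.exp 1 / (c / (128 * R)) = Real.exp (1 + Real.log (128 / c) + Real.log R) := by
    rw [Real.exp_add, Real.exp_add, Real.exp_log (by positivity), Real.exp_log hR0]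
    field_simp
  rw [h2, ← Real.exp_nat_mul, ← Real.exp_add]
  congr 2
  field_simp
  ring

open Classical in
theorem IsSparseModel.measureReal_exists_isCoreVector_le [IsProbabilityMeasure P]
    (h : IsSparseModel P n p B δ ξ) (hB : 0 < B) (hp0 : 0 < p) {q a : ℝ} (hq0 : 0 < q)
    (hq1 : q ≤ 1) (ha : 0 < a) (hq : ∀ e, p * q ≤ P.real {ω | δ e ω = 1 ∧ 1 / 2 ≤ |ξ e ω|})
    {K ε R : ℝ} {k M : ℕ} (hk : 0 < k) (hM : 0 < M) (hε : 0 < ε) (hε6 : ε ≤ 1 / 6)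
    (hεa : 8 * a * ε ^ 2 ≤ 1) (hεK : ε * (1 + 3 * K) ≤ Real.sqrt (rowConst B q a / 648))
    (hK : 0 ≤ K) (hR : 1 ≤ R)
    (hkn : k * (1 + Real.log (128 / rowConst B q a) + Real.log (R / ε)) ≤ rowConst B q a / 64 * n)
    (hMn : M * (1 + Real.log (128 / rowConst B q a) + Real.log (1 / ε)) ≤ rowConst B q a / 64 * n)
    (l : ℝ) :
    P.real {ω | (∀ x, ‖Matrix.toEuclideanLin (sparseMatrix δ ξ ω - Matrix.scalar (Fin n) l) x‖ ≤
        K * Real.sqrt (p * n) * ‖x‖) ∧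
      ∃ x, IsCoreVector p a ε R k M x ∧
        ‖Matrix.toEuclideanLin (sparseMatrix δ ξ ω - Matrix.scalar (Fin n) l) x‖ ≤
          ε * Real.sqrt (p * n)} ≤ Real.exp (-(rowConst B q a / 16 * n)) := by
  set c := rowConst B q a with hc
  have hc0 : 0 < c := rowConst_pos hq0 ha
  have hc1 : c ≤ 1 := by
    refine (min_le_right _ _).trans ?_
    rw [div_le_one (by positivity)]
    have : 0 ≤ 96 * B ^ 4 * a := by positivity
    linarith
  have hL1 : 0 ≤ Real.log (128 / c) :=
    Real.log_nonneg (by rw [le_div_iff₀ hc0]; linarith)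
  have hε1 : 1 ≤ 1 / ε := by rw [le_div_iff₀ hε]; linarith
  have hRε : 1 ≤ R / ε := by rw [le_div_iff₀ hε]; linarith
  have hL2 := Real.log_nonneg hε1
  have hL3 := Real.log_nonneg hRε
  set A := latticeNet n (R / ε) k ×ˢ latticeNet n (1 / ε) M with hA
  set y : (Fin n → ℤ) × (Fin n → ℤ) → EuclideanSpace ℝ (Fin n) := fun r =>
    latticePoint ε k r.1 + latticePoint ε M r.2 with hy
  set F := A.filter fun r => IsSpread p a (y r) ∧
    (Finset.univ.filter fun j => y r j ≠ 0).card ≤ k + M with hF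
  have hkM : ((k + M : ℕ) : ℝ) ≤ n / 2 := by
    have h1 : (k : ℝ) * 1 ≤
        k * (1 + Real.log (128 / c) + Real.log (R / ε)) := by gcongr; linarith
    have h2 : (M : ℝ) * 1 ≤
        M * (1 + Real.log (128 / c) + Real.log (1 / ε)) := by gcongr; linarith
    have h3 : c * n ≤ 1 * n := by gcongr
    push_cast
    linarith
  have hsub : {ω | (∀ x, ‖Matrix.toEuclideanLin
        (sparseMatrix δ ξ ω - Matrix.scalar (Fin n) l) x‖ ≤ K * Real.sqrt (p * n) * ‖x‖) ∧
      ∃ x, IsCoreVector p a ε R k M x ∧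
        ‖Matrix.toEuclideanLin (sparseMatrix δ ξ ω - Matrix.scalar (Fin n) l) x‖ ≤
          ε * Real.sqrt (p * n)} ⊆
      ⋃ r ∈ F, {ω | ‖Matrix.toEuclideanLin (sparseMatrix δ ξ ω - Matrix.scalar (Fin n) l) (y r)‖ ≤
        Real.sqrt (c / 648) * Real.sqrt (p * n)} := by
    rintro ω ⟨hω, x, hx, hxε⟩
    obtain ⟨u, hu, v, hv, h1, h2, h3⟩ := hx.exists_lattice hk hM hε hε6 hεa ha hp0
    refine Set.mem_iUnion₂.2 ⟨(u, v), Finset.mem_filter.2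
      ⟨Finset.mem_product.2 ⟨hu, hv⟩, h1, h2⟩, ?_⟩
    set L := Matrix.toEuclideanLin (sparseMatrix δ ξ ω - Matrix.scalar (Fin n) l) with hL
    change ‖L (y (u, v))‖ ≤ _
    have h4 : L (y (u, v)) = L x - L (x - y (u, v)) := by rw [map_sub]; abel
    rw [h4]
    calc ‖L x - L (x - y (u, v))‖ ≤ ‖L x‖ + ‖L (x - y (u, v))‖ := norm_sub_le _ _
      _ ≤ ε * Real.sqrt (p * n) + K * Real.sqrt (p * n) * (3 * ε) := by
          gcongr
          exact (hω _).trans (by gcongr)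
      _ = ε * (1 + 3 * K) * Real.sqrt (p * n) := by ring
      _ ≤ _ := by gcongr
  refine (measureReal_mono hsub (measure_ne_top _ _)).trans
    ((measureReal_biUnion_finset_le _ _).trans ?_)
  calc ∑ r ∈ F, P.real {ω | ‖Matrix.toEuclideanLin
          (sparseMatrix δ ξ ω - Matrix.scalar (Fin n) l) (y r)‖ ≤
            Real.sqrt (c / 648) * Real.sqrt (p * n)}
      ≤ ∑ r ∈ F, Real.exp (-(c / 8 * n)) := by
        refine Finset.sum_le_sum fun r hr => ?_
        obtain ⟨-, h1, h2⟩ := Finset.mem_filter.1 hr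
        exact h.measureReal_norm_le_of_isSpread hB hp0 hq0 hq1 ha hq h1
          (le_trans (by exact_mod_cast h2) hkM) l
    _ = F.card * Real.exp (-(c / 8 * n)) := by rw [Finset.sum_const, nsmul_eq_mul]
    -- Each net costs cn/32 in the exponent, in total half of the available cn/8.
    _ ≤ (Real.exp (c / 64 * n + c / 64 * n) * Real.exp (c / 64 * n + c / 64 * n)) *
          Real.exp (-(c / 8 * n)) := by
        gcongr
        calc (F.card : ℝ) ≤ A.card := by exact_mod_cast Finset.card_filter_le _ _
          _ = (latticeNet n (R / ε) k).card * (latticeNet n (1 / ε) M).card := by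
              rw [hA, Finset.card_product]; push_cast; rfl
          _ ≤ _ := by
              gcongr
              · exact (card_latticeNet_le_exp n hRε hc0 hc1 k).trans (Real.exp_le_exp.2 (by linarith))
              · exact (card_latticeNet_le_exp n hε1 hc0 hc1 M).trans (Real.exp_le_exp.2 (by linarith))
    _ = Real.exp (-(c / 16 * n)) := by
        rw [← Real.exp_add, ← Real.exp_add]
        congr 1
        ring

end NetArgument
end SparseRandomMatrix

namespace SparseRandomMatrix

/-! ### From compressible almost-null vectors to core vectors. -/

section CoreVectors

variable {n : ℕ} {A : Matrix (Fin n) (Fin n) ℝ} {p q l r K D ε : ℝ}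
  {x : EuclideanSpace ℝ (Fin n)}

theorem restrict_smul (T : Finset (Fin n)) (c : ℝ) (x : EuclideanSpace ℝ (Fin n)) :
    restrict T (c • x) = c • restrict T x := by
  ext j
  by_cases hj : j ∈ T <;> simp [restrict_apply, hj]

theorem exists_support_of_mem_comp {M : ℕ} (hx : x ∈ Comp n M r) :
    ∃ S : Finset (Fin n), S.card ≤ M ∧ ‖restrict Sᶜ x‖ ≤ r := by
  classical
  obtain ⟨-, y, hy, hxy⟩ := hx
  refine ⟨Finset.univ.filter fun i => y i ≠ 0, ?_, ?_⟩
  · have h1 : {i | y i ≠ 0}.ncard ≤ M := hy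
    rwa [Set.ncard_eq_toFinset_card', Set.toFinset_ofPred] at h1
  · refine le_trans ?_ hxy
    refine le_trans (le_of_eq ?_)
      (norm_restrict_le (Finset.univ.filter fun i => y i ≠ 0)ᶜ (x - y))
    congr 1
    ext j
    by_cases hj : y j = 0 <;> simp [restrict_apply, hj]

theorem isCoreVector_smul {a R τ : ℝ} {k M : ℕ} {T S : Finset (Fin n)} (hT : T.card ≤ k)
    (hS : S.card ≤ M) (hx : ‖x‖ = 1) (hτ : ‖restrict Tᶜ x‖ = τ) (hτ0 : 0 < τ) (hτR : 1 ≤ R * τ)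
    (hr : ‖restrict Sᶜ x‖ ≤ r) (hrτ : r ≤ ε * τ)
    (hsp : (1 / (2 * a) ≤ T.card * p ∧ T.card * p ≤ 1 / 2 ∧ ∀ j ∈ T, Real.sqrt p * τ ≤ |x j|) ∨
      ∀ j ∉ T, |x j| ≤ Real.sqrt (a * p) * τ) : IsCoreVector p a ε R k M (τ⁻¹ • x) := by
  have hn : ∀ v : EuclideanSpace ℝ (Fin n), ‖τ⁻¹ • v‖ = ‖v‖ / τ := fun v => by
    rw [norm_smul, Real.norm_eq_abs, abs_of_pos (inv_pos.2 hτ0), inv_mul_eq_div]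
  have hj : ∀ j, |(τ⁻¹ • x) j| = |x j| / τ := fun j => by
    rw [PiLp.smul_apply, smul_eq_mul, abs_mul, abs_of_pos (inv_pos.2 hτ0), inv_mul_eq_div]
  refine ⟨T, S, hT, hS, ?_, ?_, ?_, ?_⟩
  · rw [hn, hx, div_le_iff₀ hτ0]; exact hτR
  · rw [restrict_smul, hn, hτ, div_self hτ0.ne']
  · rw [restrict_smul, hn, div_le_iff₀ hτ0]
    refine (norm_restrict_mono ?_ x).trans (hr.trans hrτ)
    exact Finset.compl_subset_compl.2 Finset.subset_union_left
  · rcases hsp with ⟨h1, h2, h3⟩ | h3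
    · exact Or.inl ⟨h1, h2, fun j hjT => by rw [hj, le_div_iff₀ hτ0]; exact h3 j hjT⟩
    · exact Or.inr fun j hjT => by rw [hj, div_le_iff₀ hτ0]; exact h3 j hjT

/-- Dividing by the norm τ off the core costs a factor at most D^m. Since r·D^m = D^(-6) ≤ ε, both
the sparse approximation and the smallness of the image survive at scale ε. -/
theorem HasStructure.exists_isCoreVector {M : ℕ} (hA : HasStructure A p q) (hq : 0 < q)
    (hq1 : q ≤ 1) (hp : 0 < p) (hd : 1 ≤ p * n)
    (hK : ∀ y, ‖Matrix.toEuclideanLin (A - Matrix.scalar (Fin n) l) y‖ ≤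
      K * Real.sqrt (p * n) * ‖y‖)
    (hR : ‖Matrix.toEuclideanLin (A - Matrix.scalar (Fin n) l) x‖ ≤ r * Real.sqrt (p * n))
    (hx : x ∈ Comp n M r) {m : ℕ} (hr : r * D ^ (m + 6) = 1) (hD : 1 ≤ D)
    (hDK : 2 * (256 / q * K ^ 2 + 1) ≤ D ^ 2) (hDq : 512 / q ≤ D ^ 12) (hDε : 1 ≤ ε * D ^ 6)
    (hpm : 1 / (8 * p) ≤ Real.sqrt (p * n) ^ m) :
    ∃ z, IsCoreVector p (Real.exp (128 / q)) ε (D ^ m) (max 1 (coreSize p q)) M z ∧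
      ‖Matrix.toEuclideanLin (A - Matrix.scalar (Fin n) l) z‖ ≤ ε * Real.sqrt (p * n) := by
  classical
  obtain ⟨S, hS, hSr⟩ := exists_support_of_mem_comp hx
  have hx1 : ‖x‖ = 1 := hx.1
  set a := Real.exp (128 / q) with ha
  have ha8 : 8 < a := by
    have h1 : 128 ≤ 128 / q := by rw [le_div_iff₀ hq]; linarith
    have h2 := Real.add_one_le_exp (128 / q)
    linarith
  have hD0 : 0 < D := by linarith
  have hDm : 1 ≤ D ^ m := one_le_pow₀ hD
  have hr0 : 0 < r := pos_of_mul_pos_left (by rw [hr]; exact one_pos) (by positivity)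
  have hrm : r * D ^ m ≤ ε := by
    have h1 : r * D ^ m * D ^ 6 ≤ ε * D ^ 6 := by
      rw [mul_assoc, ← pow_add, hr]; exact hDε
    exact le_of_mul_le_mul_right h1 (by positivity)
  suffices hT : ∃ (T : Finset (Fin n)) (τ : ℝ), T.card ≤ max 1 (coreSize p q) ∧
      ‖restrict Tᶜ x‖ = τ ∧ 0 < τ ∧ 1 ≤ D ^ m * τ ∧
      ((1 / (2 * a) ≤ T.card * p ∧ T.card * p ≤ 1 / 2 ∧ ∀ j ∈ T, Real.sqrt p * τ ≤ |x j|) ∨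
        ∀ j ∉ T, |x j| ≤ Real.sqrt (a * p) * τ) by
    obtain ⟨T, τ, h1, h2, h3, h4, h5⟩ := hT
    have hrτ : r ≤ ε * τ := by
      calc r = r * 1 := (mul_one r).symm
        _ ≤ r * (D ^ m * τ) := by gcongr
        _ = r * D ^ m * τ := by ring
        _ ≤ ε * τ := by gcongr
    refine ⟨τ⁻¹ • x, isCoreVector_smul h1 hS hx1 h2 h3 h4 hSr hrτ h5, ?_⟩
    rw [map_smul, norm_smul, Real.norm_eq_abs, abs_of_pos (inv_pos.2 h3), inv_mul_eq_div,
      div_le_iff₀ h3]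
    calc _ ≤ r * Real.sqrt (p * n) := hR
      _ ≤ ε * τ * Real.sqrt (p * n) := by gcongr
      _ = _ := by ring
  by_cases hpa : p ≤ 1 / a
  · have hap : 0 < a * p := by positivity
    have hap1 : a * p ≤ 1 := by rw [le_div_iff₀ (by linarith)] at hpa; linarith
    -- For m = 0 the hypothesis would give p ≥ 1/8, against p ≤ 1/a < 1/8.
    have hm : 0 < m := by
      rcases Nat.eq_zero_or_pos m with h0 | h0
      · rw [h0, pow_zero, div_le_one (by positivity)] at hpm
        nlinarith
      · exact h0
    have hk1 : (coreSize p q : ℝ) ≤ 1 / (a * p) := Nat.floor_le (by positivity)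
    obtain ⟨T, hT1, hT2, hT3⟩ := hA.exists_core hq hp hd hK hR hx1 hpa hm hDK
      (by
        have h1 : r ^ 2 * (D ^ 2) ^ m * D ^ 12 = 1 := by
          calc r ^ 2 * (D ^ 2) ^ m * D ^ 12 = (r * D ^ (m + 6)) ^ 2 := by ring
            _ = 1 := by rw [hr, one_pow]
        calc 2 * (256 / q * r ^ 2) * (D ^ 2) ^ m = r ^ 2 * (D ^ 2) ^ m * (512 / q) := by ring
          _ ≤ r ^ 2 * (D ^ 2) ^ m * D ^ 12 := by gcongr
          _ = 1 := h1)
      (hk1.trans (le_trans (one_div_le_one_div_of_le (by positivity) (by gcongr)) hpm))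
    set τ := ‖restrict Tᶜ x‖ with hτ
    have hτ1 : 1 ≤ D ^ m * τ := by
      have h1 : 1 ≤ (D ^ m * τ) ^ 2 := by rw [mul_pow, ← pow_mul, mul_comm m 2, pow_mul]; exact hT3
      exact (one_le_sq_iff₀ (by positivity)).1 h1
    have hτ0 : 0 < τ := by
      refine lt_of_le_of_ne (norm_nonneg _) fun h0 => ?_
      rw [← h0, mul_zero] at hτ1
      linarith
    refine ⟨T, τ, by rw [hT1]; exact le_max_right _ _, rfl, hτ0, hτ1, ?_⟩
    -- Either the whole core is large compared with √p·τ, or one of its coordinates is not, and then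
    -- no coordinate outside the core exceeds that one.
    by_cases hall : ∀ j ∈ T, Real.sqrt p * τ ≤ |x j|
    · refine Or.inl ⟨?_, ?_, hall⟩
      · have h1 : 1 ≤ 1 / (a * p) := by rw [le_div_iff₀ hap]; linarith
        have h2 : 1 / (a * p) / 2 ≤ coreSize p q := by
          have h3 := Nat.lt_floor_add_one (1 / (a * p))
          have h4 : 1 ≤ ⌊1 / (a * p)⌋₊ := Nat.le_floor (by exact_mod_cast h1)
          have h5 : (1 : ℝ) ≤ (⌊1 / (a * p)⌋₊ : ℝ) := by exact_mod_cast h4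
          change _ ≤ ((⌊1 / (a * p)⌋₊ : ℕ) : ℝ)
          linarith
        rw [hT1]
        calc 1 / (2 * a) = 1 / (a * p) / 2 * p := by field_simp
          _ ≤ _ := by gcongr
      · rw [hT1]
        refine (coreSize_mul_le hp).trans ?_
        exact one_div_le_one_div_of_le (by norm_num) (by linarith)
    · push Not at hall
      obtain ⟨j₀, hj₀, hj₀'⟩ := hall
      refine Or.inr fun j hj => (hT2 j₀ hj₀ j hj).trans (hj₀'.le.trans ?_)
      gcongr
      nlinarith
  · have hTx : restrict (∅ : Finset (Fin n))ᶜ x = x := by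
      ext j
      simp [restrict_apply]
    -- For p > 1/a no core is needed: all coordinates are at most 1 ≤ √(ap).
    refine ⟨∅, 1, by simp, by rw [hTx, hx1], one_pos, by rw [mul_one]; exact hDm,
      Or.inr fun j _ => ?_⟩
    have h1 : |x j| ≤ 1 := by
      have := PiLp.norm_apply_le x j
      rwa [hx1, Real.norm_eq_abs] at this
    have h2 : 1 ≤ a * p := by
      rw [not_le, div_lt_iff₀ (by linarith)] at hpa
      linarith
    rw [mul_one]
    exact h1.trans (Real.one_le_sqrt.2 h2)

theorem exists_nat_eq_ellZero (hp : 0 < p) (hp1 : p ≤ 1) (hd : 100 ≤ p * n) :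
    ∃ m : ℕ, ellZero n p = m ∧ (m : ℝ) ≤ Real.log n + 1 ∧
      1 / (8 * p) ≤ Real.sqrt (p * n) ^ m := by
  have hn : (1 : ℝ) ≤ n := by
    have : p * n ≤ 1 * n := by gcongr
    linarith
  have hs10 : 10 ≤ Real.sqrt (p * n) := Real.le_sqrt_of_sq_le (by linarith)
  set s := Real.log (Real.sqrt (p * n)) with hs
  have hs1 : 1 ≤ s := by
    rw [hs, Real.le_log_iff_exp_le (by linarith)]
    have := Real.exp_one_lt_d9
    linarith
  set t := Real.log (1 / (8 * p)) with ht
  -- For dense matrices the logarithm in the numerator is negative, but 8p ≤ 8 < √(pn) keeps the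
  -- ceiling nonnegative.
  have h1 : -1 < t / s := by
    rw [lt_div_iff₀ (by linarith)]
    have h2 : Real.log (8 * p) < s := Real.log_lt_log (by positivity) (by linarith)
    have h3 : t = -Real.log (8 * p) := by rw [ht, one_div, Real.log_inv]
    linarith
  have h2 : 0 ≤ ellZero n p := by
    have : -1 < ellZero n p := Int.lt_ceil.2 (by push_cast; exact h1)
    omega
  obtain ⟨m, hm⟩ := Int.eq_ofNat_of_zero_le h2
  refine ⟨m, hm, ?_, ?_⟩
  · have h3 : (ellZero n p : ℝ) < t / s + 1 := Int.ceil_lt_add_one _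
    rw [hm] at h3
    have h4 : t / s ≤ Real.log n := by
      rw [div_le_iff₀ (by linarith)]
      have h5 : t ≤ Real.log n := by
        refine Real.log_le_log (by positivity) ?_
        rw [div_le_iff₀ (by positivity)]
        linarith
      exact h5.trans (le_mul_of_one_le_right (Real.log_nonneg hn) hs1)
    push_cast at h3
    linarith
  · have h3 : t / s ≤ (ellZero n p : ℝ) := Int.le_ceil _
    rw [hm, div_le_iff₀ (by linarith)] at h3
    push_cast at h3
    rw [← Real.log_le_log_iff (by positivity) (by positivity), Real.log_pow]
    exact h3

theorem rho_mul_pow {m : ℕ} (hD : 0 < D) (hm : ellZero n p = m) : rho D n p * D ^ (m + 6) = 1 := by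
  rw [rho, hm, ← zpow_natCast, ← zpow_add₀ hD.ne']
  push_cast
  ring_nf
  simp

end CoreVectors
end SparseRandomMatrix

namespace SparseRandomMatrix

/-! ### Compressible vectors for fixed λ, and discretization of the eigenvalue. -/

section Compressible

variable {Ω : Type*} [MeasurableSpace Ω] {P : Measure Ω} {n : ℕ} {p B : ℝ}
  {δ ξ : Sym2 (Fin n) → Ω → ℝ}

/-- The logarithm of the net size per coordinate, up to terms of lower order. -/
noncomputable def netConst (B q ε : ℝ) : ℝ :=
  1 + Real.log (128 / rowConst B q (Real.exp (128 / q))) + Real.log (1 / ε)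

theorem rowConst_le_one {q a : ℝ} (ha : 0 < a) : rowConst B q a ≤ 1 := by
  refine (min_le_right _ _).trans ?_
  rw [div_le_one (by positivity)]
  have : 0 ≤ 96 * B ^ 4 * a := by positivity
  linarith

theorem one_le_netConst {q ε : ℝ} (hq : 0 < q) (hε : 0 < ε) (hε1 : ε ≤ 1) :
    1 ≤ netConst B q ε := by
  have hc := rowConst_pos (B := B) hq (Real.exp_pos (128 / q))
  have hc1 := rowConst_le_one (B := B) (q := q) (Real.exp_pos (128 / q))
  have h1 : 0 ≤ Real.log (128 / rowConst B q (Real.exp (128 / q))) :=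
    Real.log_nonneg (by rw [le_div_iff₀ hc]; linarith)
  have h2 : 0 ≤ Real.log (1 / ε) := Real.log_nonneg (by rw [le_div_iff₀ hε]; linarith)
  rw [netConst]
  linarith

theorem IsSparseModel.measureReal_exists_comp_le [IsProbabilityMeasure P]
    (h : IsSparseModel P n p B δ ξ) (hB : 0 < B) (hp0 : 0 < p) (hp1 : p ≤ 1) {q : ℝ} (hq0 : 0 < q)
    (hq1 : q ≤ 1) (hq : ∀ e, p * q ≤ P.real {ω | δ e ω = 1 ∧ 1 / 2 ≤ |ξ e ω|})
    (hd : 1 ≤ p * n) {K ε D r : ℝ} {M m : ℕ} (hM : 0 < M) (hε : 0 < ε) (hε6 : ε ≤ 1 / 6)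
    (hεa : 8 * Real.exp (128 / q) * ε ^ 2 ≤ 1)
    (hεK : ε * (1 + 3 * K) ≤ Real.sqrt (rowConst B q (Real.exp (128 / q)) / 648)) (hK : 0 ≤ K)
    (hr : r * D ^ (m + 6) = 1) (hD : 1 ≤ D) (hDK : 2 * (256 / q * K ^ 2 + 1) ≤ D ^ 2)
    (hDq : 512 / q ≤ D ^ 12) (hDε : 1 ≤ ε * D ^ 6) (hpm : 1 / (8 * p) ≤ Real.sqrt (p * n) ^ m)
    (hmd : netConst B q ε + m * Real.log D ≤ rowConst B q (Real.exp (128 / q)) / 64 * (p * n))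
    (hMn : M * netConst B q ε ≤ rowConst B q (Real.exp (128 / q)) / 64 * n) (l : ℝ) :
    P.real {ω | (∀ x, ‖Matrix.toEuclideanLin (sparseMatrix δ ξ ω - Matrix.scalar (Fin n) l) x‖ ≤
        K * Real.sqrt (p * n) * ‖x‖) ∧ HasStructure (sparseMatrix δ ξ ω) p q ∧
      ∃ x ∈ Comp n M r,
        ‖Matrix.toEuclideanLin (sparseMatrix δ ξ ω - Matrix.scalar (Fin n) l) x‖ ≤
          r * Real.sqrt (p * n)} ≤
      Real.exp (-(rowConst B q (Real.exp (128 / q)) / 16 * (p * n))) := by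
  set a := Real.exp (128 / q) with ha
  have ha1 : 1 ≤ a := Real.one_le_exp (by positivity)
  set c := rowConst B q a with hc
  have hc0 : 0 < c := rowConst_pos hq0 (by positivity)
  have hkp : ((max 1 (coreSize p q) : ℕ) : ℝ) * p ≤ 1 := by
    rw [Nat.cast_max, Nat.cast_one, max_mul_of_nonneg _ _ hp0.le, one_mul]
    refine max_le hp1 ((coreSize_mul_le hp0).trans ?_)
    rw [div_le_one (by positivity)]
    exact ha1
  have hD0 : 0 < D := by linarith
  -- The norm bound D^m costs m log D per core coordinate; there are at most 1/p of them, so a cost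
  -- of order pn each is affordable.
  have hkn : ((max 1 (coreSize p q) : ℕ) : ℝ) *
      (1 + Real.log (128 / c) + Real.log (D ^ m / ε)) ≤ c / 64 * n := by
    have e1 : 1 + Real.log (128 / c) + Real.log (D ^ m / ε) =
        netConst B q ε + m * Real.log D := by
      rw [netConst, div_eq_mul_one_div (D ^ m), Real.log_mul (by positivity) (by positivity),
        Real.log_pow]
      ring
    rw [e1]
    calc _ ≤ ((max 1 (coreSize p q) : ℕ) : ℝ) * (c / 64 * (p * n)) := by gcongr
      _ = ((max 1 (coreSize p q) : ℕ) : ℝ) * p * (c / 64 * n) := by ring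
      _ ≤ 1 * (c / 64 * n) := by gcongr
      _ = _ := one_mul _
  have hmain := h.measureReal_exists_isCoreVector_le hB hp0 hq0 hq1 (a := a) (by positivity) hq
    (K := K) (ε := ε) (R := D ^ m) (k := max 1 (coreSize p q)) (M := M)
    (lt_max_of_lt_left one_pos) hM hε hε6 hεa hεK hK (one_le_pow₀ hD) hkn hMn l
  refine (measureReal_mono ?_ (measure_ne_top _ _)).trans (hmain.trans (Real.exp_le_exp.2 ?_))
  · rintro ω ⟨h1, h2, x, hx, h3⟩
    exact ⟨h1, h2.exists_isCoreVector hq0 hq1 hp0 hd h1 h3 hx hr hD hDK hDq hDε hpm⟩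
  · have : p * n ≤ 1 * n := by gcongr
    have : c / 16 * (p * n) ≤ c / 16 * n := by gcongr; linarith
    linarith

theorem norm_toEuclideanLin_sub_scalar_le {A : Matrix (Fin n) (Fin n) ℝ} {K l : ℝ}
    (x : EuclideanSpace ℝ (Fin n)) (h : ‖Matrix.toEuclideanLin A x‖ ≤ K * ‖x‖) :
    ‖Matrix.toEuclideanLin (A - Matrix.scalar (Fin n) l) x‖ ≤ (K + |l|) * ‖x‖ := by
  have h1 : Matrix.toEuclideanLin (A - Matrix.scalar (Fin n) l) x =
      Matrix.toEuclideanLin A x - l • x := by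
    ext i
    rw [toEuclideanLin_sub_scalar_apply]
    simp [Matrix.toLpLin_apply, Matrix.mulVec, dotProduct]
  rw [h1]
  refine (norm_sub_le _ _).trans ?_
  rw [norm_smul, Real.norm_eq_abs, add_mul]
  linarith

theorem toEuclideanLin_sub_scalar_of_hasEigenvector {A : Matrix (Fin n) (Fin n) ℝ} {l s : ℝ}
    {x : EuclideanSpace ℝ (Fin n)}
    (h : Module.End.HasEigenvector (Matrix.toEuclideanLin A) l x) :
    Matrix.toEuclideanLin (A - Matrix.scalar (Fin n) s) x = (l - s) • x := by
  have h1 := h.apply_eq_smul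
  ext i
  have h2 := congrArg (fun v : EuclideanSpace ℝ (Fin n) => v i) h1
  rw [toEuclideanLin_sub_scalar_apply]
  simp only [Matrix.toLpLin_apply, Matrix.mulVec, dotProduct, PiLp.smul_apply, smul_eq_mul] at h2
  rw [h2, PiLp.smul_apply, smul_eq_mul]
  ring

/-- Rounding the eigenvalue to a multiple of r·s turns an eigenvector into an almost-null vector for
one of at most 2K₀/r + 1 fixed shifts. -/
theorem measureReal_exists_eigenvector_le [IsProbabilityMeasure P] {A : Ω → Matrix (Fin n) (Fin n) ℝ}
    {X : Set (EuclideanSpace ℝ (Fin n))} (hX : ∀ x ∈ X, ‖x‖ = 1) {K₀ s r c t : ℝ}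
    (hK₀ : 0 ≤ K₀) (hs : 0 < s) (hr : 0 < r) {G : Set Ω}
    (hG : ∀ ω ∈ G, ∀ x, ‖Matrix.toEuclideanLin (A ω) x‖ ≤ K₀ * s * ‖x‖)
    (hl : ∀ l, |l| ≤ K₀ * s → P.real (G ∩ {ω | ∃ x ∈ X,
      ‖Matrix.toEuclideanLin (A ω - Matrix.scalar (Fin n) l) x‖ ≤ r * s}) ≤ Real.exp (-c))
    (ht : 2 * (K₀ / r) + 1 ≤ Real.exp t) :
    P.real (G ∩ {ω | ∃ x ∈ X, ∃ l : ℝ,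
      Module.End.HasEigenvector (Matrix.toEuclideanLin (A ω)) l x}) ≤ Real.exp (t - c) := by
  set N : Finset ℤ := (Finset.Icc (-⌊K₀ / r⌋) ⌊K₀ / r⌋) with hN
  set E : ℤ → Set Ω := fun z => G ∩ {ω | ∃ x ∈ X,
      ‖Matrix.toEuclideanLin (A ω - Matrix.scalar (Fin n) (r * s * z)) x‖ ≤ r * s} with hE
  have hNz : ∀ z ∈ N, |r * s * (z : ℝ)| ≤ K₀ * s := by
    intro z hz
    rw [hN, Finset.mem_Icc, ← abs_le, Int.le_floor] at hz
    push_cast at hz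
    rw [le_div_iff₀ hr] at hz
    rw [abs_mul, abs_of_pos (by positivity)]
    nlinarith
  have hsub : G ∩ {ω | ∃ x ∈ X, ∃ l : ℝ,
      Module.End.HasEigenvector (Matrix.toEuclideanLin (A ω)) l x} ⊆ ⋃ z ∈ N, E z := by
    rintro ω ⟨hω, x, hx, l, hxl⟩
    have h1 := hG ω hω x
    rw [hxl.apply_eq_smul, norm_smul, hX x hx, mul_one, mul_one, Real.norm_eq_abs] at h1
    -- Rounding towards zero keeps the shift in the range allowed by the norm bound.
    obtain ⟨z, hz1, hz2⟩ := exists_int_trunc (show 0 < r * s by positivity) l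
    refine Set.mem_iUnion₂.2 ⟨z, ?_, hω, x, hx, ?_⟩
    · rw [hN, Finset.mem_Icc, ← abs_le, Int.le_floor]
      push_cast
      rw [le_div_iff₀ hr]
      have h2 := hz2.trans h1
      rw [abs_mul, abs_of_pos (show 0 < r * s by positivity)] at h2
      refine le_of_mul_le_mul_right ?_ hs
      linarith
    · rw [toEuclideanLin_sub_scalar_of_hasEigenvector hxl, norm_smul, hX x hx, mul_one,
        Real.norm_eq_abs]
      exact hz1
  refine (measureReal_mono hsub (measure_ne_top _ _)).trans
    ((measureReal_biUnion_finset_le _ _).trans ?_)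
  calc ∑ z ∈ N, P.real (E z) ≤ ∑ z ∈ N, Real.exp (-c) :=
        Finset.sum_le_sum fun z hz => hl _ (hNz z hz)
    _ = N.card * Real.exp (-c) := by rw [Finset.sum_const, nsmul_eq_mul]
    _ ≤ Real.exp t * Real.exp (-c) := by
        gcongr
        refine le_trans ?_ ht
        have h0 : 0 ≤ ⌊K₀ / r⌋ := Int.floor_nonneg.2 (by positivity)
        have h1 : (N.card : ℤ) = 2 * ⌊K₀ / r⌋ + 1 := by
          rw [hN, Int.card_Icc, Int.toNat_of_nonneg (by omega)]
          ring
        have h2 : (N.card : ℝ) = 2 * (⌊K₀ / r⌋ : ℝ) + 1 := by exact_mod_cast h1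
        rw [h2]
        have := Int.floor_le (K₀ / r)
        linarith
    _ = _ := by rw [← Real.exp_add]; congr 1

theorem exists_log_le_sqrt {q : ℝ} (hq : 0 < q) :
    ∃ d₀ : ℝ, ∀ d, d₀ ≤ d → 8 * (3 + Real.log d) ≤ q / 64 * Real.sqrt d := by
  have h1 := (Real.isLittleO_log_id_atTop.def (show 0 < q / 2048 by positivity))
  have h2 := Real.tendsto_sqrt_atTop.eventually h1
  obtain ⟨d₁, hd₁⟩ := Filter.eventually_atTop.1 h2
  refine ⟨max d₁ (max 1 ((3072 / q) ^ 2)), fun d hd => ?_⟩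
  have hd1 : 1 ≤ d := (le_max_left _ _).trans ((le_max_right _ _).trans hd)
  have hd2 : 3072 / q ≤ Real.sqrt d :=
    Real.le_sqrt_of_sq_le ((le_max_right _ _).trans ((le_max_right _ _).trans hd))
  have h3 := hd₁ d ((le_max_left _ _).trans hd)
  rw [id, Real.norm_eq_abs, Real.norm_eq_abs, abs_of_nonneg (Real.sqrt_nonneg d),
    Real.log_sqrt (by linarith)] at h3
  have h4 := (le_abs_self _).trans h3
  rw [div_le_iff₀ hq] at hd2
  linarith

end Compressible
end SparseRandomMatrix

/-! ### Assembly of the estimates and choice of the constants. -/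

namespace SparseRandomMatrix

theorem sum_exp_le_exp {d q c : ℝ} (hd : 0 ≤ d) (hq1 : q ≤ 1)
    (h4 : 4 ≤ min (q / 64) (c / 32) * d) :
    Real.exp (-d) + 2 * Real.exp (-(d * q / 64)) + Real.exp (-(c / 32 * d)) ≤
      Real.exp (-(min (q / 64) (c / 32) / 2 * d)) := by
  set e := min (q / 64) (c / 32) with he
  have h1 : e * d ≤ q / 64 * d := mul_le_mul_of_nonneg_right (min_le_left _ _) hd
  have h2 : e * d ≤ c / 32 * d := mul_le_mul_of_nonneg_right (min_le_right _ _) hd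
  have h3 : q / 64 * d ≤ 1 * d := mul_le_mul_of_nonneg_right (by linarith) hd
  have e1 : Real.exp (-d) ≤ Real.exp (-(e * d)) := Real.exp_le_exp.2 (by linarith)
  have e2 : Real.exp (-(d * q / 64)) ≤ Real.exp (-(e * d)) := Real.exp_le_exp.2 (by linarith)
  have e3 : Real.exp (-(c / 32 * d)) ≤ Real.exp (-(e * d)) := Real.exp_le_exp.2 (by linarith)
  have e4 : (4 : ℝ) ≤ Real.exp (e / 2 * d) := by
    have h5 := Real.quadratic_le_exp_of_nonneg (show 0 ≤ e / 2 * d by linarith)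
    nlinarith
  calc _ ≤ 4 * Real.exp (-(e * d)) := by linarith
    _ ≤ Real.exp (e / 2 * d) * Real.exp (-(e * d)) := by gcongr
    _ = _ := by rw [← Real.exp_add]; congr 1; ring

/-- Both estimates, with the conditions on the constants made explicit. -/
theorem IsSparseModel.comp_estimates {Ω : Type*} [MeasurableSpace Ω] {P : Measure Ω}
    [IsProbabilityMeasure P] {n : ℕ} {p B : ℝ} {δ ξ : Sym2 (Fin n) → Ω → ℝ}
    (h : IsSparseModel P n p B δ ξ) (hB : 0 < B) (hp0 : 0 < p) (hp1 : p ≤ 1) {q : ℝ} (hq0 : 0 < q)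
    (hq1 : q ≤ 1) (hq : ∀ e, p * q ≤ P.real {ω | δ e ω = 1 ∧ 1 / 2 ≤ |ξ e ω|})
    {K₀ K ε D : ℝ} {M : ℕ} (hK₀ : 0 ≤ K₀) (hKK : K₀ ≤ K)
    (hnorm : P.real {ω | ¬ ∀ x, ‖Matrix.toEuclideanLin (sparseMatrix δ ξ ω) x‖ ≤
        K₀ * Real.sqrt (p * n) * ‖x‖} ≤ Real.exp (-(p * n)))
    (hM : 0 < M) (hε : 0 < ε) (hε6 : ε ≤ 1 / 6) (hεa : 8 * Real.exp (128 / q) * ε ^ 2 ≤ 1)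
    (hεK : ε * (1 + 3 * (K₀ + K)) ≤ Real.sqrt (rowConst B q (Real.exp (128 / q)) / 648))
    (hD : 1 ≤ D) (hDK : 2 * (256 / q * (K₀ + K) ^ 2 + 1) ≤ D ^ 2)
    (hDq : 512 / q ≤ D ^ 12) (hDε : 1 ≤ ε * D ^ 6) (hd : 100 ≤ p * n)
    (hlog1 : Real.log n ≤ p * n * q / 128)
    (hlog2 : Real.log n * Real.log D ≤
      rowConst B q (Real.exp (128 / q)) / 256 * (p * n))
    (hd1 : 8 * (3 + Real.log (p * n)) ≤ q / 64 * Real.sqrt (p * n))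
    (hd2 : 128 / q ≤ Real.sqrt (p * n))
    (hd3 : netConst B q ε + 7 * Real.log D + Real.log (2 * K₀ + 1) ≤
      rowConst B q (Real.exp (128 / q)) / 256 * (p * n))
    (hd4 : 4 ≤ min (q / 64) (rowConst B q (Real.exp (128 / q)) / 32) * (p * n))
    (hMn : M * netConst B q ε ≤ rowConst B q (Real.exp (128 / q)) / 64 * n) :
    (∀ l : ℝ, |l| ≤ K * Real.sqrt (p * n) →
      P.real {ω | ∃ x ∈ Comp n M (rho D n p),
        ‖Matrix.toEuclideanLin (sparseMatrix δ ξ ω - Matrix.scalar (Fin n) l) x‖ ≤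
          rho D n p * Real.sqrt (p * n)} ≤
      Real.exp (-(min (q / 64) (rowConst B q (Real.exp (128 / q)) / 32) / 2 * (p * n)))) ∧
    P.real {ω | ∃ x ∈ Comp n M (rho D n p), ∃ l : ℝ,
        Module.End.HasEigenvector (Matrix.toEuclideanLin (sparseMatrix δ ξ ω)) l x} ≤
      Real.exp (-(min (q / 64) (rowConst B q (Real.exp (128 / q)) / 32) / 2 * (p * n))) := by
  set c := rowConst B q (Real.exp (128 / q)) with hc
  have hc0 : 0 < c := rowConst_pos hq0 (Real.exp_pos _)
  set s := Real.sqrt (p * n) with hs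
  have hs0 : 0 < s := Real.sqrt_pos.2 (by linarith)
  have hD0 : 0 < D := by linarith
  have hlogD : 0 ≤ Real.log D := Real.log_nonneg hD
  have hΛ := one_le_netConst (B := B) hq0 hε (by linarith)
  have hlogK : 0 ≤ Real.log (2 * K₀ + 1) := Real.log_nonneg (by linarith)
  obtain ⟨m, hm, hmn, hpm⟩ := exists_nat_eq_ellZero hp0 hp1 hd
  set r := rho D n p with hr
  have hrD : r * D ^ (m + 6) = 1 := rho_mul_pow hD0 hm
  have hr0 : 0 < r := zpow_pos hD0 _
  have hmD : m * Real.log D ≤ c / 256 * (p * n) + Real.log D := by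
    have : m * Real.log D ≤ (Real.log n + 1) * Real.log D := by gcongr
    linarith
  set G₁ := {ω | ∀ x, ‖Matrix.toEuclideanLin (sparseMatrix δ ξ ω) x‖ ≤ K₀ * s * ‖x‖} with hG₁
  set G₂ := {ω | HasStructure (sparseMatrix δ ξ ω) p q} with hG₂
  have hG₁c : P.real G₁ᶜ ≤ Real.exp (-(p * n)) := hnorm
  have hG₂c : P.real G₂ᶜ ≤ 2 * Real.exp (-(p * n * q / 64)) :=
    h.measureReal_not_hasStructure_le hp0 hq0 hq1 hq hlog1 (by linarith) hd1 hd2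
  have hfix : ∀ l : ℝ, |l| ≤ K * s → P.real (G₁ ∩ G₂ ∩ {ω | ∃ x ∈ Comp n M r,
      ‖Matrix.toEuclideanLin (sparseMatrix δ ξ ω - Matrix.scalar (Fin n) l) x‖ ≤ r * s}) ≤
      Real.exp (-(c / 16 * (p * n))) := by
    intro l hl
    refine (measureReal_mono ?_ (measure_ne_top _ _)).trans
      (h.measureReal_exists_comp_le hB hp0 hp1 hq0 hq1 hq (by linarith) (K := K₀ + K) hM hε hε6
        hεa hεK (by linarith) hrD hD hDK hDq hDε hpm (by linarith) hMn l)
    -- The shifted matrix has norm at most (K₀ + K)√(pn), the constant used throughout the net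
    -- argument.
    rintro ω ⟨⟨h1, h2⟩, h3⟩
    refine ⟨fun x => (norm_toEuclideanLin_sub_scalar_le x (h1 x)).trans ?_, h2, h3⟩
    have : K₀ * s + |l| ≤ (K₀ + K) * s := by linarith
    gcongr
  have htot : ∀ E : Set Ω, P.real (G₁ ∩ G₂ ∩ E) ≤ Real.exp (-(c / 32 * (p * n))) →
      P.real E ≤ Real.exp (-(min (q / 64) (c / 32) / 2 * (p * n))) := by
    intro E hE
    refine le_trans ?_ (sum_exp_le_exp (by linarith) hq1 hd4)
    have hsub : E ⊆ (G₁ᶜ ∪ G₂ᶜ) ∪ (G₁ ∩ G₂ ∩ E) := fun ω hω => by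
      by_cases h1 : ω ∈ G₁ <;> by_cases h2 : ω ∈ G₂ <;> simp [h1, h2, hω]
    refine (measureReal_mono hsub (measure_ne_top _ _)).trans ((measureReal_union_le _ _).trans ?_)
    have := measureReal_union_le (μ := P) G₁ᶜ G₂ᶜ
    linarith
  have hcd : 0 ≤ c * (p * n) := by positivity
  refine ⟨fun l hl => htot _ ((hfix l hl).trans (Real.exp_le_exp.2 (by linarith))), htot _ ?_⟩
  -- Half of the exponent c/16 pays for the eigenvalue net, whose size is of order D^(m + 6).
  refine (measureReal_exists_eigenvector_le (t := c / 32 * (p * n)) (fun x hx => hx.1) hK₀ hs0 hr0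
    (fun ω hω => hω.1) (fun l hl => hfix l (hl.trans (by gcongr))) ?_).trans
    (Real.exp_le_exp.2 (by linarith))
  have h1 : K₀ / r = K₀ * D ^ (m + 6) := by
    rw [div_eq_iff hr0.ne', mul_assoc, mul_comm (D ^ (m + 6)), hrD, mul_one]
  have h2 : 1 ≤ D ^ (m + 6) := one_le_pow₀ hD
  calc 2 * (K₀ / r) + 1 ≤ (2 * K₀ + 1) * D ^ (m + 6) := by rw [h1]; linarith
    _ = Real.exp (Real.log (2 * K₀ + 1) + (m + 6 : ℕ) * Real.log D) := by
        rw [Real.exp_add, Real.exp_log (by linarith), Real.exp_nat_mul, Real.exp_log hD0]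
    _ ≤ _ := by
        refine Real.exp_le_exp.2 ?_
        push_cast
        linarith

end SparseRandomMatrix

theorem mainTheorem3 :
    ∀ B K : ℝ, 0 < B → 0 < K →
      -- `C₀` is the constant in the sparsity threshold, `Cbar` the base of `ρ`.
      ∃ C₀ C Cbar c c' c'' : ℝ,
        0 < C₀ ∧ 0 < C ∧ 1 < Cbar ∧ 0 < c ∧ 0 < c' ∧ 0 < c'' ∧
        ∀ {Ω : Type*} [MeasurableSpace Ω] (P : Measure Ω) [IsProbabilityMeasure P]
          (n : ℕ) (p : ℝ) (δ ξ : Sym2 (Fin n) → Ω → ℝ) (M : ℕ),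
          SparseRandomMatrix.IsSparseModel P n p B δ ξ →
          0 < p → p ≤ 1 → C₀ * Real.log n / n ≤ p →
          p⁻¹ ≤ (M : ℝ) → (M : ℝ) ≤ c * n →
          (∀ l : ℝ, l ∈ Set.Icc (-(K * Real.sqrt (p * n))) (K * Real.sqrt (p * n)) →
            P.real {ω | ∃ x ∈ SparseRandomMatrix.Comp n M (SparseRandomMatrix.rho Cbar n p),
                ‖Matrix.toEuclideanLin
                    (SparseRandomMatrix.sparseMatrix δ ξ ω - Matrix.scalar (Fin n) l) x‖ ≤
                  C * SparseRandomMatrix.rho Cbar n p * Real.sqrt (p * n)} ≤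
              Real.exp (-(c' * (p * n)))) ∧
          P.real {ω | ∃ x ∈ SparseRandomMatrix.Comp n M (SparseRandomMatrix.rho Cbar n p),
              ∃ l : ℝ, Module.End.HasEigenvector
                (Matrix.toEuclideanLin (SparseRandomMatrix.sparseMatrix δ ξ ω)) l x} ≤
            Real.exp (-(c'' * (p * n))) := by
  intro B K hB hK
  obtain ⟨K₀, hK₀, hnorm⟩ := SparseRandomMatrix.IsSparseModel.norm_le hB
  obtain ⟨q, hq⟩ : ∃ q : ℝ, q = min 1 (1 / (96 * B ^ 4)) := ⟨_, rfl⟩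
  have hq0 : 0 < q := by rw [hq]; positivity
  have hq1 : q ≤ 1 := by rw [hq]; exact min_le_left _ _
  set a := Real.exp (128 / q) with ha
  have ha0 : 0 < a := Real.exp_pos _
  set c := SparseRandomMatrix.rowConst B q a with hc
  have hc0 : 0 < c := SparseRandomMatrix.rowConst_pos hq0 ha0
  -- The eigenvalue net reaches up to K₀√(pn), so the fixed-shift estimate must cover that range as
  -- well.
  set K' := max K K₀ with hK'
  have hK'0 : K₀ ≤ K' := le_max_right _ _
  set ε := min (1 / 6) (min (1 / (8 * a)) (Real.sqrt (c / 648) / (1 + 3 * (K₀ + K')))) with hε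
  have hK3 : 0 < 1 + 3 * (K₀ + K') := by linarith
  have hε0 : 0 < ε := by
    refine lt_min (by norm_num) (lt_min (by positivity) (div_pos ?_ hK3))
    exact Real.sqrt_pos.2 (by positivity)
  have hε6 : ε ≤ 1 / 6 := min_le_left _ _
  have hεa : 8 * a * ε ^ 2 ≤ 1 := by
    have h1 : ε ≤ 1 / (8 * a) := (min_le_right _ _).trans (min_le_left _ _)
    rw [le_div_iff₀ (by positivity)] at h1
    nlinarith
  have hεK : ε * (1 + 3 * (K₀ + K')) ≤ Real.sqrt (c / 648) := by
    rw [← le_div_iff₀ hK3]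
    exact (min_le_right _ _).trans (min_le_right _ _)
  -- The sum of all the lower bounds required; as D ≥ 1, every positive power of D is at least D.
  obtain ⟨D, hD⟩ : ∃ D : ℝ,
      D = 2 + 512 / q + 2 * (256 / q * (K₀ + K') ^ 2 + 1) + 1 / ε := ⟨_, rfl⟩
  have t1 : 0 < 512 / q := by positivity
  have t2 : 0 < 2 * (256 / q * (K₀ + K') ^ 2 + 1) := by positivity
  have t3 : 0 < 1 / ε := by positivity
  have hD2 : 2 ≤ D := by linarith
  have hDpow : ∀ k : ℕ, k ≠ 0 → D ≤ D ^ k := fun k hk => le_self_pow₀ (by linarith) hk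
  have hlogD : 0 ≤ Real.log D := Real.log_nonneg (by linarith)
  have hDε : 1 ≤ ε * D ^ 6 := by
    have h1 : 1 / ε ≤ D ^ 6 := by have := hDpow 6 (by norm_num); linarith
    rw [div_le_iff₀ hε0] at h1
    linarith
  set Λ := SparseRandomMatrix.netConst B q ε with hΛ
  have hΛ1 : 1 ≤ Λ := SparseRandomMatrix.one_le_netConst hq0 hε0 (by linarith)
  obtain ⟨d₀, hd₀⟩ := SparseRandomMatrix.exists_log_le_sqrt hq0
  set e := min (q / 64) (c / 32) with he
  have he0 : 0 < e := lt_min (by positivity) (by positivity)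
  set d₁ := max 100 (max d₀ (max ((128 / q) ^ 2)
    (max ((Λ + 7 * Real.log D + Real.log (2 * K₀ + 1)) / (c / 256)) (4 / e)))) with hd₁
  have hd₁0 : 0 < d₁ := lt_of_lt_of_le (by norm_num) (le_max_left _ _)
  set C₀ := 1 + 128 / q + 256 * Real.log D / c with hC₀
  have u1 : 0 < 128 / q := by positivity
  have u2 : 0 ≤ 256 * Real.log D / c := by positivity
  have hC₀0 : 0 < C₀ := by linarith
  -- The part 1/d₁ of the constant c serves to force pn ≥ d₁ through p⁻¹ ≤ M ≤ cn; the other part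
  -- bounds the entropy of the M sparse coordinates.
  refine ⟨C₀, 1, D, min (c / (64 * Λ)) (1 / d₁), e / 2, e / 2, hC₀0, one_pos, by linarith,
    lt_min (by positivity) (by positivity), by positivity, by positivity, ?_⟩
  intro Ω _ P _ n p δ ξ M h hp0 hp1 hC hpM hMc
  have hM0 : (0 : ℝ) < M := (inv_pos.2 hp0).trans_le hpM
  have hn0 : (0 : ℝ) < n := by
    have h1 : (0 : ℝ) < min (c / (64 * Λ)) (1 / d₁) * n := hM0.trans_le hMc
    exact pos_of_mul_pos_right h1 (by positivity)
  have hn1 : (1 : ℝ) ≤ n := by exact_mod_cast Nat.one_le_iff_ne_zero.2 (by rintro rfl; simp at hn0)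
  have hlogn : 0 ≤ Real.log n := Real.log_nonneg hn1
  have hd : d₁ ≤ p * n := by
    have h1 : p⁻¹ ≤ 1 / d₁ * n :=
      hpM.trans (hMc.trans (mul_le_mul_of_nonneg_right (min_le_right _ _) hn0.le))
    have h2 : p * d₁ * p⁻¹ ≤ p * d₁ * (1 / d₁ * n) := mul_le_mul_of_nonneg_left h1 (by positivity)
    have h3 : p * d₁ * p⁻¹ = d₁ := by field_simp
    have h4 : p * d₁ * (1 / d₁ * n) = p * n := by field_simp
    rwa [h3, h4] at h2
  have hCn : C₀ * Real.log n ≤ p * n := by rwa [div_le_iff₀ hn0] at hC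
  have hd100 : 100 ≤ p * n := (le_max_left _ _).trans hd
  have hd' := (le_max_right _ _).trans hd
  have hdd₀ := (le_max_left _ _).trans hd'
  have hd'' := (le_max_right _ _).trans hd'
  have hdq := (le_max_left _ _).trans hd''
  have hd''' := (le_max_right _ _).trans hd''
  have hdΛ := (le_max_left _ _).trans hd'''
  have hde := (le_max_right _ _).trans hd'''
  have hlog0 : Real.log n ≤ p * n := by
    refine le_trans (le_mul_of_one_le_left hlogn (by linarith)) hCn
  have hlog1 : Real.log n ≤ p * n * q / 128 := by
    have h1 : 128 / q * Real.log n ≤ p * n :=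
      (mul_le_mul_of_nonneg_right (by linarith) hlogn).trans hCn
    rw [div_mul_eq_mul_div, div_le_iff₀ hq0] at h1
    linarith
  have hlog2 : Real.log n * Real.log D ≤ c / 256 * (p * n) := by
    have h1 : 256 * Real.log D / c * Real.log n ≤ p * n :=
      (mul_le_mul_of_nonneg_right (by linarith) hlogn).trans hCn
    rw [div_mul_eq_mul_div, div_le_iff₀ hc0] at h1
    linarith
  have hMn : M * Λ ≤ c / 64 * n := by
    have h1 : (M : ℝ) ≤ c / (64 * Λ) * n :=
      hMc.trans (mul_le_mul_of_nonneg_right (min_le_left _ _) hn0.le)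
    calc M * Λ ≤ c / (64 * Λ) * n * Λ := by gcongr
      _ = c / 64 * n := by field_simp
  obtain ⟨h1, h2⟩ := h.comp_estimates hB hp0 hp1 hq0 hq1
    (fun e => le_trans (by rw [hq]; gcongr; exact min_le_right _ _) (h.le_measureReal_good hB hp0.le e))
    hK₀.le hK'0 (hnorm P n p δ ξ h hp0 hp1 (by linarith) hlog0) (by exact_mod_cast hM0) hε0 hε6
    hεa hεK (by linarith) (by have := hDpow 2 (by norm_num); linarith)
    (by have := hDpow 12 (by norm_num); linarith) hDε hd100 hlog1 hlog2 (hd₀ _ hdd₀)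
    (Real.le_sqrt_of_sq_le hdq) (by rw [div_le_iff₀ (by positivity)] at hdΛ; linarith)
    (by rw [div_le_iff₀ he0] at hde; linarith) hMn
  refine ⟨fun l hl => ?_, h2⟩
  rw [one_mul]
  refine h1 l ((abs_le.2 hl).trans ?_)
  gcongr
  exact le_max_left _ _
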